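/- **Setting.** A rooted labelled tree $T$ of size $n\ge 1$ has node set $[n]=\{1,\dots,n\}$ and all edges directed towards the root. Consider, for an integer $d\ge 1$, the following families of rooted labelled trees: *ordered trees* (the children of each node form a sequence), *unordered trees* (the children of each node form a set), *$d$-ary trees* (each node has $d$ distinguishable positions, and to each of them at most one child is attached), and *$d$-bundled trees* (each node has $d$ distinguishable positions, and at each of them a possibly empty sequence of children is attached). Given $T$ of size $n$ and $s=(s_1,\dots,s_n)\in[n]^n$, drivers $1,\dots,n$ arrive one after the other; driver $i$ starts at node $s_i$, follows the path towards the root and parks at the first free node on it (if there is none, he leaves without parking). The pair $(T,s)$ is a *tree parking function* of size $n$ if all $n$ drivers park; it is *prime* if moreover every edge of $T$ is crossed by at least one driver searching for a free node. A (prime) tree parking function with $s_1\le\dots\le s_n$ is called a *(prime) tree parking distribution*. For a given tree family let $G_n$, $P_n$, $\tilde G_n$, $\tilde P_n$ be the numbers of tree parking functions, prime tree parking functions, tree parking distributions and prime tree parking distributions $(T,s)$ of size $n$ with $T$ in the family, and let $$G(z)=\sum_{n\ge1}G_n\frac{z^n}{(n!)^2},\quad P(z)=\sum_{n\ge1}P_n\frac{z^n}{(n!)^2},\quad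 \tilde G(z)=\sum_{n\ge1}\tilde G_n\frac{z^n}{n!},\quad \tilde P(z)=\sum_{n\ge1}\tilde P_n\frac{z^n}{n!}.$$ **Theorem.** For each of these tree families and each $X\in\{G,P,\tilde G,\tilde P\}$, one has, as formal power series, $$X=g(Q),\qquad Q=z\,\varphi(Q),$$ where $Q=Q(z)$ is the unique formal power series satisfying the second equation (it has $Q(0)=0$), and where $g$ and $\varphi$ are as follows. Tree parking functions: - ordered trees: $G=1-\frac{1}{(1-Q)(1+Q)e^{Q}}$, $\;Q=z(1+Q)^2e^{Q}$; - unordered trees: $G=2Q+\ln(1-Q)$, $\;Q=ze^{2Q}$; - $d$-ary trees: $G=\frac{(1-dQ)^{1/d}e^{Q}}{1-Q}-1$, $\;Q=z\frac{e^{dQ}}{(1-Q)^{d-1}}$; - $d$-bundled trees: $G=1-\frac{1}{(1-dQ)^{1/d}(1+Q)e^{Q}}$, $\;Q=z(1+Q)^{d+1}e^{dQ}$. Prime tree parking functions: - ordered trees: $P=(1+Q)(1-Q)e^{Q}-1$, $\;Q=\frac{z}{(1-Q)^2e^{Q}}$; - unordered trees: $P=2Q+\ln(1-Q)$, $\;Q=\frac{z}{1-Q}$;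 - $d$-ary trees: $P=1-\frac{1-Q}{(1-dQ)^{1/d}e^{Q}}$, $\;Q=z\frac{e^{Q}}{(1-dQ)^{(d-1)/d}}$; - $d$-bundled trees: $P=(1-dQ)^{1/d}(1+Q)e^{Q}-1$, $\;Q=\frac{z}{(1-dQ)^{(d+1)/d}e^{Q}}$. Tree parking distributions: - ordered trees: $\tilde G=1-\frac{1}{(1+Q)^2(1-Q)}$, $\;Q=z(1+Q)^4$; - unordered trees: $\tilde G=Q+\ln(1+Q)+\ln(1-Q)$, $\;Q=z(1+Q)^2e^{Q}$; - $d$-ary trees: $\tilde G=\frac{(1-Q^2)^{1/d}}{1-Q/d}-1$, $\;Q=\frac{dz(1+Q)^2}{(1-Q/d)^{d-1}}$; - $d$-bundled trees: $\tilde G=1-\frac{1}{(1+Q/d)(1-Q^2)^{1/d}}$, $\;Q=dz(1+Q)^2(1+Q/d)^{d+1}$. Prime tree parking distributions: - ordered trees: $\tilde P=(1+Q)^2(1-Q)-1$, $\;Q=\frac{z}{(1-Q)^2}$; - unordered trees: $\tilde P=Q+\ln(1+Q)+\ln(1-Q)$, $\;Q=\frac{z(1+Q)}{1-Q}$; - $d$-ary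 trees: $\tilde P=1-\frac{1-Q/d}{(1-Q^2)^{1/d}}$, $\;Q=\frac{dz(1+Q)^{(d+1)/d}}{(1-Q)^{(d-1)/d}}$; - $d$-bundled trees: $\tilde P=(1+Q/d)(1-Q^2)^{1/d}-1$, $\;Q=\frac{dz(1+Q)^{(d-1)/d}}{(1-Q)^{(d+1)/d}}$. -/

import Mathlib

namespace TreeParking

noncomputable section

/-! ### Labelled rooted trees -/

/-- A rooted tree on the vertex set `Fin n` (labels are `0, …, n-1`), all edges directed towards
the root. The edges are the pairs `(c, parent c)` with `c ≠ root`; the value `parent root = root`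
is a convention and not an edge. There is no such tree for `n = 0`. -/
structure RootedTree (n : ℕ) where
  root : Fin n
  parent : Fin n → Fin n
  parent_root : parent root = root
  reaches_root : ∀ v, ∃ k : ℕ, parent^[k] v = root

/-- The children of `v`, i.e. the roots of the subtrees attached to `v`. -/
abbrev RootedTree.Child {n : ℕ} (T : RootedTree n) (v : Fin n) : Type :=
  {c : Fin n // c ≠ T.root ∧ T.parent c = v}

/-- The combinatorial tree families. -/
inductive TreeFamily
  | ordered
  | unordered
  | dary (d : ℕ)
  | dbundled (d : ℕ)

/-- The ways in which a node with (finite) set `C` of children can arrange them: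
* ordered trees: the children form a sequence (the `i`-th child from the left, for each `i`);
* unordered trees: there is no further information;
* `d`-ary trees: the children occupy distinct positions among `d` positions;
* `d`-bundled trees: each child is put into one of `d` bundles, and the children in each bundle
  form a sequence. -/
def TreeFamily.Arrangement : TreeFamily → Type → Type
  | ordered, C => Fin (Nat.card C) ≃ C
  | unordered, _ => Unit
  | dary d, C => C ↪ Fin d
  | dbundled d, C =>
      Σ b : C → Fin d, ∀ j : Fin d, Fin (Nat.card {c : C // b c = j}) ≃ {c : C // b c = j}

/-- The labelled trees of size `n` of a family: rooted trees on `Fin n` with an arrangement of the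
children of each node. -/
structure LabelledTree (F : TreeFamily) (n : ℕ) extends RootedTree n where
  arr : ∀ v : Fin n, F.Arrangement (toRootedTree.Child v)

/-! ### The parking procedure -/

namespace RootedTree

variable {n m : ℕ} (T : RootedTree n)

open Classical in
/-- The node where a driver with preferred node `v` parks, if the nodes in `occ` are occupied: the
first free node on the path from `v` to the root, or `none` if there is no free node there. -/
def freeSpot (occ : Finset (Fin n)) (v : Fin n) : Option (Fin n) :=
  if h : ∃ k : ℕ, T.parent^[k] v ∉ occ then some (T.parent^[Nat.find h] v) else none

/-- The set of occupied nodes after the arrival of a driver with preferred node `v`. -/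
def arrive (occ : Finset (Fin n)) (v : Fin n) : Finset (Fin n) :=
  match T.freeSpot occ v with
  | some w => insert w occ
  | none => occ

/-- The set of occupied nodes at the moment when driver `i` arrives. -/
def occupiedBefore (s : Fin m → Fin n) (i : Fin m) : Finset (Fin n) :=
  ((List.ofFn s).take i).foldl T.arrive ∅

/-- All drivers of the sequence `s` of preferences are able to park. -/
def AllPark (s : Fin m → Fin n) : Prop :=
  ∀ i : Fin m, (T.freeSpot (T.occupiedBefore s i) (s i)).isSome

/-- A driver with preferred node `v` who finds the nodes in `occ` occupied passes through `c` and
leaves it along the edge `(c, parent c)` (for `c ≠ root`) in search of a free node: all nodes on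
the path from `v` up to and including `c` are occupied. -/
def Crosses (occ : Finset (Fin n)) (v c : Fin n) : Prop :=
  ∃ k : ℕ, T.parent^[k] v = c ∧ ∀ j ≤ k, T.parent^[j] v ∈ occ

/-- Every edge of the tree is used by some driver during the parking procedure. -/
def AllEdgesUsed (s : Fin m → Fin n) : Prop :=
  ∀ c : Fin n, c ≠ T.root → ∃ i : Fin m, T.Crosses (T.occupiedBefore s i) (s i) c

end RootedTree

/-- `(T, s)` is a tree parking function of size `n`: there are `n` nodes and `n` drivers, and all
drivers are able to park. -/
def IsParkingFunction {F : TreeFamily} {n : ℕ} (T : LabelledTree F n) (s : Fin n → Fin n) : Prop :=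
  T.toRootedTree.AllPark s

/-- Prime tree parking functions: all edges are used. -/
def IsPrimeParkingFunction {F : TreeFamily} {n : ℕ} (T : LabelledTree F n) (s : Fin n → Fin n) :
    Prop :=
  IsParkingFunction T s ∧ T.toRootedTree.AllEdgesUsed s

/-- Tree parking distributions: the preferences are non-decreasing. -/
def IsParkingDistribution {F : TreeFamily} {n : ℕ} (T : LabelledTree F n) (s : Fin n → Fin n) :
    Prop :=
  IsParkingFunction T s ∧ Monotone s

/-- Prime tree parking distributions. -/
def IsPrimeParkingDistribution {F : TreeFamily} {n : ℕ} (T : LabelledTree F n)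
    (s : Fin n → Fin n) : Prop :=
  IsPrimeParkingFunction T s ∧ Monotone s

/-! ### Counting and generating functions -/

/-- The number `G_n` of tree parking functions of size `n`. -/
def numG (F : TreeFamily) (n : ℕ) : ℕ :=
  Nat.card {p : LabelledTree F n × (Fin n → Fin n) // IsParkingFunction p.1 p.2}

/-- The number `P_n` of prime tree parking functions of size `n`. -/
def numP (F : TreeFamily) (n : ℕ) : ℕ :=
  Nat.card {p : LabelledTree F n × (Fin n → Fin n) // IsPrimeParkingFunction p.1 p.2}

/-- The number `G̃_n` of tree parking distributions of size `n`. -/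
def numGt (F : TreeFamily) (n : ℕ) : ℕ :=
  Nat.card {p : LabelledTree F n × (Fin n → Fin n) // IsParkingDistribution p.1 p.2}

/-- The number `P̃_n` of prime tree parking distributions of size `n`. -/
def numPt (F : TreeFamily) (n : ℕ) : ℕ :=
  Nat.card {p : LabelledTree F n × (Fin n → Fin n) // IsPrimeParkingDistribution p.1 p.2}

/-- The double-exponential generating function `∑_{n ≥ 1} a n z^n / (n!)^2`. -/
def doubleExpGF (a : ℕ → ℕ) : PowerSeries ℚ :=
  PowerSeries.mk fun n => if n = 0 then 0 else (a n : ℚ) / (n.factorial : ℚ) ^ 2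

/-- The exponential generating function `∑_{n ≥ 1} a n z^n / n!`. -/
def expGF (a : ℕ → ℕ) : PowerSeries ℚ :=
  PowerSeries.mk fun n => if n = 0 then 0 else (a n : ℚ) / (n.factorial : ℚ)

/-- `G(z)` -/
def G (F : TreeFamily) : PowerSeries ℚ := doubleExpGF (numG F)

/-- `P(z)` -/
def P (F : TreeFamily) : PowerSeries ℚ := doubleExpGF (numP F)

/-- `G̃(z)` -/
def Gt (F : TreeFamily) : PowerSeries ℚ := expGF (numGt F)

/-- `P̃(z)` -/
def Pt (F : TreeFamily) : PowerSeries ℚ := expGF (numPt F)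

/-! ### Elementary functions of formal power series -/

/-- `e^f` for a formal power series `f` with constant term `0`. -/
def fexp (f : PowerSeries ℚ) : PowerSeries ℚ := (PowerSeries.exp ℚ).subst f

/-- `ln f` for a formal power series `f` with constant term `1`. -/
def fln (f : PowerSeries ℚ) : PowerSeries ℚ := (PowerSeries.log ℚ).subst (f - 1)

/-- `f^a`, with `a` rational, for a formal power series `f` with constant term `1`. -/
def fpow (f : PowerSeries ℚ) (a : ℚ) : PowerSeries ℚ :=
  (PowerSeries.binomialSeries ℚ a).subst (f - 1)

/-- The series `A(z)` is given by `A = g(Q)`, `Q = z φ(Q)`: there is exactly one formal power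
series `Q = Q(z)` with `Q = z φ(Q)`; it has constant term `0` (so that the compositions are those
of formal power series), and `A = g(Q)`. -/
def ImplicitForm (A g φ : PowerSeries ℚ) : Prop :=
  ∃ Q : PowerSeries ℚ,
    PowerSeries.constantCoeff Q = 0 ∧
    Q = PowerSeries.X * φ.subst Q ∧
    (∀ Q' : PowerSeries ℚ, Q' = PowerSeries.X * φ.subst Q' → Q' = Q) ∧
    A = g.subst Q

/-- The variable in which `g` and `φ` are written. -/
abbrev q : PowerSeries ℚ := PowerSeries.X

end

end TreeParking

open TreeParking

/-! Let the load `m v` be the number of drivers preferring `v`. Parking is a conservation law: of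
the drivers starting in the subtree of `v`, each one parks in it or leaves it through `v`
(`card_occupiedAfter_inter_desc`). Hence all drivers park iff every subtree carries at least as much
load as it has nodes, and the function is prime iff moreover the inequality is strict below the root
(`allPark_iff`, `allEdgesUsed_iff`). The order of the drivers no longer matters: a load arises from
`n! / ∏ (m v)!` sequences, and from exactly one monotone sequence. So everything reduces to weighted
trees with loads, where a node of load `j` has weight `[u^j] A(u)`, with `A = exp` for functions and
`A = 1/(1-u)` for distributions, and a node with `k` children has weight `k! [t^k] φ(t)`, with `φ`
the degree series of the family.

To make this recursive, trees whose total load exceeds their size by `e` are admitted, with `u`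
marking the excess `e` and `z` the size. Removing the root leaves a set of trees, each of excess at
least `b` (`b = 0` in general, `b = 1` for primes). If `F(z,u)` enumerates the trees and `K` is its
part of `u`-order at least `b`, then `u F` is `z A(u) φ(K)` minus its value at `u = 0`
(`treeSum_eq`, `forestSum_succ`, `treeSum_eq_factorial_mul_coeff`). For `b = 0` one has `K = F` and
the subtracted term is `z φ(g)`, where `g = F(z,0)` is the wanted series; for `b = 1` one has `K = F
- g`, and the term is `z` (`catalytic_of_treeSum`, `primeCatalytic_of_treeSum`).

Such an equation with a catalytic variable is solved by the kernel method (`kernel_method`): along a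
series `u = U(z)` at which the coefficient of `∂K/∂u` in the differentiated equation vanishes, there
are three equations for `U`, `k = K(z,U)` and `g`. A suitable `Q`, rational in `U` or in `k` and
`g`, parametrizes their solution. The remaining identities between exponentials and rational powers
become linear after taking logarithmic derivatives (`eq_of_ld_eq`). -/

open TreeParking

namespace TreeParking
open PowerSeries Finset

/-! ### Contractions of the ring of formal power series -/

section FixedPoint

variable {R : Type*} [CommRing R]

/-- A self-map of `R⟦X⟧` which is contracting for the `X`-adic metric. -/
def Contracting (Φ : R⟦X⟧ → R⟦X⟧) : Prop :=
  ∀ (n : ℕ) (f g : R⟦X⟧), X ^ n ∣ f - g → X ^ (n + 1) ∣ Φ f - Φ g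

lemma eq_of_forall_X_pow_dvd {f g : R⟦X⟧} (h : ∀ n : ℕ, X ^ n ∣ f - g) : f = g := by
  ext n
  have := X_pow_dvd_iff.1 (h (n + 1)) n n.lt_succ_self
  rwa [map_sub, sub_eq_zero] at this

lemma Contracting.unique {Φ : R⟦X⟧ → R⟦X⟧} (h : Contracting Φ) {f g : R⟦X⟧} (hf : f = Φ f)
    (hg : g = Φ g) : f = g := by
  refine eq_of_forall_X_pow_dvd fun n => ?_
  induction n with
  | zero => simp
  | succ n ih => rw [hf, hg]; exact h n f g ih

lemma Contracting.exists_fixed {Φ : R⟦X⟧ → R⟦X⟧} (h : Contracting Φ) : ∃ f, f = Φ f := by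
  have step : ∀ n k : ℕ, X ^ n ∣ Φ^[n + k] 0 - Φ^[n] 0 := by
    intro n
    induction n with
    | zero => simp
    | succ n ih =>
      intro k
      rw [show n + 1 + k = (n + k) + 1 by ring, Function.iterate_succ_apply',
        Function.iterate_succ_apply']
      exact h n _ _ (ih k)
  -- By `step`, the `n`-th coefficient no longer changes from the iterate `n + 1` on.
  let f : R⟦X⟧ := mk fun n => coeff n (Φ^[n + 1] 0)
  have hf : ∀ n, X ^ n ∣ f - Φ^[n] 0 := by
    intro n
    rw [X_pow_dvd_iff]
    intro m hm
    obtain ⟨k, rfl⟩ := Nat.exists_eq_add_of_lt hm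
    have := X_pow_dvd_iff.1 (step (m + 1) k) m m.lt_succ_self
    rw [map_sub, sub_eq_zero] at this
    simp only [f, map_sub, coeff_mk, sub_eq_zero]
    rw [← this, add_right_comm]
  refine ⟨f, eq_of_forall_X_pow_dvd fun n => ?_⟩
  have h1 := hf (n + 1)
  have h2 := h n _ _ (hf n)
  rw [Function.iterate_succ_apply'] at h1
  exact (pow_dvd_pow X n.le_succ).trans (by simpa using dvd_sub h1 h2)

end FixedPoint

/-! ### Substitution into a series, computed by truncation -/

section Subst

variable {S : Type*} [CommRing S] [Algebra ℚ S]

omit [Algebra ℚ S] in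
lemma coeff_pow_eq_zero_of_lt {K : S⟦X⟧} (hK : constantCoeff K = 0) {n k : ℕ} (h : n < k) :
    coeff n (K ^ k) = 0 :=
  X_pow_dvd_iff.1 (pow_dvd_pow_of_dvd (X_dvd_iff.2 hK) k) n h

lemma coeff_subst_eq_sum (φ : ℚ⟦X⟧) {K : S⟦X⟧} (hK : constantCoeff K = 0) {n N : ℕ}
    (h : n ≤ N) :
    coeff n (φ.subst K) = ∑ k ∈ range (N + 1), coeff k φ • coeff n (K ^ k) := by
  rw [coeff_subst' (HasSubst.of_constantCoeff_zero' hK)]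
  refine finsum_eq_sum_of_support_subset _ fun k hk => ?_
  by_contra hk'
  simp only [coe_range, Set.mem_Iio, not_lt] at hk'
  exact hk (by simp [coeff_pow_eq_zero_of_lt hK (show n < k by omega)])

/-- The truncation of `φ.subst K`. -/
lemma X_pow_dvd_subst_sub_sum (φ : ℚ⟦X⟧) {K : S⟦X⟧} (hK : constantCoeff K = 0) (N : ℕ) :
    X ^ N ∣ φ.subst K - ∑ k ∈ range (N + 1), coeff k φ • K ^ k := by
  rw [X_pow_dvd_iff]
  intro n hn
  rw [map_sub, coeff_subst_eq_sum φ hK hn.le, map_sum, sub_eq_zero]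
  simp

/-- `K - L` divides every `K ^ k - L ^ k`. So substitution does not expand `X`-adic distances, and
one further factor `X` turns it into a contraction. -/
lemma X_pow_dvd_subst_sub_subst (φ : ℚ⟦X⟧) {K L : S⟦X⟧} (hK : constantCoeff K = 0)
    (hL : constantCoeff L = 0) {n : ℕ} (h : X ^ n ∣ K - L) :
    X ^ n ∣ φ.subst K - φ.subst L := by
  have h1 := X_pow_dvd_subst_sub_sum φ hK n
  have h2 := X_pow_dvd_subst_sub_sum φ hL n
  have h3 : X ^ n ∣ (∑ k ∈ range (n + 1), coeff k φ • K ^ k)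
      - ∑ k ∈ range (n + 1), coeff k φ • L ^ k := by
    rw [← sum_sub_distrib]
    refine dvd_sum fun k _ => ?_
    rw [← smul_sub]
    exact dvd_smul_of_dvd _ (h.trans (sub_dvd_pow_sub_pow K L k))
  have := (h1.sub h2).add h3
  convert this using 1
  ring

lemma constantCoeff_subst' (φ : ℚ⟦X⟧) {K : S⟦X⟧} (hK : constantCoeff K = 0) :
    constantCoeff (φ.subst K) = algebraMap ℚ S (constantCoeff φ) := by
  rw [← coeff_zero_eq_constantCoeff_apply, coeff_subst_eq_sum φ hK le_rfl]
  simp [Algebra.smul_def]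

end Subst

/-- The constant coefficient is subtracted so that the map is meaningful for all series; at a fixed
point the factor `X` makes this correction zero. -/
lemma contracting_X_mul_subst (φ : ℚ⟦X⟧) :
    Contracting fun f : ℚ⟦X⟧ => X * φ.subst (f - C (constantCoeff f)) := by
  intro n f g h
  rw [← mul_sub, pow_succ']
  refine mul_dvd_mul_left _ (X_pow_dvd_subst_sub_subst φ (by simp) (by simp) ?_)
  rcases n with _ | n
  · simp
  · have : constantCoeff f = constantCoeff g := by
      simpa [sub_eq_zero] using X_pow_dvd_iff.1 h 0 n.succ_pos
    simpa [this] using h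

lemma eq_X_mul_subst_unique (φ : ℚ⟦X⟧) {Q Q' : ℚ⟦X⟧} (h : Q = X * φ.subst Q)
    (h' : Q' = X * φ.subst Q') : Q' = Q := by
  have hc : ∀ f : ℚ⟦X⟧, f = X * φ.subst f → f = X * φ.subst (f - C (constantCoeff f)) := by
    intro f hf
    have : constantCoeff f = 0 := by rw [hf]; simp
    simpa [this] using hf
  exact (contracting_X_mul_subst φ).unique (hc _ h') (hc _ h)

lemma ImplicitForm.intro {A g φ Q : ℚ⟦X⟧} (h : Q = X * φ.subst Q) (hA : A = g.subst Q) :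
    ImplicitForm A g φ :=
  ⟨Q, by rw [h]; simp, h, fun _ h' => eq_X_mul_subst_unique φ h h', hA⟩

/-! ### Derivation with respect to the inner variable -/

section Bivariate

/-- A derivation applied to the coefficients of a power series. -/
noncomputable def mapCoeffDeriv {S : Type*} [CommRing S] [Algebra ℚ S] (D : Derivation ℚ S S) :
    Derivation ℚ S⟦X⟧ S⟦X⟧ :=
  Derivation.mk'
    { toFun := fun f => mk fun n => D (coeff n f)
      map_add' := fun f g => by ext n; simp
      map_smul' := fun c f => by ext n; simp }
    (fun f g => by
      ext n
      simp only [LinearMap.coe_mk, AddHom.coe_mk, coeff_mk, smul_eq_mul, map_add, coeff_mul,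
        map_sum, Derivation.leibniz, sum_add_distrib]
      congr 1
      exact Finset.Nat.sum_antidiagonal_swap
        (f := fun x => coeff x.1 g * D (coeff x.2 f)))

variable {S : Type*} [CommRing S] [Algebra ℚ S] (D : Derivation ℚ S S)

@[simp] lemma coeff_mapCoeffDeriv (f : S⟦X⟧) (n : ℕ) :
    coeff n (mapCoeffDeriv D f) = D (coeff n f) := by
  simp [mapCoeffDeriv]

lemma mapCoeffDeriv_C (a : S) : mapCoeffDeriv D (C a) = C (D a) := by
  ext n
  simp only [coeff_mapCoeffDeriv, coeff_C]
  split_ifs <;> simp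

lemma mapCoeffDeriv_X : mapCoeffDeriv D (X : S⟦X⟧) = 0 := by
  ext n
  simp only [coeff_mapCoeffDeriv, coeff_X]
  split_ifs <;> simp

lemma mapCoeffDeriv_map (f : ℚ⟦X⟧) : mapCoeffDeriv D (map (algebraMap ℚ S) f) = 0 := by
  ext n
  simp

lemma X_pow_dvd_mapCoeffDeriv {n : ℕ} {f : S⟦X⟧} (h : X ^ n ∣ f) :
    X ^ n ∣ mapCoeffDeriv D f := by
  rw [X_pow_dvd_iff] at h ⊢
  intro m hm
  simp [h m hm]

lemma mapCoeffDeriv_subst (φ : ℚ⟦X⟧) {K : S⟦X⟧} (hK : constantCoeff K = 0) :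
    mapCoeffDeriv D (φ.subst K) = (d⁄dX ℚ φ).subst K * mapCoeffDeriv D K := by
  refine eq_of_forall_X_pow_dvd fun N => ?_
  -- The truncation of `φ` goes one degree further than that of its derivative, since
  -- differentiation lowers degrees by one.
  have h1 := X_pow_dvd_mapCoeffDeriv D
    ((pow_dvd_pow X N.le_succ).trans (X_pow_dvd_subst_sub_sum φ hK (N + 1)))
  have h2 := (X_pow_dvd_subst_sub_sum (d⁄dX ℚ φ) hK N).mul_right (mapCoeffDeriv D K)
  convert h1.sub h2 using 1
  rw [map_sub, sub_mul, map_sum]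
  have : ∑ k ∈ range (N + 1 + 1), mapCoeffDeriv D (coeff k φ • K ^ k)
      = (∑ k ∈ range (N + 1), coeff k (d⁄dX ℚ φ) • K ^ k) * mapCoeffDeriv D K := by
    rw [sum_range_succ', sum_mul]
    simp only [pow_zero, Derivation.map_smul, Derivation.map_one_eq_zero, smul_zero, add_zero]
    refine sum_congr rfl fun k _ => ?_
    rw [Derivation.leibniz_pow, coeff_derivative]
    simp only [Nat.add_sub_cancel, smul_eq_mul, smul_mul_assoc, mul_smul, nsmul_eq_mul]
    congr 1
    rw [Algebra.smul_def]
    push_cast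
    simp [add_mul]
  rw [this]
  ring

/-! ### Evaluation of the inner variable -/

variable {T : Type*} [CommRing T]

/-- For a ring homomorphism `φ : S → T⟦X⟧`, the homomorphism `S⟦X⟧ → T⟦X⟧` extending it with
`X ↦ X`. -/
noncomputable def diagHom (φ : S →+* T⟦X⟧) : S⟦X⟧ →+* T⟦X⟧ where
  toFun f := mk fun n => ∑ p ∈ antidiagonal n, coeff p.2 (φ (coeff p.1 f))
  map_one' := by
    ext n
    rw [coeff_mk, sum_eq_single (0, n)]
    · simp
    · rintro ⟨i, j⟩ h hne
      have : i ≠ 0 := by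
        rintro rfl
        simp at h; simp [h] at hne
      simp [coeff_one, this]
    · simp
  map_zero' := by ext; simp
  map_add' f g := by ext; simp [sum_add_distrib]
  map_mul' f g := by
    ext n
    simp only [coeff_mk, coeff_mul, map_sum, map_mul, sum_mul_sum]
    simp only [← sum_product', sum_sigma']
    -- Both sides sum over 2×2 arrays of exponents with total `n`. The bijection transposes the
    -- array; the outer pair records its row sums.
    refine sum_nbij' (fun x => ⟨(x.2.1.1 + x.2.2.1, x.2.1.2 + x.2.2.2),
        (x.2.1.1, x.2.2.1), (x.2.1.2, x.2.2.2)⟩)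
      (fun x => ⟨(x.2.1.1 + x.2.2.1, x.2.1.2 + x.2.2.2),
        (x.2.1.1, x.2.2.1), (x.2.1.2, x.2.2.2)⟩) ?_ ?_ ?_ ?_ ?_
    · rintro ⟨⟨a, b⟩, ⟨c, d⟩, e, f⟩
      simp only [mem_sigma, mem_product, HasAntidiagonal.mem_antidiagonal]
      rintro ⟨h1, h2, h3⟩
      exact ⟨by omega, trivial, trivial⟩
    · rintro ⟨⟨a, b⟩, ⟨c, d⟩, e, f⟩
      simp only [mem_sigma, mem_product, HasAntidiagonal.mem_antidiagonal]
      rintro ⟨h1, h2, h3⟩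
      exact ⟨by omega, trivial, trivial⟩
    · rintro ⟨⟨a, b⟩, ⟨c, d⟩, e, f⟩
      simp only [mem_sigma, mem_product, HasAntidiagonal.mem_antidiagonal]
      rintro ⟨-, rfl, rfl⟩
      rfl
    · rintro ⟨⟨a, b⟩, ⟨c, d⟩, e, f⟩
      simp only [mem_sigma, mem_product, HasAntidiagonal.mem_antidiagonal]
      rintro ⟨-, rfl, rfl⟩
      rfl
    · rintro ⟨⟨a, b⟩, ⟨c, d⟩, e, f⟩ _
      rfl

variable (φ : S →+* T⟦X⟧)

omit [Algebra ℚ S] in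
lemma coeff_diagHom (f : S⟦X⟧) (n : ℕ) :
    coeff n (diagHom φ f) = ∑ p ∈ antidiagonal n, coeff p.2 (φ (coeff p.1 f)) := by
  simp [diagHom]

omit [Algebra ℚ S] in
lemma diagHom_C (a : S) : diagHom φ (C a) = φ a := by
  ext n
  rw [coeff_diagHom, sum_eq_single (0, n)]
  · simp
  · rintro ⟨i, j⟩ h hne
    have : i ≠ 0 := by
      rintro rfl
      simp at h; simp [h] at hne
    simp [coeff_C, this]
  · simp

omit [Algebra ℚ S] in
lemma diagHom_X : diagHom φ X = X := by
  ext n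
  rw [coeff_diagHom]
  rcases n with _ | n
  · simp
  rw [sum_eq_single (1, n)]
  · simp [coeff_one, coeff_X]
  · rintro ⟨i, j⟩ h hne
    have : i ≠ 1 := by
      rintro rfl
      simp at h
      exact hne (by rw [show j = n by omega])
    simp [coeff_X, this]
  · simp [add_comm]

omit [Algebra ℚ S] in
lemma diagHom_map (ι : T →+* S) (h : ∀ a, φ (ι a) = C a) (f : T⟦X⟧) :
    diagHom φ (map ι f) = f := by
  ext n
  rw [coeff_diagHom, sum_eq_single (n, 0)]
  · simp [h]
  · rintro ⟨i, j⟩ hij hne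
    have : j ≠ 0 := by
      rintro rfl
      simp at hij; simp [hij] at hne
    simp [h, coeff_C, this]
  · simp

omit [Algebra ℚ S] in
lemma X_pow_dvd_diagHom {n : ℕ} {f : S⟦X⟧} (h : X ^ n ∣ f) : X ^ n ∣ diagHom φ f := by
  simpa [diagHom_X] using map_dvd (diagHom φ) h

omit [Algebra ℚ S] in
lemma constantCoeff_diagHom (f : S⟦X⟧) :
    constantCoeff (diagHom φ f) = constantCoeff (φ (constantCoeff f)) := by
  rw [← coeff_zero_eq_constantCoeff_apply, coeff_diagHom]
  simp

lemma diagHom_subst [Algebra ℚ T] (f : ℚ⟦X⟧) {K : S⟦X⟧} (hK : constantCoeff K = 0) :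
    diagHom φ (f.subst K) = f.subst (diagHom φ K) := by
  refine eq_of_forall_X_pow_dvd fun N => ?_
  have h1 := X_pow_dvd_diagHom φ (X_pow_dvd_subst_sub_sum f hK N)
  have h2 := X_pow_dvd_subst_sub_sum f (K := diagHom φ K)
    (by rw [constantCoeff_diagHom, hK]; simp) N
  convert h1.sub h2 using 1
  simp [map_sum, map_rat_smul]

omit [Algebra ℚ S] in
lemma X_pow_dvd_diagHom_sub {φ ψ : S →+* T⟦X⟧} {n : ℕ} (h : ∀ a, X ^ n ∣ φ a - ψ a)
    (f : S⟦X⟧) : X ^ n ∣ diagHom φ f - diagHom ψ f := by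
  rw [X_pow_dvd_iff]
  intro m hm
  rw [map_sub, coeff_diagHom, coeff_diagHom, ← sum_sub_distrib]
  refine sum_eq_zero fun p hp => ?_
  rw [← map_sub]
  rw [HasAntidiagonal.mem_antidiagonal] at hp
  exact X_pow_dvd_iff.1 (h _) _ (by omega)

/-- The homomorphism `ℚ⟦u⟧⟦z⟧ → ℚ⟦z⟧` which substitutes the series `U`, without its constant
term, for the inner variable. -/
noncomputable def evalInner (U : ℚ⟦X⟧) : ℚ⟦X⟧⟦X⟧ →+* ℚ⟦X⟧ :=
  diagHom (substAlgHom (R := ℚ) (HasSubst.of_constantCoeff_zero'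
    (show constantCoeff (U - C (constantCoeff U)) = 0 by simp)) : ℚ⟦X⟧ →+* ℚ⟦X⟧)

lemma evalInner_C {U : ℚ⟦X⟧} (hU : constantCoeff U = 0) (a : ℚ⟦X⟧) :
    evalInner U (C a) = a.subst U := by
  rw [evalInner, diagHom_C]
  simp [hU, coe_substAlgHom]

lemma evalInner_map (U f : ℚ⟦X⟧) : evalInner U (map C f) = f := by
  refine diagHom_map _ _ (fun a => ?_) f
  have := (substAlgHom (R := ℚ) (HasSubst.of_constantCoeff_zero'
    (show constantCoeff (U - C (constantCoeff U)) = 0 by simp))).commutes a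
  simpa using this

lemma evalInner_X (U : ℚ⟦X⟧) : evalInner U X = X := diagHom_X _

/-- This produces the root of the kernel: changing `U` in order `n` changes the evaluated series in
order `n` at the earliest, and the factor `X` gains one order. -/
lemma contracting_X_mul_evalInner (f : ℚ⟦X⟧⟦X⟧) :
    Contracting fun U => X * evalInner U f := by
  intro n U V h
  rw [← mul_sub, pow_succ']
  refine mul_dvd_mul_left _ (X_pow_dvd_diagHom_sub (fun a => ?_) f)
  simp only [RingHom.coe_coe, coe_substAlgHom]
  refine X_pow_dvd_subst_sub_subst a (by simp) (by simp) ?_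
  rcases n with _ | n
  · simp
  · have : constantCoeff U = constantCoeff V := by
      simpa [sub_eq_zero] using X_pow_dvd_iff.1 h 0 n.succ_pos
    simpa [this] using h

/-- The kernel method for the equation `u (K + p) = z (A(u) φ(K) - c)` with `p, c ∈ ℚ⟦z⟧`. -/
lemma kernel_method (A φ p c : ℚ⟦X⟧) {K : ℚ⟦X⟧⟦X⟧} (hK : constantCoeff K = 0)
    (h : C X * (K + map C p) = X * (C A * φ.subst K - map C c)) :
    ∃ U k : ℚ⟦X⟧, constantCoeff U = 0 ∧ constantCoeff k = 0 ∧
      U = X * (A.subst U * (d⁄dX ℚ φ).subst k) ∧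
      k + p = X * ((d⁄dX ℚ A).subst U * φ.subst k) ∧
      U * (k + p) = X * (A.subst U * φ.subst k - c) := by
  -- After differentiation in `u`, the coefficient of `∂K/∂u` is the kernel `u - z A(u) φ'(K)`; `U`
  -- is its root.
  obtain ⟨U, hU⟩ := (contracting_X_mul_evalInner (C A * (d⁄dX ℚ φ).subst K)).exists_fixed
  replace hU : U = X * evalInner U (C A * (d⁄dX ℚ φ).subst K) := hU
  have hU0 : constantCoeff U = 0 := by rw [hU]; simp
  have hsub : ∀ f : ℚ⟦X⟧, evalInner U (f.subst K) = f.subst (evalInner U K) :=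
    fun f => diagHom_subst _ f hK
  refine ⟨U, evalInner U K, hU0, ?_, ?_, ?_, ?_⟩
  · rw [evalInner, constantCoeff_diagHom, hK]; simp
  · rwa [map_mul, evalInner_C hU0, hsub] at hU
  -- In the derivative with respect to `u`, the outer variable `z` and the series `p`, `c` are
  -- constants.
  · have hD := congrArg (mapCoeffDeriv (d⁄dX ℚ)) h
    have hm : ∀ f : ℚ⟦X⟧, mapCoeffDeriv (d⁄dX ℚ) (map C f) = 0 := mapCoeffDeriv_map _
    simp only [Derivation.leibniz, map_add, map_sub, mapCoeffDeriv_C, mapCoeffDeriv_X, hm,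
      mapCoeffDeriv_subst _ _ hK, smul_eq_mul, derivative_X, map_one, mul_one, mul_zero,
      add_zero, sub_zero] at hD
    have := congrArg (evalInner U) hD
    simp only [map_add, map_mul, evalInner_C hU0, evalInner_map, evalInner_X, hsub,
      subst_X (HasSubst.of_constantCoeff_zero' hU0)] at this
    simp only [map_mul, evalInner_C hU0, hsub] at hU
    set W := evalInner U (mapCoeffDeriv (d⁄dX ℚ) K)
    -- `W` is the unknown value of `∂K/∂u` at `u = U`. Its coefficients on the two sides agree by
    -- the choice of `U`, so it cancels.
    have h2 := congrArg (· * W) hU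
    linear_combination this - h2
  · have := congrArg (evalInner U) h
    simpa only [map_mul, map_add, map_sub, evalInner_C hU0, evalInner_map, evalInner_X, hsub,
      subst_X (HasSubst.of_constantCoeff_zero' hU0)] using this

end Bivariate

end TreeParking

namespace TreeParking
open PowerSeries Finset

/-! ### Logarithmic derivatives -/

section LogDeriv

/-- The logarithmic derivative `f' / f`. -/
noncomputable def ld (f : ℚ⟦X⟧) : ℚ⟦X⟧ := d⁄dX ℚ f * f⁻¹

lemma ld_eq_iff {f g : ℚ⟦X⟧} (hf : constantCoeff f ≠ 0) : ld f = g ↔ d⁄dX ℚ f = g * f := by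
  rw [ld]
  constructor
  · rintro rfl
    rw [mul_assoc, PowerSeries.inv_mul_cancel _ hf, mul_one]
  · intro h
    rw [h, mul_assoc, PowerSeries.mul_inv_cancel _ hf, mul_one]

lemma derivative_eq_ld_mul {f : ℚ⟦X⟧} (hf : constantCoeff f ≠ 0) :
    d⁄dX ℚ f = ld f * f := (ld_eq_iff hf).1 rfl

lemma ld_mul {f g : ℚ⟦X⟧} (hf : constantCoeff f ≠ 0) (hg : constantCoeff g ≠ 0) :
    ld (f * g) = ld f + ld g := by
  rw [ld_eq_iff (by simp [hf, hg]), Derivation.leibniz, derivative_eq_ld_mul hf,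
    derivative_eq_ld_mul hg]
  simp only [smul_eq_mul]
  ring

lemma ld_one : ld 1 = 0 := by simp [ld]

lemma ld_inv {f : ℚ⟦X⟧} (hf : constantCoeff f ≠ 0) : ld f⁻¹ = -ld f := by
  have := ld_mul hf (g := f⁻¹) (by simp [hf])
  rw [PowerSeries.mul_inv_cancel _ hf, ld_one] at this
  linear_combination -this

lemma ld_pow {f : ℚ⟦X⟧} (hf : constantCoeff f ≠ 0) (n : ℕ) : ld (f ^ n) = n * ld f := by
  induction n with
  | zero => simp [ld_one]
  | succ n ih =>
    rw [pow_succ, ld_mul (by simp [hf]) hf, ih]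
    push_cast
    ring

/-- The quotient has derivative zero and constant term one. Identities between products of `fexp`
and `fpow` are proved in this way, because `ld` makes them linear. -/
lemma eq_of_ld_eq {f g : ℚ⟦X⟧} (hf : constantCoeff f = 1) (hg : constantCoeff g = 1)
    (h : ld f = ld g) : f = g := by
  have hf' : constantCoeff f ≠ 0 := by simp [hf]
  have hg' : constantCoeff g ≠ 0 := by simp [hg]
  have h1 : ld (f * g⁻¹) = 0 := by rw [ld_mul hf' (by simp [hg]), ld_inv hg', h]; ring
  rw [ld_eq_iff (by simp [hf, hg])] at h1
  have h2 : f * g⁻¹ = 1 := derivative.ext (by rw [h1]; simp) (by simp [hf, hg])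
  calc f = f * g⁻¹ * g := by rw [mul_assoc, PowerSeries.inv_mul_cancel _ hg', mul_one]
    _ = g := by rw [h2, one_mul]

end LogDeriv

/-! ### Exponential, logarithm and rational powers: derivatives and substitution -/

section Elementary

lemma constantCoeff_fexp {f : ℚ⟦X⟧} (hf : constantCoeff f = 0) :
    constantCoeff (fexp f) = 1 := by
  rw [fexp, constantCoeff_subst' _ hf]; simp

lemma constantCoeff_fln {f : ℚ⟦X⟧} (hf : constantCoeff f = 1) :
    constantCoeff (fln f) = 0 := by
  rw [fln, constantCoeff_subst' _ (by simp [hf])]; simp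

lemma constantCoeff_fpow {f : ℚ⟦X⟧} (hf : constantCoeff f = 1) (a : ℚ) :
    constantCoeff (fpow f a) = 1 := by
  rw [fpow, constantCoeff_subst' _ (by simp [hf]), binomialSeries_constantCoeff]; simp

lemma ld_fexp {f : ℚ⟦X⟧} (hf : constantCoeff f = 0) : ld (fexp f) = d⁄dX ℚ f := by
  rw [ld_eq_iff (by simp [constantCoeff_fexp hf]), fexp,
    derivative_subst (HasSubst.of_constantCoeff_zero' hf), derivative_exp, mul_comm]

/-- The differential equation `(1 + x) y' = a y` of `(1 + x)^a`; it is the source of the logarithmic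
derivative of `fpow`. -/
lemma derivative_binomialSeries (a : ℚ) :
    d⁄dX ℚ (PowerSeries.binomialSeries ℚ a) * (1 + X) = C a * PowerSeries.binomialSeries ℚ a := by
  ext n
  rw [mul_add, mul_one, map_add, coeff_derivative, coeff_C_mul, binomialSeries_coeff,
    binomialSeries_coeff]
  -- The recurrence `(m + 1) choose(a, m + 1) = (a - m) choose(a, m)`, read off from descending
  -- Pochhammer products.
  have key : ∀ m : ℕ, Ring.choose a (m + 1) * (m + 1 : ℚ) = Ring.choose a m * (a - m) := by
    intro m
    have h1 := Ring.descPochhammer_eq_factorial_smul_choose a (m + 1)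
    have h2 := Ring.descPochhammer_eq_factorial_smul_choose a m
    rw [descPochhammer_succ_right, Polynomial.smeval_mul, h2] at h1
    have h3 : (descPochhammer ℤ m).smeval a = (m.factorial • Ring.choose a m : ℚ) := h2
    simp [Nat.factorial_succ, Polynomial.smeval_sub, Polynomial.smeval_X,
      Polynomial.smeval_natCast] at h1
    have : (m.factorial : ℚ) ≠ 0 := by exact_mod_cast m.factorial_ne_zero
    apply mul_left_cancel₀ this
    linear_combination -h1
  rcases n with _ | n
  · simp
  · rw [coeff_succ_mul_X, coeff_derivative, binomialSeries_coeff]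
    have h1 := key (n + 1)
    have h2 := key n
    simp only [smul_eq_mul, mul_one]
    push_cast at *
    linear_combination h1

lemma ld_fpow {f : ℚ⟦X⟧} (hf : constantCoeff f = 1) (a : ℚ) :
    ld (fpow f a) = C a * ld f := by
  have hs : HasSubst (f - 1) := HasSubst.of_constantCoeff_zero' (by simp [hf])
  have hf' : constantCoeff f ≠ 0 := by simp [hf]
  rw [ld_eq_iff (by simp [constantCoeff_fpow hf]), fpow, derivative_subst hs, map_sub,
    derivative_one, sub_zero, derivative_eq_ld_mul hf']
  have := congrArg (substAlgHom (R := ℚ) hs) (derivative_binomialSeries a)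
  simp only [map_mul, map_add, map_one, coe_substAlgHom, subst_X hs] at this
  have hC : (C a : ℚ⟦X⟧).subst (f - 1) = C a := by
    have := (substAlgHom (R := ℚ) hs).commutes a
    simpa [coe_substAlgHom] using this
  rw [hC] at this
  linear_combination ld f * this

lemma derivative_fln {f : ℚ⟦X⟧} (hf : constantCoeff f = 1) : d⁄dX ℚ (fln f) = ld f := by
  have hs : HasSubst (f - 1) := HasSubst.of_constantCoeff_zero' (by simp [hf])
  have hf' : constantCoeff f ≠ 0 := by simp [hf]
  rw [eq_comm, ld_eq_iff hf', fln, derivative_subst hs, map_sub, derivative_one, sub_zero]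
  have h1 : d⁄dX ℚ (log ℚ) * (1 + X) = 1 := by
    rw [deriv_log]
    ext n
    rcases n with _ | n
    · simp
    · rw [mul_add, mul_one, map_add, coeff_succ_mul_X]
      simp [pow_succ, coeff_one]
  have := congrArg (substAlgHom (R := ℚ) hs) h1
  simp only [map_mul, map_add, map_one, coe_substAlgHom, subst_X hs] at this
  linear_combination -(d⁄dX ℚ f) * this

lemma subst_fexp {f Q : ℚ⟦X⟧} (hf : constantCoeff f = 0) (hQ : constantCoeff Q = 0) :
    (fexp f).subst Q = fexp (f.subst Q) :=
  subst_comp_subst_apply (HasSubst.of_constantCoeff_zero' hf)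
    (HasSubst.of_constantCoeff_zero' hQ) _

lemma subst_one' {Q : ℚ⟦X⟧} (hQ : constantCoeff Q = 0) : (1 : ℚ⟦X⟧).subst Q = 1 := by
  rw [← coe_substAlgHom (HasSubst.of_constantCoeff_zero' hQ), map_one]

lemma subst_C' {Q : ℚ⟦X⟧} (hQ : constantCoeff Q = 0) (a : ℚ) : (C a : ℚ⟦X⟧).subst Q = C a := by
  have := (substAlgHom (R := ℚ) (HasSubst.of_constantCoeff_zero' hQ)).commutes a
  simpa [coe_substAlgHom] using this

lemma subst_fpow {f Q : ℚ⟦X⟧} (hf : constantCoeff f = 1) (hQ : constantCoeff Q = 0) (a : ℚ) :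
    (fpow f a).subst Q = fpow (f.subst Q) a := by
  have hs := HasSubst.of_constantCoeff_zero' hQ
  rw [fpow, fpow, subst_comp_subst_apply (HasSubst.of_constantCoeff_zero' (by simp [hf])) hs,
    subst_sub hs, subst_one' hQ]

lemma subst_fln {f Q : ℚ⟦X⟧} (hf : constantCoeff f = 1) (hQ : constantCoeff Q = 0) :
    (fln f).subst Q = fln (f.subst Q) := by
  have hs := HasSubst.of_constantCoeff_zero' hQ
  rw [fln, fln, subst_comp_subst_apply (HasSubst.of_constantCoeff_zero' (by simp [hf])) hs,
    subst_sub hs, subst_one' hQ]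

lemma subst_inv {f Q : ℚ⟦X⟧} (hf : constantCoeff f ≠ 0) (hQ : constantCoeff Q = 0) :
    (f⁻¹).subst Q = (f.subst Q)⁻¹ := by
  have hs := HasSubst.of_constantCoeff_zero' hQ
  rw [PowerSeries.eq_inv_iff_mul_eq_one (by rw [constantCoeff_subst' _ hQ]; simpa using hf),
    ← subst_mul hs, PowerSeries.inv_mul_cancel _ hf, subst_one' hQ]

lemma derivative_fpow {f : ℚ⟦X⟧} (hf : constantCoeff f = 1) (a : ℚ) :
    d⁄dX ℚ (fpow f a) = C a * fpow f (a - 1) * d⁄dX ℚ f := by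
  have hf' : constantCoeff f ≠ 0 := by simp [hf]
  have h : fpow f a = fpow f (a - 1) * f := by
    apply eq_of_ld_eq (constantCoeff_fpow hf _) (by simp [constantCoeff_fpow hf, hf])
    rw [ld_mul (by simp [constantCoeff_fpow hf]) hf', ld_fpow hf, ld_fpow hf]
    simp
    ring
  rw [derivative_eq_ld_mul (by simp [constantCoeff_fpow hf]), ld_fpow hf,
    derivative_eq_ld_mul hf', h]
  ring

end Elementary
end TreeParking

namespace TreeParking
open PowerSeries Finset

/-! ### Solving the kernel equations for degree series that are powers -/

section Solve

lemma X_cancel {f g : ℚ⟦X⟧} (h : X * f = X * g) : f = g :=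
  mul_left_cancel₀ PowerSeries.X_ne_zero h

/-- The degree-weight series `(1 + e t)^(e d)`, for `e = ±1`. -/
noncomputable def powSeries (e : ℚ) (d : ℕ) : ℚ⟦X⟧ := fpow (1 + C e * X) (e * d)

lemma subst_one_add_C_mul {k : ℚ⟦X⟧} (hk : constantCoeff k = 0) (e : ℚ) :
    (1 + C e * X : ℚ⟦X⟧).subst k = 1 + C e * k := by
  have hs := HasSubst.of_constantCoeff_zero' hk
  rw [subst_add hs, subst_mul hs, subst_one' hk, subst_C' hk, subst_X hs]

lemma subst_powSeries {k : ℚ⟦X⟧} (hk : constantCoeff k = 0) (e : ℚ) (d : ℕ) :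
    (powSeries e d).subst k = fpow (1 + C e * k) (e * d) := by
  rw [powSeries, subst_fpow (by simp) hk, subst_one_add_C_mul hk]

/-- The exponent `e d` and the inner derivative `e` multiply to `d`, so both signs can be treated
together. -/
lemma subst_derivative_powSeries {k : ℚ⟦X⟧} (hk : constantCoeff k = 0) {e : ℚ} (he : e * e = 1)
    (d : ℕ) :
    (d⁄dX ℚ (powSeries e d)).subst k = d * fpow (1 + C e * k) (e * d - 1) := by
  have hs := HasSubst.of_constantCoeff_zero' hk
  rw [powSeries, derivative_fpow (by simp)]
  have : C (e * d) * fpow (1 + C e * X) (e * d - 1) * d⁄dX ℚ (1 + C e * X : ℚ⟦X⟧)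
      = C (d : ℚ) * fpow (1 + C e * X) (e * d - 1) := by
    simp only [map_add, derivative_one, Derivation.leibniz, derivative_X, derivative_C,
      smul_eq_mul, mul_one, mul_zero, add_zero, zero_add]
    have h : (C (e * d) : ℚ⟦X⟧) * C e = C (d : ℚ) := by
      rw [← map_mul]; congr 1; linear_combination (d : ℚ) * he
    linear_combination fpow (1 + C e * X) (e * d - 1) * h
  rw [this, subst_mul hs, subst_C' hk, subst_fpow (by simp) hk, subst_one_add_C_mul hk]
  simp

lemma fpow_sub_one_mul {f : ℚ⟦X⟧} (hf : constantCoeff f = 1) (a : ℚ) :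
    fpow f (a - 1) * f = fpow f a := by
  have hf' : constantCoeff f ≠ 0 := by simp [hf]
  apply eq_of_ld_eq (by simp [constantCoeff_fpow hf, hf]) (constantCoeff_fpow hf _)
  rw [ld_mul (by simp [constantCoeff_fpow hf]) hf', ld_fpow hf, ld_fpow hf]
  simp
  ring

lemma derivative_geom : d⁄dX ℚ ((1 - X : ℚ⟦X⟧)⁻¹) = ((1 - X)⁻¹) ^ 2 := by
  rw [derivative_inv']
  simp

lemma subst_exp (U : ℚ⟦X⟧) : (exp ℚ).subst U = fexp U := rfl

lemma subst_geom {U : ℚ⟦X⟧} (hU : constantCoeff U = 0) :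
    ((1 - X : ℚ⟦X⟧)⁻¹).subst U = (1 - U)⁻¹ := by
  have hs := HasSubst.of_constantCoeff_zero' hU
  rw [subst_inv (by simp) hU, subst_sub hs, subst_one' hU, subst_X hs]

lemma subst_derivative_geom {U : ℚ⟦X⟧} (hU : constantCoeff U = 0) :
    (d⁄dX ℚ ((1 - X : ℚ⟦X⟧)⁻¹)).subst U = ((1 - U)⁻¹) ^ 2 := by
  rw [derivative_geom, subst_pow (HasSubst.of_constantCoeff_zero' hU), subst_geom hU]

variable {K : ℚ⟦X⟧⟦X⟧} {g : ℚ⟦X⟧}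

/-- Parking functions, `d`-ary (`e = 1`) and `d`-bundled (`e = -1`) trees. -/
lemma solve_powSeries_exp {e : ℚ} (he : e * e = 1) {d : ℕ} (hd : d ≠ 0)
    (hK : constantCoeff K = 0) (hg : constantCoeff g = 0)
    (h : C X * K = X * (C (exp ℚ) * (powSeries e d).subst K - map C ((powSeries e d).subst g))) :
    ∃ Q : ℚ⟦X⟧, constantCoeff Q = 0 ∧
      Q = X * (fexp (d * Q) * fpow (1 - C e * Q) (1 - e * d)) ∧
      1 + C e * g = fpow (1 - d * Q) (e / d) * fexp (C e * Q) * (1 - C e * Q)⁻¹ := by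
  obtain ⟨U, k, hU, hk, h1, h2, h3⟩ := kernel_method (exp ℚ) (powSeries e d) 0
    ((powSeries e d).subst g) hK (by simpa using h)
  have hd' : (d : ℚ) ≠ 0 := by exact_mod_cast hd
  rw [subst_powSeries hk] at h2 h3
  rw [subst_powSeries hg] at h3
  rw [add_zero] at h2 h3
  rw [subst_derivative_powSeries hk he] at h1
  rw [derivative_exp] at h2
  rw [subst_exp] at h1 h2 h3
  have hY : constantCoeff (1 + C e * k) = 1 := by simp [hk]
  -- With `W = Y ^ (e d - 1)` one has `φ(k) = W Y` and `φ'(k) = d W`, so that all three equations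
  -- share the factor `W`.
  rw [← fpow_sub_one_mul hY] at h2 h3
  set Y := 1 + C e * k with hYdef
  set W := fpow Y (e * d - 1) with hW
  have hldW : ld W = C (e * d - 1) * ld Y := ld_fpow hY _
  have hW1 : constantCoeff W = 1 := constantCoeff_fpow hY _
  have hCe : (C e : ℚ⟦X⟧) * C e = 1 := by rw [← map_mul, he, map_one]
  have hCd : (C ((d : ℚ)⁻¹) : ℚ⟦X⟧) * d = 1 := by
    rw [← map_natCast C, ← map_mul, inv_mul_cancel₀ hd', map_one]
  have hCed : (C (e / d : ℚ) : ℚ⟦X⟧) = C e * C ((d : ℚ)⁻¹) := by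
    rw [← map_mul, div_eq_mul_inv]
  -- `Q = U / d` absorbs the factor `d` of `φ'(k) = d W`.
  obtain ⟨Q, rfl⟩ : ∃ Q : ℚ⟦X⟧, U = d * Q := ⟨C ((d : ℚ)⁻¹) * U, by linear_combination -U * hCd⟩
  have hQ : constantCoeff Q = 0 := by simpa [hd'] using hU
  have hE : constantCoeff (fexp (d * Q)) = 1 := constantCoeff_fexp hU
  have hdc : ∀ a b : ℚ⟦X⟧, (d : ℚ⟦X⟧) * a = d * b → a = b := fun a b hab => by
    linear_combination C ((d : ℚ)⁻¹) * hab - (a - b) * hCd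
  have hQ1 : Q = X * (fexp (d * Q) * W) := hdc _ _ (by linear_combination h1)
  -- The equations for `k` and `Q` differ only by the factor `Y`. Together with `Y = 1 + e k` this
  -- gives `Y = 1 / (1 - e Q)`.
  have hkQ : k = Q * Y := by linear_combination h2 - Y * hQ1
  have hYQ : Y * (1 - C e * Q) = 1 := by
    linear_combination hYdef + C e * hkQ
  have hldY : ld Y = -ld (1 - C e * Q) := by
    have := ld_mul (f := Y) (g := 1 - C e * Q) (by simp [hY]) (by simp [hQ])
    rw [hYQ, ld_one] at this
    linear_combination -this
  -- Eliminating `k` from the third equation expresses `φ(g) = (1 + e g) ^ (e d)` through `Q`. The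
  -- root is extracted below on logarithmic derivatives, multiplying by `e / d`.
  have hG : fpow (1 + C e * g) (e * d) = W * Y * (fexp (d * Q) * (1 - d * Q)) :=
    X_cancel (by linear_combination h3 - d * Q * h2)
  have hg1 : constantCoeff (1 + C e * g) = 1 := by simp [hg]
  have hld := congrArg ld hG
  simp only [ld_mul, ld_fpow, hldW, ne_eq, hW1, hY, hU, hE, ld_fexp, map_mul, map_sub,
    map_one, map_natCast, sub_zero, one_ne_zero, not_false_eq_true, mul_one, hg1, Derivation.leibniz, Derivation.map_natCast, smul_eq_mul, mul_zero, add_zero] at hld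
  refine ⟨Q, hQ, ?_, ?_⟩
  · have : fpow (1 - C e * Q) (1 - e * d) = W := by
      apply eq_of_ld_eq (constantCoeff_fpow (by simp [hQ]) _) hW1
      rw [ld_fpow (by simp [hQ]), hldW, hldY]
      simp
      ring
    rw [this]
    exact hQ1
  · apply eq_of_ld_eq hg1
    · simp [constantCoeff_fpow, constantCoeff_fexp, hQ]
    simp [ld_mul, ld_fpow, constantCoeff_fpow, hQ, hCed, ld_fexp, constantCoeff_fexp, ld_inv]
    linear_combination C e * C ((d : ℚ)⁻¹) * hld + C e ^ 2 * C ((d : ℚ)⁻¹) * d * hldY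
      - (ld (1 + C e * g) + ld (1 - C e * Q)) * (C e ^ 2 * hCd + hCe) + C e * d⁄dX ℚ Q * hCd

/-- Prime parking functions, `d`-ary (`e = 1`) and `d`-bundled (`e = -1`) trees. -/
lemma solve_powSeries_exp_prime {e : ℚ} (he : e * e = 1) {d : ℕ} (hd : d ≠ 0)
    (hK : constantCoeff K = 0)
    (h : C X * (K + map C g) = X * (C (exp ℚ) * (powSeries e d).subst K - 1)) :
    ∃ Q : ℚ⟦X⟧, constantCoeff Q = 0 ∧
      Q = X * (fexp (C e * Q) * fpow (1 - (d : ℚ⟦X⟧) * Q) (e / d - 1)) ∧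
      1 - C e * g = (1 - C e * Q) * (fpow (1 - (d : ℚ⟦X⟧) * Q) (-(e / d)) * fexp (-(C e * Q))) := by
  obtain ⟨U, k, hU, hk, h1, h2, h3⟩ := kernel_method (exp ℚ) (powSeries e d) g 1
    hK (by simpa using h)
  have hd' : (d : ℚ) ≠ 0 := by exact_mod_cast hd
  rw [subst_powSeries hk] at h2 h3
  rw [subst_derivative_powSeries hk he] at h1
  rw [derivative_exp] at h2
  rw [subst_exp] at h1 h2 h3
  have hY : constantCoeff (1 + C e * k) = 1 := by simp [hk]
  rw [← fpow_sub_one_mul hY] at h2 h3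
  set Y := 1 + C e * k with hYdef
  set W := fpow Y (e * d - 1) with hW
  have hldW : ld W = C (e * d - 1) * ld Y := ld_fpow hY _
  have hW1 : constantCoeff W = 1 := constantCoeff_fpow hY _
  have hCe : (C e : ℚ⟦X⟧) * C e = 1 := by rw [← map_mul, he, map_one]
  have hCd : (C ((d : ℚ)⁻¹) : ℚ⟦X⟧) * d = 1 := by
    rw [← map_natCast C, ← map_mul, inv_mul_cancel₀ hd', map_one]
  have hCed : (C (e / d : ℚ) : ℚ⟦X⟧) = C e * C ((d : ℚ)⁻¹) := by
    rw [← map_mul, div_eq_mul_inv]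
  obtain ⟨Q, rfl⟩ : ∃ Q : ℚ⟦X⟧, U = d * Q := ⟨C ((d : ℚ)⁻¹) * U, by linear_combination -U * hCd⟩
  have hQ : constantCoeff Q = 0 := by simpa [hd'] using hU
  have hE : constantCoeff (fexp (d * Q)) = 1 := constantCoeff_fexp hU
  have hdc : ∀ a b : ℚ⟦X⟧, (d : ℚ⟦X⟧) * a = d * b → a = b := fun a b hab => by
    linear_combination C ((d : ℚ)⁻¹) * hab - (a - b) * hCd
  have hQ1 : Q = X * (fexp (d * Q) * W) := hdc _ _ (by linear_combination h1)
  have hkQ : k + g = Q * Y := by linear_combination h2 - Y * hQ1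
  -- Now `k + g`, not `k`, equals `Q Y`, so that relation does not determine `Y`. Instead `Y` comes
  -- from this one, in which `W Y` is `Y ^ (e d)`.
  have hG : 1 = W * Y * (fexp (d * Q) * (1 - d * Q)) :=
    X_cancel (by linear_combination h3 - d * Q * h2)
  have hld := congrArg ld hG
  simp only [ld_mul, ld_one, hldW, ne_eq, hW1, hY, hU, hE, ld_fexp, map_mul, map_sub,
    map_one, map_natCast, sub_zero, one_ne_zero, not_false_eq_true, mul_one, Derivation.leibniz, Derivation.map_natCast, smul_eq_mul, mul_zero, add_zero] at hld
  have hldY : ld Y = -(C e * d⁄dX ℚ Q) - C e * C ((d : ℚ)⁻¹) * ld (1 - d * Q) := by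
    linear_combination -(C e * C ((d : ℚ)⁻¹) * hld) - ld Y * (C e ^ 2 * hCd + hCe)
      - C e * d⁄dX ℚ Q * hCd
  refine ⟨Q, hQ, ?_, ?_⟩
  · have : fexp (C e * Q) * fpow (1 - (d : ℚ⟦X⟧) * Q) (e / d - 1) = fexp (d * Q) * W := by
      apply eq_of_ld_eq <;> simp [ld_mul, ld_fpow, constantCoeff_fpow, hQ, hCed, ld_fexp, constantCoeff_fexp, hW1, hldW]
      linear_combination hld + hldY
    rw [this]
    exact hQ1
  · have : Y = fpow (1 - (d : ℚ⟦X⟧) * Q) (-(e / d)) * fexp (-(C e * Q)) := by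
      apply eq_of_ld_eq <;> simp [ld_mul, ld_fpow, constantCoeff_fpow, hQ, hCed, ld_fexp, constantCoeff_fexp, hY]
      linear_combination hldY
    rw [← this]
    -- From `Y = 1 + e k` and `k + g = Q Y` follows `1 - e g = (1 - e Q) Y`.
    linear_combination -C e * hkQ - hYdef

/-- Parking distributions, `d`-ary (`e = 1`) and `d`-bundled (`e = -1`) trees. -/
lemma solve_powSeries_geom {e : ℚ} (he : e * e = 1) {d : ℕ} (hd : d ≠ 0)
    (hK : constantCoeff K = 0) (hg : constantCoeff g = 0)
    (h : C X * K = X * (C ((1 - X : ℚ⟦X⟧)⁻¹) * (powSeries e d).subst K - map C ((powSeries e d).subst g))) :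
    ∃ Q : ℚ⟦X⟧, constantCoeff Q = 0 ∧
      Q = X * ((d : ℚ⟦X⟧) * (1 + Q) ^ 2 * fpow (1 - C (e / d) * Q) (1 - e * d)) ∧
      1 + C e * g = fpow (1 - Q ^ 2) (e / d) * (1 - C (e / d) * Q)⁻¹ := by
  obtain ⟨U, k, hU, hk, h1, h2, h3⟩ := kernel_method ((1 - X : ℚ⟦X⟧)⁻¹) (powSeries e d) 0
    ((powSeries e d).subst g) hK (by simpa using h)
  have hd' : (d : ℚ) ≠ 0 := by exact_mod_cast hd
  rw [subst_powSeries hk] at h2 h3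
  rw [subst_powSeries hg] at h3
  rw [add_zero] at h2 h3
  rw [subst_derivative_powSeries hk he] at h1
  rw [subst_geom hU] at h1 h3
  rw [subst_derivative_geom hU] at h2
  have hY : constantCoeff (1 + C e * k) = 1 := by simp [hk]
  rw [← fpow_sub_one_mul hY] at h2 h3
  set Y := 1 + C e * k with hYdef
  set W := fpow Y (e * d - 1) with hW
  have hldW : ld W = C (e * d - 1) * ld Y := ld_fpow hY _
  have hW1 : constantCoeff W = 1 := constantCoeff_fpow hY _
  have hCe : (C e : ℚ⟦X⟧) * C e = 1 := by rw [← map_mul, he, map_one]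
  have hCd : (C ((d : ℚ)⁻¹) : ℚ⟦X⟧) * d = 1 := by
    rw [← map_natCast C, ← map_mul, inv_mul_cancel₀ hd', map_one]
  have hCed : (C (e / d : ℚ) : ℚ⟦X⟧) = C e * C ((d : ℚ)⁻¹) := by
    rw [← map_mul, div_eq_mul_inv]
  have hI : (1 - U)⁻¹ * (1 - U) = 1 := PowerSeries.inv_mul_cancel _ (by simp [hU])
  set I := (1 - U)⁻¹ with hIdef
  -- With `Q = U / (1 - U)`, the values `A(U) = 1 + Q` and `A'(U) = (1 + Q) ^ 2` become polynomials
  -- in `Q`.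
  obtain ⟨Q, hQU⟩ : ∃ Q : ℚ⟦X⟧, Q = U * I := ⟨_, rfl⟩
  have hQ : constantCoeff Q = 0 := by simp [hQU, hU]
  have hIQ : I = 1 + Q := by linear_combination hI - hQU
  have hQ1 : Q = X * ((d : ℚ⟦X⟧) * (1 + Q) ^ 2 * W) := by
    rw [← hIQ]
    linear_combination hQU + I * h1
  have hkQ : k = C ((d : ℚ)⁻¹) * Q * Y := by
    linear_combination h2 - C ((d : ℚ)⁻¹) * Y * (hQU + I * h1)
      - X * I ^ 2 * W * Y * hCd
  have hYQ : Y * (1 - C (e / d) * Q) = 1 := by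
    rw [hCed]
    linear_combination hYdef + C e * hkQ
  have hldY : ld Y = -ld (1 - C (e / d) * Q) := by
    have := ld_mul (f := Y) (g := 1 - C (e / d) * Q) (by simp [hY]) (by simp [hQ])
    rw [hYQ, ld_one] at this
    linear_combination -this
  have hG : fpow (1 + C e * g) (e * d) = W * Y * ((1 + Q) * (1 - Q)) := by
    refine X_cancel ?_
    rw [hQU] at hIQ ⊢
    linear_combination h3 - U * h2 + X * W * Y * (1 - U * I) * hIQ
  have hg1 : constantCoeff (1 + C e * g) = 1 := by simp [hg]
  have hld := congrArg ld hG
  simp only [ld_mul, ld_fpow, hldW, ne_eq, hW1, hY, map_add, hQ, add_zero, map_mul, map_sub,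
    map_one, map_natCast, sub_zero, one_ne_zero, not_false_eq_true, mul_one, hg1] at hld
  refine ⟨Q, hQ, ?_, ?_⟩
  · have : fpow (1 - C (e / d) * Q) (1 - e * d) = W := by
      apply eq_of_ld_eq (constantCoeff_fpow (by simp [hQ]) _) hW1
      rw [ld_fpow (by simp [hQ]), hldW, hldY]
      simp
      ring
    rw [this]
    exact hQ1
  · rw [show 1 - Q ^ 2 = (1 + Q) * (1 - Q) by ring]
    apply eq_of_ld_eq hg1
    · simp [constantCoeff_fpow, hQ]
    rw [hCed] at hldY
    simp [ld_mul, ld_fpow, constantCoeff_fpow, hQ, hCed, ld_inv]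
    linear_combination C e * C ((d : ℚ)⁻¹) * hld + C e ^ 2 * C ((d : ℚ)⁻¹) * d * hldY
      - (ld (1 + C e * g) + ld (1 - C e * C ((d : ℚ)⁻¹) * Q)) * (C e ^ 2 * hCd + hCe)

/-- Prime parking distributions, `d`-ary (`e = 1`) and `d`-bundled (`e = -1`) trees. -/
lemma solve_powSeries_geom_prime {e : ℚ} (he : e * e = 1) {d : ℕ} (hd : d ≠ 0)
    (hK : constantCoeff K = 0)
    (h : C X * (K + map C g) = X * (C ((1 - X : ℚ⟦X⟧)⁻¹) * (powSeries e d).subst K - 1)) :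
    ∃ Q : ℚ⟦X⟧, constantCoeff Q = 0 ∧
      Q = X * ((d : ℚ⟦X⟧) * (fpow (1 + Q) (1 + e / d) * fpow (1 - Q) (e / d - 1))) ∧
      1 - C e * g = (1 - C (e / d) * Q) * fpow (1 - Q ^ 2) (-(e / d)) := by
  obtain ⟨U, k, hU, hk, h1, h2, h3⟩ := kernel_method ((1 - X : ℚ⟦X⟧)⁻¹) (powSeries e d) g 1
    hK (by simpa using h)
  have hd' : (d : ℚ) ≠ 0 := by exact_mod_cast hd
  rw [subst_powSeries hk] at h2 h3
  rw [subst_derivative_powSeries hk he] at h1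
  rw [subst_geom hU] at h1 h3
  rw [subst_derivative_geom hU] at h2
  have hY : constantCoeff (1 + C e * k) = 1 := by simp [hk]
  rw [← fpow_sub_one_mul hY] at h2 h3
  set Y := 1 + C e * k with hYdef
  set W := fpow Y (e * d - 1) with hW
  have hldW : ld W = C (e * d - 1) * ld Y := ld_fpow hY _
  have hW1 : constantCoeff W = 1 := constantCoeff_fpow hY _
  have hCe : (C e : ℚ⟦X⟧) * C e = 1 := by rw [← map_mul, he, map_one]
  have hCd : (C ((d : ℚ)⁻¹) : ℚ⟦X⟧) * d = 1 := by
    rw [← map_natCast C, ← map_mul, inv_mul_cancel₀ hd', map_one]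
  have hCed : (C (e / d : ℚ) : ℚ⟦X⟧) = C e * C ((d : ℚ)⁻¹) := by
    rw [← map_mul, div_eq_mul_inv]
  have hI : (1 - U)⁻¹ * (1 - U) = 1 := PowerSeries.inv_mul_cancel _ (by simp [hU])
  set I := (1 - U)⁻¹ with hIdef
  obtain ⟨Q, hQU⟩ : ∃ Q : ℚ⟦X⟧, Q = U * I := ⟨_, rfl⟩
  have hQ : constantCoeff Q = 0 := by simp [hQU, hU]
  have hIQ : I = 1 + Q := by linear_combination hI - hQU
  have hQ1 : Q = X * ((d : ℚ⟦X⟧) * (1 + Q) ^ 2 * W) := by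
    rw [← hIQ]
    linear_combination hQU + I * h1
  have hkQ : k + g = C ((d : ℚ)⁻¹) * Q * Y := by
    linear_combination h2 - C ((d : ℚ)⁻¹) * Y * (hQU + I * h1)
      - X * I ^ 2 * W * Y * hCd
  -- As in the prime case for `exp`, this determines `Y`, by `Y ^ (e d) (1 - Q ^ 2) = 1`.
  have hG : 1 = W * Y * ((1 + Q) * (1 - Q)) := by
    refine X_cancel ?_
    rw [hQU] at hIQ ⊢
    linear_combination h3 - U * h2 + X * W * Y * (1 - U * I) * hIQ
  have hld := congrArg ld hG
  simp only [ld_mul, ld_one, hldW, ne_eq, hW1, hY, map_add, hQ, add_zero, map_mul, map_sub,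
    map_one, map_natCast, sub_zero, one_ne_zero, not_false_eq_true, mul_one] at hld
  have hldY : ld Y = -(C e * C ((d : ℚ)⁻¹) * (ld (1 + Q) + ld (1 - Q))) := by
    linear_combination -(C e * C ((d : ℚ)⁻¹) * hld) - ld Y * (C e ^ 2 * hCd + hCe)
  refine ⟨Q, hQ, ?_, ?_⟩
  · have : (1 + Q) ^ 2 * W = fpow (1 + Q) (1 + e / d) * fpow (1 - Q) (e / d - 1) := by
      apply eq_of_ld_eq <;> simp [ld_mul, ld_fpow, constantCoeff_fpow, hQ, hCed, hW1, ld_pow, hldW]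
      linear_combination -hld - hldY
    rw [← this]
    linear_combination hQ1
  · have : Y = fpow (1 - Q ^ 2) (-(e / d)) := by
      rw [show 1 - Q ^ 2 = (1 + Q) * (1 - Q) by ring]
      apply eq_of_ld_eq <;> simp [ld_mul, ld_fpow, constantCoeff_fpow, hQ, hCed, hY]
      linear_combination hldY
    rw [← this, hCed]
    linear_combination -C e * hkQ - hYdef

end Solve
end TreeParking

namespace TreeParking
open PowerSeries Finset

/-- `g` is the value at `u = 0` of the solution `K(z, u)` of the functional equation
`u K(z, u) = z (A(u) φ(K(z, u)) - φ(g(z)))`. -/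
def Catalytic (A φ g : ℚ⟦X⟧) : Prop :=
  constantCoeff g = 0 ∧ ∃ K : ℚ⟦X⟧⟦X⟧, constantCoeff K = 0 ∧
    C X * K = X * (C A * φ.subst K - map C (φ.subst g))

/-- `p` is the series for which the functional equation
`u (K(z, u) + p(z)) = z (A(u) φ(K(z, u)) - 1)` has a solution `K(z, u)`. -/
def PrimeCatalytic (A φ p : ℚ⟦X⟧) : Prop :=
  ∃ K : ℚ⟦X⟧⟦X⟧, constantCoeff K = 0 ∧ C X * (K + map C p) = X * (C A * φ.subst K - 1)

/-! ### Solving the kernel equations for the degree series `exp` -/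

section Unordered

@[simp] lemma derivative_two : d⁄dX ℚ (2 : ℚ⟦X⟧) = 0 :=
  (d⁄dX ℚ).map_natCast 2

variable {g : ℚ⟦X⟧}

/-- Since `A = φ = exp`, the equations for `U` and `k` have the same right-hand side. Hence `k = U`,
and this series is `Q`. -/
lemma solve_exp_exp (h : Catalytic (exp ℚ) (exp ℚ) g) :
    ∃ Q : ℚ⟦X⟧, constantCoeff Q = 0 ∧ Q = X * fexp (2 * Q) ∧ g = 2 * Q + fln (1 - Q) := by
  obtain ⟨hg, K, hK, h⟩ := h
  obtain ⟨U, k, hU, hk, h1, h2, h3⟩ := kernel_method (exp ℚ) (exp ℚ) 0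
    ((exp ℚ).subst g) hK (by simpa using h)
  simp only [derivative_exp, subst_exp, add_zero] at h1 h2 h3
  obtain rfl : k = U := h2.trans h1.symm
  have hfe : fexp k * fexp k = fexp (2 * k) := by
    apply eq_of_ld_eq <;> simp [ld_mul, ld_fexp, constantCoeff_fexp, hk]
    ring
  have hG : fexp g = fexp k * fexp k * (1 - k) := X_cancel (by linear_combination h3 - k * h2)
  refine ⟨k, hU, by rw [← hfe]; exact h1, ?_⟩
  refine derivative.ext ?_ (by simp [hg, hk, constantCoeff_fln])
  have := congrArg ld hG
  simp [ld_mul, ld_fexp, constantCoeff_fexp, hk, hg] at this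
  simp [derivative_fln, hk]
  linear_combination this

/-- Here the equal right-hand sides give `k + g = U`, which is `Q`. The third equation evaluates the
product of exponentials as `1 / (1 - U)`, so none is left in the equation for `Q`. -/
lemma solve_exp_exp_prime (h : PrimeCatalytic (exp ℚ) (exp ℚ) g) :
    ∃ Q : ℚ⟦X⟧, constantCoeff Q = 0 ∧ Q = X * (1 - Q)⁻¹ ∧ g = 2 * Q + fln (1 - Q) := by
  obtain ⟨K, hK, h⟩ := h
  obtain ⟨U, k, hU, hk, h1, h2, h3⟩ := kernel_method (exp ℚ) (exp ℚ) g 1 hK (by simpa using h)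
  simp only [derivative_exp, subst_exp] at h1 h2 h3
  have hG : fexp U * fexp k * (1 - U) = 1 := X_cancel (by linear_combination U * h2 - h3)
  have hI : (1 - U)⁻¹ * (1 - U) = 1 := PowerSeries.inv_mul_cancel _ (by simp [hU])
  have hEI : fexp U * fexp k = (1 - U)⁻¹ := by
    linear_combination (1 - U)⁻¹ * hG - fexp U * fexp k * hI
  have hg : k + g = U := h2.trans h1.symm
  refine ⟨U, hU, by rw [← hEI]; exact h1, ?_⟩
  have hg0 : constantCoeff g = 0 := by
    have := congrArg constantCoeff hg
    simpa [hk, hU] using this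
  refine derivative.ext ?_ (by simp [hg0, hU, constantCoeff_fln])
  have h4 := congrArg ld hG
  have h5 := congrArg (d⁄dX ℚ) hg
  simp [ld_mul, ld_fexp, constantCoeff_fexp, hk, hU, ld_one] at h4 h5
  simp [derivative_fln, hU]
  linear_combination h5 - h4

/-- Dividing the second kernel equation by the first gives `k = U / (1 - U)`, hence `A(U) = 1 + k`;
the parameter `Q` is `k`. -/
lemma solve_exp_geom (h : Catalytic ((1 - X)⁻¹) (exp ℚ) g) :
    ∃ Q : ℚ⟦X⟧, constantCoeff Q = 0 ∧ Q = X * ((1 + Q) ^ 2 * fexp Q) ∧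
      g = Q + fln (1 + Q) + fln (1 - Q) := by
  obtain ⟨hg, K, hK, h⟩ := h
  obtain ⟨U, k, hU, hk, h1, h2, h3⟩ := kernel_method ((1 - X)⁻¹) (exp ℚ) 0
    ((exp ℚ).subst g) hK (by simpa using h)
  simp only [derivative_exp, subst_exp, add_zero, subst_derivative_geom hU, subst_geom hU]
    at h1 h2 h3
  have hI : (1 - U)⁻¹ * (1 - U) = 1 := PowerSeries.inv_mul_cancel _ (by simp [hU])
  set I := (1 - U)⁻¹ with hIdef
  have hkU : k = U * I := by linear_combination h2 - I * h1
  have hIk : I = 1 + k := by linear_combination hI - hkU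
  rw [hIk] at h1 h2 h3 hkU
  have hG : fexp g = fexp k * ((1 + k) * (1 - k)) :=
    X_cancel (by linear_combination h3 - U * h2 + X * (1 + k) * fexp k * hkU)
  refine ⟨k, hk, h2, ?_⟩
  refine derivative.ext ?_ (by simp [hg, hk, constantCoeff_fln])
  have := congrArg ld hG
  simp [ld_mul, ld_fexp, constantCoeff_fexp, hk, hg] at this
  simp [derivative_fln, hk]
  linear_combination this

/-- The parameter is `Q = k + g = U / (1 - U)`, and the third equation replaces `exp k` by `1 / (1 -
Q ^ 2)`. -/
lemma solve_exp_geom_prime (h : PrimeCatalytic ((1 - X)⁻¹) (exp ℚ) g) :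
    ∃ Q : ℚ⟦X⟧, constantCoeff Q = 0 ∧ Q = X * ((1 + Q) * (1 - Q)⁻¹) ∧
      g = Q + fln (1 + Q) + fln (1 - Q) := by
  obtain ⟨K, hK, h⟩ := h
  obtain ⟨U, k, hU, hk, h1, h2, h3⟩ := kernel_method ((1 - X)⁻¹) (exp ℚ) g 1 hK
    (by simpa using h)
  simp only [derivative_exp, subst_exp, subst_derivative_geom hU, subst_geom hU] at h1 h2 h3
  have hI : (1 - U)⁻¹ * (1 - U) = 1 := PowerSeries.inv_mul_cancel _ (by simp [hU])
  set I := (1 - U)⁻¹ with hIdef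
  obtain ⟨Q, hQ⟩ : ∃ Q : ℚ⟦X⟧, Q = k + g := ⟨_, rfl⟩
  rw [← hQ] at h2 h3
  have hkU : Q = U * I := by linear_combination h2 - I * h1
  have hIk : I = 1 + Q := by linear_combination hI - hkU
  have hQ0 : constantCoeff Q = 0 := by simp [hkU, hU]
  rw [hIk] at h1 h2 h3 hkU
  have hG : fexp k * ((1 + Q) * (1 - Q)) = 1 :=
    X_cancel (by linear_combination U * h2 - h3 - X * (1 + Q) * fexp k * hkU)
  have hJ : (1 - Q)⁻¹ * (1 - Q) = 1 := PowerSeries.inv_mul_cancel _ (by simp [hQ0])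
  have hEJ : (1 + Q) ^ 2 * fexp k = (1 + Q) * (1 - Q)⁻¹ := by
    linear_combination (1 + Q) * (1 - Q)⁻¹ * hG - (1 + Q) ^ 2 * fexp k * hJ
  have hg0 : constantCoeff g = 0 := by
    have := congrArg constantCoeff hQ
    simpa [hk, hQ0, eq_comm] using this
  refine ⟨Q, hQ0, by rw [← hEJ]; exact h2, ?_⟩
  refine derivative.ext ?_ (by simp [hg0, hQ0, constantCoeff_fln])
  have h4 := congrArg ld hG
  have h5 := congrArg (d⁄dX ℚ) hQ
  simp [ld_mul, ld_fexp, constantCoeff_fexp, hk, hQ0, ld_one] at h4 h5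
  simp [derivative_fln, hQ0]
  linear_combination -h5 - h4

end Unordered

/-! ### Implicit forms for unordered trees -/

section Implicit

variable {g : ℚ⟦X⟧}

lemma subst_natCast {Q : ℚ⟦X⟧} (hQ : constantCoeff Q = 0) (n : ℕ) :
    (n : ℚ⟦X⟧).subst Q = n := by
  rw [← coe_substAlgHom (HasSubst.of_constantCoeff_zero' hQ), map_natCast]

lemma subst_ofNat {Q : ℚ⟦X⟧} (hQ : constantCoeff Q = 0) (n : ℕ) [n.AtLeastTwo] :
    (OfNat.ofNat n : ℚ⟦X⟧).subst Q = OfNat.ofNat n := by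
  rw [← coe_substAlgHom (HasSubst.of_constantCoeff_zero' hQ), map_ofNat]

lemma implicit_unordered_exp (h : Catalytic (exp ℚ) (exp ℚ) g) :
    ImplicitForm g (2 * q + fln (1 - q)) (fexp (2 * q)) := by
  obtain ⟨Q, hQ, h1, h2⟩ := solve_exp_exp h
  have hs := HasSubst.of_constantCoeff_zero' hQ
  refine ImplicitForm.intro (Q := Q) ?_ ?_
  · simpa [subst_add hs, subst_sub hs, subst_mul hs, subst_ofNat hQ, subst_one' hQ,
    subst_X hs, subst_fln, subst_fexp, hQ] using h1
  · simpa [subst_add hs, subst_sub hs, subst_mul hs, subst_ofNat hQ, subst_one' hQ,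
    subst_X hs, subst_fln, subst_fexp, hQ] using h2

lemma implicit_unordered_exp_prime (h : PrimeCatalytic (exp ℚ) (exp ℚ) g) :
    ImplicitForm g (2 * q + fln (1 - q)) (1 - q)⁻¹ := by
  obtain ⟨Q, hQ, h1, h2⟩ := solve_exp_exp_prime h
  have hs := HasSubst.of_constantCoeff_zero' hQ
  refine ImplicitForm.intro (Q := Q) ?_ ?_
  · simpa [subst_add hs, subst_sub hs, subst_mul hs, subst_ofNat hQ, subst_one' hQ,
    subst_X hs, subst_fln, subst_inv, hQ] using h1
  · simpa [subst_add hs, subst_sub hs, subst_mul hs, subst_ofNat hQ, subst_one' hQ,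
    subst_X hs, subst_fln, subst_inv, hQ] using h2

lemma implicit_unordered_geom (h : Catalytic ((1 - X)⁻¹) (exp ℚ) g) :
    ImplicitForm g (q + fln (1 + q) + fln (1 - q)) ((1 + q) ^ 2 * fexp q) := by
  obtain ⟨Q, hQ, h1, h2⟩ := solve_exp_geom h
  have hs := HasSubst.of_constantCoeff_zero' hQ
  refine ImplicitForm.intro (Q := Q) ?_ ?_
  · simpa [subst_add hs, subst_sub hs, subst_mul hs, subst_pow hs, subst_one' hQ,
    subst_X hs, subst_fln, subst_fexp, hQ] using h1
  · simpa [subst_add hs, subst_sub hs, subst_mul hs, subst_pow hs, subst_one' hQ,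
    subst_X hs, subst_fln, subst_fexp, hQ] using h2

lemma implicit_unordered_geom_prime (h : PrimeCatalytic ((1 - X)⁻¹) (exp ℚ) g) :
    ImplicitForm g (q + fln (1 + q) + fln (1 - q)) ((1 + q) * (1 - q)⁻¹) := by
  obtain ⟨Q, hQ, h1, h2⟩ := solve_exp_geom_prime h
  have hs := HasSubst.of_constantCoeff_zero' hQ
  refine ImplicitForm.intro (Q := Q) ?_ ?_
  · simpa [subst_add hs, subst_sub hs, subst_mul hs, subst_inv, subst_one' hQ,
    subst_X hs, subst_fln, subst_fexp, hQ] using h1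
  · simpa [subst_add hs, subst_sub hs, subst_mul hs, subst_inv, subst_one' hQ,
    subst_X hs, subst_fln, subst_fexp, hQ] using h2

end Implicit
end TreeParking

namespace TreeParking
open PowerSeries Finset

/-! ### Implicit forms for `d`-ary, `d`-bundled and ordered trees -/

section ImplicitPow

lemma fpow_natCast {f : ℚ⟦X⟧} (hf : constantCoeff f = 1) (n : ℕ) : fpow f n = f ^ n := by
  apply eq_of_ld_eq (constantCoeff_fpow hf _) (by simp [hf])
  rw [ld_fpow hf, ld_pow (by simp [hf]), map_natCast]

lemma fpow_neg {f : ℚ⟦X⟧} (hf : constantCoeff f = 1) (a : ℚ) : fpow f (-a) = (fpow f a)⁻¹ := by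
  apply eq_of_ld_eq (constantCoeff_fpow hf _) (by simp [constantCoeff_fpow hf])
  rw [ld_fpow hf, ld_inv (by simp [constantCoeff_fpow hf]), ld_fpow hf]
  simp

lemma fpow_one {f : ℚ⟦X⟧} (hf : constantCoeff f = 1) : fpow f 1 = f := by
  simpa using fpow_natCast hf 1

lemma fpow_zero {f : ℚ⟦X⟧} (hf : constantCoeff f = 1) : fpow f 0 = 1 := by
  simpa using fpow_natCast hf 0

lemma fpow_one_sub_natCast {f : ℚ⟦X⟧} (hf : constantCoeff f = 1) {d : ℕ} (hd : d ≠ 0) :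
    fpow f (1 - d) = (f ^ (d - 1))⁻¹ := by
  rw [← fpow_natCast hf, ← fpow_neg hf]
  congr 1
  rw [Nat.cast_sub (by omega)]
  simp

lemma fexp_neg {f : ℚ⟦X⟧} (hf : constantCoeff f = 0) : fexp (-f) = (fexp f)⁻¹ := by
  apply eq_of_ld_eq <;> simp [constantCoeff_fexp, hf, ld_fexp, ld_inv]

variable {g : ℚ⟦X⟧} {d : ℕ}

lemma implicit_dary_exp (hd : d ≠ 0) (h : Catalytic (exp ℚ) (powSeries 1 d) g) :
    ImplicitForm g (fpow (1 - d * q) (1 / d) * fexp q * (1 - q)⁻¹ - 1)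
      (fexp (d * q) * ((1 - q) ^ (d - 1))⁻¹) := by
  obtain ⟨hg, K, hK, h⟩ := h
  obtain ⟨Q, hQ, h1, h2⟩ := solve_powSeries_exp (by norm_num) hd hK hg h
  have hs := HasSubst.of_constantCoeff_zero' hQ
  refine ImplicitForm.intro (Q := Q) ?_ ?_
  · simpa [subst_sub hs, subst_mul hs, subst_pow hs, subst_natCast hQ, subst_one' hQ, subst_X hs,
      subst_fexp, subst_inv, hQ, fpow_one_sub_natCast, hd] using h1
  · simp [subst_sub hs, subst_mul hs, subst_natCast hQ, subst_one' hQ, subst_X hs,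
      subst_fexp, subst_fpow, subst_inv, hQ] at h2 ⊢
    linear_combination h2

lemma implicit_dary_exp_prime (hd : d ≠ 0) (h : PrimeCatalytic (exp ℚ) (powSeries 1 d) g) :
    ImplicitForm g (1 - (1 - q) * (fpow (1 - d * q) (1 / d) * fexp q)⁻¹)
      (fexp q * (fpow (1 - d * q) ((d - 1) / d))⁻¹) := by
  obtain ⟨K, hK, h⟩ := h
  obtain ⟨Q, hQ, h1, h2⟩ := solve_powSeries_exp_prime (by norm_num) hd hK h
  have hs := HasSubst.of_constantCoeff_zero' hQ
  have hd' : (d : ℚ) ≠ 0 := by exact_mod_cast hd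
  refine ImplicitForm.intro (Q := Q) ?_ ?_
  · rw [show (1 / d - 1 : ℚ) = -((d - 1) / d) by field_simp; ring, fpow_neg (by simp [hQ])] at h1
    simpa [subst_sub hs, subst_mul hs, subst_natCast hQ, subst_one' hQ, subst_X hs,
      subst_fexp, subst_fpow, subst_inv, hQ, constantCoeff_fpow] using h1
  · rw [fpow_neg (by simp [hQ]), fexp_neg (by simp [hQ])] at h2
    simp [subst_sub hs, subst_mul hs, subst_natCast hQ, subst_one' hQ, subst_X hs,
      subst_fexp, subst_fpow, subst_inv, hQ, constantCoeff_fpow, constantCoeff_fexp] at h2 ⊢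
    linear_combination -h2

lemma implicit_dbundled_exp (hd : d ≠ 0) (h : Catalytic (exp ℚ) (powSeries (-1) d) g) :
    ImplicitForm g (1 - (fpow (1 - d * q) (1 / d) * (1 + q) * fexp q)⁻¹)
      ((1 + q) ^ (d + 1) * fexp (d * q)) := by
  obtain ⟨hg, K, hK, h⟩ := h
  obtain ⟨Q, hQ, h1, h2⟩ := solve_powSeries_exp (by norm_num) hd hK hg h
  have hs := HasSubst.of_constantCoeff_zero' hQ
  refine ImplicitForm.intro (Q := Q) ?_ ?_
  · rw [show (1 - -1 * d : ℚ) = (d + 1 : ℕ) by push_cast; ring, fpow_natCast (by simp [hQ]),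
      mul_comm (fexp _)] at h1
    simpa [subst_add hs, subst_mul hs, subst_pow hs, subst_natCast hQ, subst_one' hQ, subst_X hs,
      subst_fexp, hQ] using h1
  · rw [neg_div, fpow_neg (by simp [hQ])] at h2
    simp [subst_sub hs, subst_add hs, subst_mul hs, subst_natCast hQ, subst_one' hQ, subst_X hs,
      subst_fexp, subst_fpow, subst_inv, hQ, constantCoeff_fpow, constantCoeff_fexp, fexp_neg] at h2 ⊢
    linear_combination -h2

lemma implicit_dbundled_exp_prime (hd : d ≠ 0)
    (h : PrimeCatalytic (exp ℚ) (powSeries (-1) d) g) :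
    ImplicitForm g (fpow (1 - d * q) (1 / d) * (1 + q) * fexp q - 1)
      (fpow (1 - d * q) ((d + 1) / d) * fexp q)⁻¹ := by
  obtain ⟨K, hK, h⟩ := h
  obtain ⟨Q, hQ, h1, h2⟩ := solve_powSeries_exp_prime (by norm_num) hd hK h
  have hs := HasSubst.of_constantCoeff_zero' hQ
  have hd' : (d : ℚ) ≠ 0 := by exact_mod_cast hd
  refine ImplicitForm.intro (Q := Q) ?_ ?_
  · rw [show (-1 / d - 1 : ℚ) = -((d + 1) / d) by field_simp; ring, fpow_neg (by simp [hQ])] at h1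
    simpa [subst_sub hs, subst_mul hs, subst_natCast hQ, subst_one' hQ, subst_X hs,
      subst_fexp, subst_fpow, subst_inv, hQ, constantCoeff_fpow, constantCoeff_fexp, fexp_neg,
      PowerSeries.mul_inv_rev] using h1
  · simp [subst_sub hs, subst_add hs, subst_mul hs, subst_natCast hQ, subst_one' hQ, subst_X hs,
      subst_fexp, subst_fpow, hQ, neg_div] at h2 ⊢
    linear_combination h2

lemma smul_eq_C_mul' (a : ℚ) (f : ℚ⟦X⟧) : a • f = C a * f := by
  ext n; simp

lemma implicit_dary_geom (hd : d ≠ 0) (h : Catalytic ((1 - X)⁻¹) (powSeries 1 d) g) :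
    ImplicitForm g (fpow (1 - q ^ 2) (1 / d) * (1 - (1 / d : ℚ) • q)⁻¹ - 1)
      (d * (1 + q) ^ 2 * ((1 - (1 / d : ℚ) • q) ^ (d - 1))⁻¹) := by
  obtain ⟨hg, K, hK, h⟩ := h
  obtain ⟨Q, hQ, h1, h2⟩ := solve_powSeries_geom (by norm_num) hd hK hg h
  have hs := HasSubst.of_constantCoeff_zero' hQ
  refine ImplicitForm.intro (Q := Q) ?_ ?_
  · rw [one_mul, fpow_one_sub_natCast (by simp [hQ]) hd] at h1
    simpa [subst_sub hs, subst_add hs, subst_mul hs, subst_pow hs, subst_natCast hQ, subst_one' hQ,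
      subst_X hs, subst_C' hQ, subst_inv, hQ, smul_eq_C_mul'] using h1
  · simp [subst_sub hs, subst_mul hs, subst_pow hs, subst_one' hQ,
      subst_X hs, subst_C' hQ, subst_fpow, subst_inv, hQ, smul_eq_C_mul'] at h2 ⊢
    linear_combination h2

lemma implicit_dary_geom_prime (hd : d ≠ 0) (h : PrimeCatalytic ((1 - X)⁻¹) (powSeries 1 d) g) :
    ImplicitForm g (1 - (1 - (1 / d : ℚ) • q) * (fpow (1 - q ^ 2) (1 / d))⁻¹)
      (d * fpow (1 + q) ((d + 1) / d) * (fpow (1 - q) ((d - 1) / d))⁻¹) := by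
  obtain ⟨K, hK, h⟩ := h
  obtain ⟨Q, hQ, h1, h2⟩ := solve_powSeries_geom_prime (by norm_num) hd hK h
  have hs := HasSubst.of_constantCoeff_zero' hQ
  have hd' : (d : ℚ) ≠ 0 := by exact_mod_cast hd
  refine ImplicitForm.intro (Q := Q) ?_ ?_
  · rw [show (1 / d - 1 : ℚ) = -((d - 1) / d) by field_simp; ring, fpow_neg (by simp [hQ]),
      show (1 + 1 / d : ℚ) = (d + 1) / d by field_simp] at h1
    simpa [subst_sub hs, subst_add hs, subst_mul hs, subst_natCast hQ, subst_one' hQ,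
      subst_X hs, subst_fpow, subst_inv, hQ, constantCoeff_fpow, mul_assoc] using h1
  · rw [fpow_neg (by simp [hQ])] at h2
    simp [subst_sub hs, subst_mul hs, subst_pow hs, subst_one' hQ,
      subst_X hs, subst_C' hQ, subst_fpow, subst_inv, hQ, smul_eq_C_mul',
      constantCoeff_fpow] at h2 ⊢
    linear_combination -h2

lemma implicit_dbundled_geom (hd : d ≠ 0) (h : Catalytic ((1 - X)⁻¹) (powSeries (-1) d) g) :
    ImplicitForm g (1 - ((1 + (1 / d : ℚ) • q) * fpow (1 - q ^ 2) (1 / d))⁻¹)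
      (d * (1 + q) ^ 2 * (1 + (1 / d : ℚ) • q) ^ (d + 1)) := by
  obtain ⟨hg, K, hK, h⟩ := h
  obtain ⟨Q, hQ, h1, h2⟩ := solve_powSeries_geom (by norm_num) hd hK hg h
  have hs := HasSubst.of_constantCoeff_zero' hQ
  refine ImplicitForm.intro (Q := Q) ?_ ?_
  · rw [show (1 - -1 * d : ℚ) = (d + 1 : ℕ) by push_cast; ring, fpow_natCast (by simp [hQ])] at h1
    simpa [subst_add hs, subst_mul hs, subst_pow hs, subst_natCast hQ, subst_one' hQ,
      subst_X hs, subst_C' hQ, smul_eq_C_mul', neg_div] using h1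
  · rw [neg_div, fpow_neg (by simp [hQ])] at h2
    simp [subst_sub hs, subst_add hs, subst_mul hs, subst_pow hs, subst_one' hQ,
      subst_X hs, subst_C' hQ, subst_fpow, subst_inv, hQ, smul_eq_C_mul',
      constantCoeff_fpow] at h2 ⊢
    linear_combination -h2

lemma implicit_dbundled_geom_prime (hd : d ≠ 0)
    (h : PrimeCatalytic ((1 - X)⁻¹) (powSeries (-1) d) g) :
    ImplicitForm g ((1 + (1 / d : ℚ) • q) * fpow (1 - q ^ 2) (1 / d) - 1)
      (d * fpow (1 + q) ((d - 1) / d) * (fpow (1 - q) ((d + 1) / d))⁻¹) := by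
  obtain ⟨K, hK, h⟩ := h
  obtain ⟨Q, hQ, h1, h2⟩ := solve_powSeries_geom_prime (by norm_num) hd hK h
  have hs := HasSubst.of_constantCoeff_zero' hQ
  have hd' : (d : ℚ) ≠ 0 := by exact_mod_cast hd
  refine ImplicitForm.intro (Q := Q) ?_ ?_
  · rw [show (-1 / d - 1 : ℚ) = -((d + 1) / d) by field_simp; ring, fpow_neg (by simp [hQ]),
      show (1 + -1 / d : ℚ) = (d - 1) / d by field_simp; ring] at h1
    simpa [subst_sub hs, subst_add hs, subst_mul hs, subst_natCast hQ, subst_one' hQ,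
      subst_X hs, subst_fpow, subst_inv, hQ, constantCoeff_fpow, mul_assoc] using h1
  · simp [subst_sub hs, subst_add hs, subst_mul hs, subst_pow hs, subst_one' hQ,
      subst_X hs, subst_C' hQ, subst_fpow, hQ, smul_eq_C_mul', neg_div] at h2 ⊢
    linear_combination h2

/-- A sequence of children is a single bundle, so the ordered families are the case `d = 1` of the
bundled ones. -/
lemma implicit_ordered_exp (h : Catalytic (exp ℚ) (powSeries (-1) 1) g) :
    ImplicitForm g (1 - ((1 - q) * (1 + q) * fexp q)⁻¹) ((1 + q) ^ 2 * fexp q) := by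
  simpa [fpow_one] using implicit_dbundled_exp one_ne_zero h

lemma implicit_ordered_exp_prime (h : PrimeCatalytic (exp ℚ) (powSeries (-1) 1) g) :
    ImplicitForm g ((1 + q) * (1 - q) * fexp q - 1) ((1 - q) ^ 2 * fexp q)⁻¹ := by
  have h2 : fpow (1 - q) (1 + 1) = (1 - q) ^ 2 := by
    rw [← fpow_natCast (by simp)]; norm_num
  have := implicit_dbundled_exp_prime one_ne_zero h
  simp only [Nat.cast_one, one_mul, div_one, fpow_one (show constantCoeff (1 - q) = 1 by simp),
    h2] at this
  rwa [mul_comm (1 + q)]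

lemma implicit_ordered_geom (h : Catalytic ((1 - X)⁻¹) (powSeries (-1) 1) g) :
    ImplicitForm g (1 - ((1 + q) ^ 2 * (1 - q))⁻¹) ((1 + q) ^ 4) := by
  have := implicit_dbundled_geom one_ne_zero h
  simp only [Nat.cast_one, one_mul, div_one, one_smul,
    fpow_one (show constantCoeff (1 - q ^ 2) = 1 by simp)] at this
  convert this using 1
  · congr 2; ring
  · ring

lemma implicit_ordered_geom_prime (h : PrimeCatalytic ((1 - X)⁻¹) (powSeries (-1) 1) g) :
    ImplicitForm g ((1 + q) ^ 2 * (1 - q) - 1) ((1 - q) ^ 2)⁻¹ := by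
  have h2 : fpow (1 - q) (1 + 1) = (1 - q) ^ 2 := by
    rw [← fpow_natCast (by simp)]; norm_num
  have := implicit_dbundled_geom_prime one_ne_zero h
  simp only [Nat.cast_one, one_mul, div_one, one_smul, sub_self, h2,
    fpow_zero (show constantCoeff (1 + q) = 1 by simp),
    fpow_one (show constantCoeff (1 - q ^ 2) = 1 by simp)] at this
  convert this using 1
  ring

end ImplicitPow
end TreeParking

/-! ### Parking as a condition on the number of drivers per subtree -/

namespace TreeParking
open Finset

open Classical in
/-- The nodes from which `v` is reached by iterating `p`. -/
noncomputable def desc {V : Type*} [Fintype V] (p : V → V) (v : V) : Finset V :=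
  {x | ∃ k : ℕ, p^[k] x = v}

lemma mem_desc {V : Type*} [Fintype V] {p : V → V} {v x : V} :
    x ∈ desc p v ↔ ∃ k : ℕ, p^[k] x = v := by
  simp [desc]

lemma self_mem_desc {V : Type*} [Fintype V] (p : V → V) (v : V) : v ∈ desc p v :=
  mem_desc.2 ⟨0, rfl⟩

namespace RootedTree

variable {n m : ℕ} (T : RootedTree n)

lemma iterate_parent_root (k : ℕ) : T.parent^[k] T.root = T.root :=
  Function.iterate_fixed T.parent_root k

lemma mem_desc_root (x : Fin n) : x ∈ desc T.parent T.root := mem_desc.2 (T.reaches_root x)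

/-- If `k` steps lead from `v` to the root, running `k` times through the cycle at `v` takes at
least `k` steps, so it ends at the root as well as at `v`. -/
lemma eq_root_of_iterate_eq {v : Fin n} {j : ℕ} (hj : 0 < j) (h : T.parent^[j] v = v) :
    v = T.root := by
  obtain ⟨k, hk⟩ := T.reaches_root v
  have h1 : T.parent^[j * k] v = v := by
    rw [Function.iterate_mul]
    exact Function.iterate_fixed h k
  obtain ⟨l, hl⟩ : ∃ l, j * k = l + k := ⟨j * k - k, by
    have : k ≤ j * k := Nat.le_mul_of_pos_left k hj
    omega⟩
  rw [hl, Function.iterate_add_apply, hk, iterate_parent_root] at h1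
  exact h1.symm

open Classical in
lemma arrive_of_exists {occ : Finset (Fin n)} {x : Fin n}
    (h : ∃ k : ℕ, T.parent^[k] x ∉ occ) :
    T.arrive occ x = insert (T.parent^[Nat.find h] x) occ := by
  simp only [arrive, freeSpot, dif_pos h]

lemma arrive_of_not_exists {occ : Finset (Fin n)} {x : Fin n}
    (h : ¬ ∃ k : ℕ, T.parent^[k] x ∉ occ) : T.arrive occ x = occ := by
  simp only [arrive, freeSpot, dif_neg h]

open Classical in
lemma isSome_freeSpot_iff {occ : Finset (Fin n)} {x : Fin n} :
    (T.freeSpot occ x).isSome ↔ ∃ k : ℕ, T.parent^[k] x ∉ occ := by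
  by_cases h : ∃ k : ℕ, T.parent^[k] x ∉ occ
  · simp only [freeSpot, dif_pos h, Option.isSome_some, true_iff]
    exact h
  · simp only [freeSpot, dif_neg h, Option.isSome_none, Bool.false_eq_true, false_iff]
    exact h

/-- Paths are constant once they reach the root. Crossing the root, which corresponds to no edge,
therefore stands for leaving the tree without parking. -/
lemma crosses_root_iff {occ : Finset (Fin n)} {x : Fin n} :
    T.Crosses occ x T.root ↔ ¬ (T.freeSpot occ x).isSome := by
  rw [isSome_freeSpot_iff]
  push Not
  constructor
  · rintro ⟨k, hk, h⟩ j
    rcases le_total j k with hj | hj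
    · exact h j hj
    · obtain ⟨l, rfl⟩ := Nat.exists_eq_add_of_le' hj
      rw [Function.iterate_add_apply, hk, iterate_parent_root, ← hk]
      exact h k le_rfl
  · intro h
    obtain ⟨k, hk⟩ := T.reaches_root x
    exact ⟨k, hk, fun j _ => h j⟩

lemma subset_arrive (occ : Finset (Fin n)) (x : Fin n) : occ ⊆ T.arrive occ x := by
  by_cases h : ∃ k : ℕ, T.parent^[k] x ∉ occ
  · classical
    rw [arrive_of_exists T h]
    convert subset_insert _ occ
  · rw [arrive_of_not_exists T h]

open Classical in
/-- A driver who starts in the subtree of `v` either parks in it or leaves it. -/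
lemma card_arrive_inter_desc (occ : Finset (Fin n)) (x v : Fin n) :
    #(T.arrive occ x ∩ desc T.parent v) + (if T.Crosses occ x v then 1 else 0)
      = #(occ ∩ desc T.parent v) + (if x ∈ desc T.parent v then 1 else 0) := by
  have hcd : T.Crosses occ x v → x ∈ desc T.parent v := fun ⟨k, hk, _⟩ => mem_desc.2 ⟨k, hk⟩
  by_cases h : ∃ k : ℕ, T.parent^[k] x ∉ occ
  · have hw := Nat.find_spec h
    have hlt : ∀ j < Nat.find h, T.parent^[j] x ∈ occ := fun j hj => by
      simpa using Nat.find_min h hj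
    have harr := arrive_of_exists T h
    generalize Nat.find h = k₀ at hw hlt harr
    by_cases hwd : T.parent^[k₀] x ∈ desc T.parent v
    · have hx : x ∈ desc T.parent v := by
        obtain ⟨l, hl⟩ := mem_desc.1 hwd
        exact mem_desc.2 ⟨l + k₀, by rw [Function.iterate_add_apply, hl]⟩
      -- A driver who passes `v` and then parks in its subtree has returned to `v`, so `v` lies on a
      -- cycle and is the root. His place would then be the root, which he found occupied.
      have hc : ¬ T.Crosses occ x v := by
        rintro ⟨k, hk, hocc⟩
        have hk₀ : k < k₀ := by
          by_contra hcon
          exact hw (hocc k₀ (by omega))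
        obtain ⟨l, hl⟩ := mem_desc.1 hwd
        have hcyc : T.parent^[l + (k₀ - k)] v = v := by
          rw [← hk, ← Function.iterate_add_apply, show l + (k₀ - k) + k = l + k₀ by omega,
            Function.iterate_add_apply, hl, hk]
        have hv := T.eq_root_of_iterate_eq (by omega) hcyc
        apply hw
        rw [show k₀ = (k₀ - k) + k by omega, Function.iterate_add_apply, hk, hv,
          iterate_parent_root, ← hv, ← hk]
        exact hocc k le_rfl
      have hno : T.parent^[k₀] x ∉ occ ∩ desc T.parent v := fun h' => hw (mem_inter.1 h').1
      rw [harr, insert_inter_of_mem hwd]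
      simp only [hx, hc, if_true, if_false, add_zero]
      convert card_insert_of_notMem hno
    · have hiff : T.Crosses occ x v ↔ x ∈ desc T.parent v := by
        refine ⟨hcd, fun hx => ?_⟩
        obtain ⟨k, hk⟩ := mem_desc.1 hx
        refine ⟨k, hk, fun j hj => hlt j ?_⟩
        by_contra hcon
        apply hwd
        refine mem_desc.2 ⟨k - k₀, ?_⟩
        rw [← Function.iterate_add_apply, show k - k₀ + k₀ = k by omega, hk]
      rw [harr, insert_inter_of_notMem hwd]
      simp only [hiff]
  · have hiff : T.Crosses occ x v ↔ x ∈ desc T.parent v := by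
      refine ⟨hcd, fun hx => ?_⟩
      obtain ⟨k, hk⟩ := mem_desc.1 hx
      push Not at h
      exact ⟨k, hk, fun j _ => h j⟩
    rw [arrive_of_not_exists T h]
    simp only [hiff]

/-- The occupied nodes after the arrival of the first `k` drivers. -/
noncomputable def occupiedAfter (s : Fin m → Fin n) (k : ℕ) : Finset (Fin n) :=
  ((List.ofFn s).take k).foldl T.arrive ∅

lemma occupiedAfter_succ (s : Fin m → Fin n) (i : Fin m) :
    T.occupiedAfter s (i + 1) = T.arrive (T.occupiedAfter s i) (s i) := by
  rw [occupiedAfter, List.take_add_one, List.foldl_append]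
  simp [occupiedAfter]

lemma occupiedAfter_mono (s : Fin m → Fin n) (i : Fin m) :
    T.occupiedBefore s i ⊆ T.occupiedAfter s m := by
  have : ∀ k ≤ m, (i : ℕ) ≤ k → T.occupiedAfter s i ⊆ T.occupiedAfter s k := by
    intro k
    induction k with
    | zero =>
      intro _ h
      rw [Nat.le_zero.1 h]
    | succ k ih =>
      intro hk h
      rcases Nat.eq_or_lt_of_le h with h | h
      · rw [h]
      · refine (ih (by omega) (by omega)).trans ?_
        rw [show k = ((⟨k, by omega⟩ : Fin m) : ℕ) from rfl, occupiedAfter_succ]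
        exact T.subset_arrive _ _
  exact this m le_rfl i.2.le

open Classical in
-- The conservation law, obtained from `card_arrive_inter_desc` by telescoping over all arrivals.
-- Both the parking and the prime criterion are read off from it.
lemma card_occupiedAfter_inter_desc (s : Fin m → Fin n) (v : Fin n) :
    #(T.occupiedAfter s m ∩ desc T.parent v) + #{i | T.Crosses (T.occupiedBefore s i) (s i) v}
      = #{i | s i ∈ desc T.parent v} := by
  have h1 : ∀ i : Fin m, (#(T.occupiedAfter s (i + 1) ∩ desc T.parent v) : ℤ)
      - #(T.occupiedAfter s i ∩ desc T.parent v)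
      = (if s i ∈ desc T.parent v then 1 else 0)
        - (if T.Crosses (T.occupiedBefore s i) (s i) v then 1 else 0) := by
    intro i
    have := T.card_arrive_inter_desc (T.occupiedAfter s i) (s i) v
    rw [← occupiedAfter_succ] at this
    -- `occupiedBefore s i` is by definition `occupiedAfter s i`.
    change _ = (if s i ∈ desc T.parent v then 1 else 0)
        - (if T.Crosses (T.occupiedAfter s i) (s i) v then 1 else 0)
    zify at this
    linarith
  have h2 := sum_congr (rfl : (univ : Finset (Fin m)) = univ) fun i _ => h1 i
  rw [Fin.sum_univ_eq_sum_range (fun i => (#(T.occupiedAfter s (i + 1) ∩ desc T.parent v) : ℤ)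
      - #(T.occupiedAfter s i ∩ desc T.parent v)),
    sum_range_sub (fun i => (#(T.occupiedAfter s i ∩ desc T.parent v) : ℤ)), sum_sub_distrib] at h2
  simp only [sum_boole] at h2
  have h3 : T.occupiedAfter s 0 = ∅ := by simp [occupiedAfter]
  rw [h3, empty_inter, card_empty] at h2
  zify
  push_cast at h2
  linarith

lemma desc_root : desc T.parent T.root = univ := by
  ext x; simp [mem_desc_root]

open Classical in
lemma allPark_iff_forall_not_crosses (s : Fin m → Fin n) :
    T.AllPark s ↔ #{i | T.Crosses (T.occupiedBefore s i) (s i) T.root} = 0 := by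
  rw [card_eq_zero, filter_eq_empty_iff]
  simp only [mem_univ, true_implies, crosses_root_iff, not_not]
  rfl

open Classical in
-- Conservation at the root: the occupied nodes and the lost drivers together number `n`.
lemma allPark_iff_occupiedAfter (s : Fin n → Fin n) :
    T.AllPark s ↔ T.occupiedAfter s n = univ := by
  have h := T.card_occupiedAfter_inter_desc s T.root
  simp only [desc_root, inter_univ, mem_univ, filter_true, card_univ, Fintype.card_fin] at h
  rw [allPark_iff_forall_not_crosses, ← card_eq_iff_eq_univ, Fintype.card_fin]
  omega

open Classical in
/-- All drivers can park if and only if, for each node `v`, at least as many drivers start in the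
subtree of `v` as it has nodes. -/
lemma allPark_iff (s : Fin n → Fin n) :
    T.AllPark s ↔ ∀ v, #(desc T.parent v) ≤ #{i | s i ∈ desc T.parent v} := by
  rw [allPark_iff_occupiedAfter]
  constructor
  · intro h v
    have := T.card_occupiedAfter_inter_desc s v
    rw [h, univ_inter] at this
    omega
  · intro h
    by_contra hne
    -- Nodes stay occupied, so nobody ever crosses a node `v` that is free at the end. All drivers
    -- from its subtree park there and, by assumption, fill it, including `v`.
    obtain ⟨v, hv⟩ : ∃ v, v ∉ T.occupiedAfter s n := by
      by_contra! hcon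
      exact hne (eq_univ_iff_forall.2 hcon)
    have h1 := T.card_occupiedAfter_inter_desc s v
    have h2 : #{i | T.Crosses (T.occupiedBefore s i) (s i) v} = 0 := by
      rw [card_eq_zero, filter_eq_empty_iff]
      rintro i - ⟨k, hk, hocc⟩
      exact hv (T.occupiedAfter_mono s i (hk ▸ hocc k le_rfl))
    rw [h2, add_zero] at h1
    have h3 : T.occupiedAfter s n ∩ desc T.parent v = desc T.parent v :=
      eq_of_subset_of_card_le inter_subset_right (by rw [h1]; exact h v)
    have h4 := self_mem_desc T.parent v
    rw [← h3] at h4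
    exact hv (mem_inter.1 h4).1

open Classical in
/-- Given that all drivers can park, all edges are used if and only if, for each node `v` except
the root, more drivers start in the subtree of `v` than it has nodes. -/
lemma allEdgesUsed_iff (s : Fin n → Fin n) (h : T.AllPark s) :
    T.AllEdgesUsed s ↔ ∀ v, v ≠ T.root → #(desc T.parent v) < #{i | s i ∈ desc T.parent v} := by
  rw [allPark_iff_occupiedAfter] at h
  refine forall₂_congr fun v _ => ?_
  have h1 := T.card_occupiedAfter_inter_desc s v
  rw [h, univ_inter] at h1
  rw [← h1, Nat.lt_add_right_iff_pos, card_pos, filter_nonempty_iff]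
  simp

end RootedTree

end TreeParking

namespace TreeParking
open Finset

/-! ### Forests encoded as parent functions, and their components -/

section Forest

variable {V : Type*} [Fintype V] [DecidableEq V]

/-- `p` is the parent function of a rooted forest on the set `S`; the roots of the forest and the
elements outside of `S` are fixed points of `p`. -/
def IsForest (S : Finset V) (p : V → V) : Prop :=
  (∀ v, v ∉ S → p v = v) ∧ (∀ v ∈ S, p v ∈ S) ∧ ∀ v, ∃ k : ℕ, p (p^[k] v) = p^[k] v

/-- The roots of a forest. -/
def rootsOf (S : Finset V) (p : V → V) : Finset V := S.filter fun v => p v = v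

/-- The children of a node of a forest. -/
def kids (p : V → V) (v : V) : Finset V := univ.filter fun c => c ≠ v ∧ p c = v

/-- The load `m` of the subtree of `v` exceeds its size by at least `b`. -/
def Balanced (b : ℕ) (p : V → V) (m : V → ℕ) (v : V) : Prop :=
  #(desc p v) + b ≤ ∑ x ∈ desc p v, m x

/-- The weight of a forest with loads on its nodes. -/
def weight (w a : ℕ → ℚ) (S : Finset V) (p : V → V) (m : V → ℕ) : ℚ :=
  ∏ v ∈ S, w #(kids p v) * a (m v)

omit [Fintype V] in
lemma mem_rootsOf {S : Finset V} {p : V → V} {v : V} : v ∈ rootsOf S p ↔ v ∈ S ∧ p v = v := by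
  simp [rootsOf]

omit [DecidableEq V] in
lemma eq_of_mem_desc_of_fixed {p : V → V} {x v : V} (h : x ∈ desc p v) (hx : p x = x) :
    x = v := by
  obtain ⟨k, hk⟩ := mem_desc.1 h
  rwa [Function.iterate_fixed hx] at hk

omit [DecidableEq V] in
lemma map_mem_desc {p : V → V} {x v : V} (h : x ∈ desc p v) (hx : x ≠ v) : p x ∈ desc p v := by
  obtain ⟨k, hk⟩ := mem_desc.1 h
  rcases k with _ | k
  · exact absurd hk hx
  · exact mem_desc.2 ⟨k, hk⟩

omit [DecidableEq V] in
lemma mem_desc_of_map {p : V → V} {x v : V} (h : p x ∈ desc p v) : x ∈ desc p v := by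
  obtain ⟨k, hk⟩ := mem_desc.1 h
  exact mem_desc.2 ⟨k + 1, hk⟩

omit [DecidableEq V] in
lemma desc_subset_of_agree {p p' : V → V} {v : V}
    (h : ∀ c ∈ desc p v, c ≠ v → p' c = p c) : desc p v ⊆ desc p' v := by
  intro x hx
  obtain ⟨k, hk⟩ := mem_desc.1 hx
  induction k generalizing x with
  | zero => rw [← hk]; exact self_mem_desc _ _
  | succ k ih =>
    by_cases hxv : x = v
    · rw [hxv]; exact self_mem_desc _ _
    · apply mem_desc_of_map
      rw [h x hx hxv]
      exact ih (mem_desc.2 ⟨k, hk⟩) hk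

omit [DecidableEq V] in
lemma desc_eq_of_agree {p p' : V → V} {v : V} (h : ∀ c ∈ desc p v, c ≠ v → p' c = p c)
    (h' : ∀ c ∈ desc p' v, c ≠ v → p' c = p c) : desc p v = desc p' v :=
  (desc_subset_of_agree h).antisymm (desc_subset_of_agree fun c hc hcv => (h' c hc hcv).symm)

/-- `S` is a union of components of the forest `p`. -/
def Inv (p : V → V) (S : Finset V) : Prop := ∀ x, x ∈ S ↔ p x ∈ S

omit [Fintype V] [DecidableEq V] in
lemma IsForest.inv {S : Finset V} {p : V → V} (h : IsForest S p) : Inv p S := by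
  intro x
  refine ⟨h.2.1 x, fun hx => ?_⟩
  by_contra hcon
  rw [h.1 x hcon] at hx
  exact hcon hx

omit [Fintype V] [DecidableEq V] in
lemma Inv.iterate {S : Finset V} {p : V → V} (h : Inv p S) (k : ℕ) (x : V) :
    x ∈ S ↔ p^[k] x ∈ S := by
  induction k generalizing x with
  | zero => rfl
  | succ k ih => rw [Function.iterate_succ_apply, ← ih, ← h]

omit [DecidableEq V] in
lemma Inv.desc_subset {S : Finset V} {p : V → V} (h : Inv p S) {v : V} (hv : v ∈ S) :
    desc p v ⊆ S := by
  intro x hx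
  obtain ⟨k, hk⟩ := mem_desc.1 hx
  rw [h.iterate k, hk]
  exact hv

omit [Fintype V] in
lemma Inv.sdiff {S S' : Finset V} {p : V → V} (h : Inv p S) (h' : Inv p S') :
    Inv p (S \ S') := by
  intro x
  rw [mem_sdiff, mem_sdiff, ← h, ← h']

lemma biUnion_desc_rootsOf {S : Finset V} {p : V → V} (h : IsForest S p) :
    (rootsOf S p).biUnion (desc p) = S := by
  ext x
  rw [mem_biUnion]
  constructor
  · rintro ⟨r, hr, hx⟩
    exact h.inv.desc_subset (mem_rootsOf.1 hr).1 hx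
  · intro hx
    obtain ⟨k, hk⟩ := h.2.2 x
    exact ⟨p^[k] x, mem_rootsOf.2 ⟨(h.inv.iterate k x).1 hx, hk⟩, mem_desc.2 ⟨k, rfl⟩⟩

lemma pairwiseDisjoint_desc_rootsOf (S : Finset V) (p : V → V) :
    (rootsOf S p : Set V).PairwiseDisjoint (desc p) := by
  intro r hr r' hr' hne
  rw [Function.onFun, disjoint_left]
  intro x hx hx'
  apply hne
  obtain ⟨k, hk⟩ := mem_desc.1 hx
  obtain ⟨l, hl⟩ := mem_desc.1 hx'
  have h1 : p^[l + k] x = r := by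
    rw [Function.iterate_add_apply, hk]
    exact Function.iterate_fixed (mem_rootsOf.1 hr).2 l
  have h2 : p^[k + l] x = r' := by
    rw [Function.iterate_add_apply, hl]
    exact Function.iterate_fixed (mem_rootsOf.1 hr').2 k
  rw [← h1, ← h2, add_comm]

/-- The subtrees of the roots partition `S`, so the inequalities at the roots add up. This keeps the
natural subtractions that define excesses from being truncated. -/
lemma card_le_sum_of_balanced {b : ℕ} {S : Finset V} {p : V → V} {m : V → ℕ} (h : IsForest S p)
    (hb : ∀ v ∈ S, Balanced b p m v) : #S ≤ ∑ v ∈ S, m v := by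
  rw [← biUnion_desc_rootsOf h, card_biUnion (pairwiseDisjoint_desc_rootsOf S p),
    sum_biUnion (pairwiseDisjoint_desc_rootsOf S p)]
  exact sum_le_sum fun r hr => (Nat.le_add_right _ b).trans (hb r (mem_rootsOf.1 hr).1)

/-! ### Restriction of a forest to a union of components -/

/-- The restriction of a forest to the set `S`. -/
def restr (S : Finset V) (p : V → V) (v : V) : V := if v ∈ S then p v else v

/-- The restriction of a load to the set `S`. -/
def restrLoad (S : Finset V) (m : V → ℕ) (v : V) : ℕ := if v ∈ S then m v else 0

omit [Fintype V] in
lemma restr_of_mem {S : Finset V} {p : V → V} {v : V} (hv : v ∈ S) : restr S p v = p v :=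
  if_pos hv

omit [Fintype V] in
lemma restr_of_notMem {S : Finset V} {p : V → V} {v : V} (hv : v ∉ S) : restr S p v = v :=
  if_neg hv

omit [Fintype V] in
lemma restrLoad_of_mem {S : Finset V} {m : V → ℕ} {v : V} (hv : v ∈ S) :
    restrLoad S m v = m v := if_pos hv

omit [Fintype V] in
lemma Inv.iterate_restr {S : Finset V} {p : V → V} (h : Inv p S) {v : V} (hv : v ∈ S) (k : ℕ) :
    (restr S p)^[k] v = p^[k] v := by
  induction k with
  | zero => rfl
  | succ k ih =>
    rw [Function.iterate_succ_apply', ih, Function.iterate_succ_apply',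
      restr_of_mem ((h.iterate k v).1 hv)]

lemma Inv.desc_restr {S : Finset V} {p : V → V} (h : Inv p S) {v : V} (hv : v ∈ S) :
    desc (restr S p) v = desc p v := by
  ext x
  by_cases hx : x ∈ S
  · simp only [mem_desc, h.iterate_restr hx]
  · refine iff_of_false (fun hc => hx ?_) (fun hc => hx (h.desc_subset hv hc))
    rw [eq_of_mem_desc_of_fixed hc (restr_of_notMem hx)]
    exact hv

lemma Inv.kids_restr {S : Finset V} {p : V → V} (h : Inv p S) {v : V} (hv : v ∈ S) :
    kids (restr S p) v = kids p v := by
  ext c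
  simp only [kids, mem_filter, mem_univ, true_and]
  refine and_congr_right fun hc => ?_
  by_cases hcS : c ∈ S
  · rw [restr_of_mem hcS]
  · rw [restr_of_notMem hcS]
    refine iff_of_false hc fun h' => hcS ?_
    rw [h c, h']
    exact hv

omit [Fintype V] in
lemma Inv.isForest_restr {S : Finset V} {p : V → V} (h : Inv p S)
    (hp : ∀ v, ∃ k : ℕ, p (p^[k] v) = p^[k] v) : IsForest S (restr S p) := by
  refine ⟨fun v hv => restr_of_notMem hv, fun v hv => ?_, fun v => ?_⟩
  · rw [restr_of_mem hv]
    exact (h v).1 hv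
  · by_cases hv : v ∈ S
    · obtain ⟨k, hk⟩ := hp v
      refine ⟨k, ?_⟩
      rw [h.iterate_restr hv, restr_of_mem ((h.iterate k v).1 hv), hk]
    · exact ⟨0, restr_of_notMem hv⟩

omit [Fintype V] in
lemma rootsOf_restr (S : Finset V) (p : V → V) : rootsOf S (restr S p) = rootsOf S p :=
  filter_congr fun v hv => by rw [restr_of_mem hv]

lemma Inv.balanced_restr {S : Finset V} {p : V → V} (h : Inv p S) {v : V} (hv : v ∈ S) (b : ℕ)
    (m : V → ℕ) : Balanced b (restr S p) (restrLoad S m) v ↔ Balanced b p m v := by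
  rw [Balanced, Balanced, h.desc_restr hv,
    sum_congr rfl fun x hx => restrLoad_of_mem (h.desc_subset hv hx)]

lemma Inv.weight_restr {S : Finset V} {p : V → V} (h : Inv p S) (w a : ℕ → ℚ) (m : V → ℕ) :
    weight w a S (restr S p) (restrLoad S m) = weight w a S p m :=
  prod_congr rfl fun v hv => by rw [h.kids_restr hv, restrLoad_of_mem hv]

/-- The union of two forests on disjoint sets, the first of which is `S`. -/
def glue (S : Finset V) (p₁ p₂ : V → V) (v : V) : V := if v ∈ S then p₁ v else p₂ v

section Glue

variable {S S' : Finset V} {p₁ p₂ : V → V}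

omit [Fintype V] in
lemma glue_of_mem {v : V} (hv : v ∈ S') : glue S' p₁ p₂ v = p₁ v := if_pos hv

omit [Fintype V] in
lemma glue_of_notMem {v : V} (hv : v ∉ S') : glue S' p₁ p₂ v = p₂ v := if_neg hv

omit [Fintype V] in
lemma restr_glue_left (h₁ : IsForest S' p₁) : restr S' (glue S' p₁ p₂) = p₁ := by
  funext v
  by_cases hv : v ∈ S'
  · rw [restr_of_mem hv, glue_of_mem hv]
  · rw [restr_of_notMem hv, h₁.1 v hv]

omit [Fintype V] in
lemma restr_glue_right (h₂ : IsForest (S \ S') p₂) : restr (S \ S') (glue S' p₁ p₂) = p₂ := by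
  funext v
  by_cases hv : v ∈ S \ S'
  · rw [restr_of_mem hv, glue_of_notMem (mem_sdiff.1 hv).2]
  · rw [restr_of_notMem hv, h₂.1 v hv]

omit [Fintype V] in
lemma inv_glue (h₁ : IsForest S' p₁) (h₂ : IsForest (S \ S') p₂) : Inv (glue S' p₁ p₂) S' := by
  intro v
  by_cases hv : v ∈ S'
  · rw [glue_of_mem hv]
    exact h₁.inv v
  · rw [glue_of_notMem hv]
    refine iff_of_false hv fun hc => ?_
    by_cases hvS : v ∈ S \ S'
    · exact (mem_sdiff.1 (h₂.2.1 v hvS)).2 hc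
    · rw [h₂.1 v hvS] at hc
      exact hv hc

omit [Fintype V] in
lemma isForest_glue (hS : S' ⊆ S) (h₁ : IsForest S' p₁) (h₂ : IsForest (S \ S') p₂) :
    IsForest S (glue S' p₁ p₂) := by
  have hoff : ∀ v, v ∉ S → glue S' p₁ p₂ v = v := fun v hv => by
    rw [glue_of_notMem fun h => hv (hS h), h₂.1 v fun h => hv (mem_sdiff.1 h).1]
  have hmem : ∀ v ∈ S, glue S' p₁ p₂ v ∈ S := fun v hv => by
    by_cases hv' : v ∈ S'
    · rw [glue_of_mem hv']
      exact hS (h₁.2.1 v hv')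
    · rw [glue_of_notMem hv']
      exact (mem_sdiff.1 (h₂.2.1 v (mem_sdiff.2 ⟨hv, hv'⟩))).1
  have hinv : Inv (glue S' p₁ p₂) S := fun v => ⟨hmem v, fun h => by
    by_contra hcon
    rw [hoff v hcon] at h
    exact hcon h⟩
  have hinv₁ := inv_glue h₁ h₂
  have hinv₂ := hinv.sdiff hinv₁
  refine ⟨hoff, hmem, fun v => ?_⟩
  by_cases hv : v ∈ S'
  · obtain ⟨k, hk⟩ := h₁.2.2 v
    refine ⟨k, ?_⟩
    have h1 := hinv₁.iterate_restr hv (k + 1)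
    rw [restr_glue_left h₁, Function.iterate_succ_apply', Function.iterate_succ_apply', hk] at h1
    rw [← h1, ← hinv₁.iterate_restr hv, restr_glue_left h₁]
  · by_cases hvS : v ∈ S \ S'
    · obtain ⟨k, hk⟩ := h₂.2.2 v
      refine ⟨k, ?_⟩
      have h1 := hinv₂.iterate_restr hvS (k + 1)
      rw [restr_glue_right h₂, Function.iterate_succ_apply', Function.iterate_succ_apply', hk]
        at h1
      rw [← h1, ← hinv₂.iterate_restr hvS, restr_glue_right h₂]
    · refine ⟨0, ?_⟩
      rw [Function.iterate_zero, id, glue_of_notMem hv, h₂.1 v hvS]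

end Glue

/-- The components of a forest correspond to its roots. -/
lemma card_components {S : Finset V} {p : V → V} (h : IsForest S p) [DecidablePred (Inv p)] :
    #{S' ∈ S.powerset | Inv p S' ∧ #(rootsOf S' p) = 1} = #(rootsOf S p) := by
  symm
  refine card_bij (fun r _ => desc p r) ?_ ?_ ?_
  · intro r hr
    rw [mem_rootsOf] at hr
    refine mem_filter.2 ⟨mem_powerset.2 (h.inv.desc_subset hr.1), fun x => ?_, ?_⟩
    · refine ⟨fun hx => ?_, mem_desc_of_map⟩
      by_cases hxr : x = r
      · rw [hxr, hr.2]; exact self_mem_desc _ _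
      · exact map_mem_desc hx hxr
    · rw [card_eq_one]
      refine ⟨r, ?_⟩
      ext y
      rw [mem_rootsOf, mem_singleton]
      constructor
      · rintro ⟨hy, hy'⟩
        exact eq_of_mem_desc_of_fixed hy hy'
      · rintro rfl
        exact ⟨self_mem_desc _ _, hr.2⟩
  · intro r hr r' hr' heq
    have := self_mem_desc p r
    rw [heq] at this
    exact eq_of_mem_desc_of_fixed this (mem_rootsOf.1 hr).2
  · intro S' hS'
    obtain ⟨hS, hinv, hone⟩ := mem_filter.1 hS'
    obtain ⟨r, hr⟩ := card_eq_one.1 hone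
    have hr' : r ∈ rootsOf S' p := by rw [hr]; exact mem_singleton_self r
    rw [mem_rootsOf] at hr'
    refine ⟨r, mem_rootsOf.2 ⟨mem_powerset.1 hS hr'.1, hr'.2⟩, ?_⟩
    refine (hinv.desc_subset hr'.1).antisymm fun x hx => ?_
    obtain ⟨k, hk⟩ := h.2.2 x
    have : p^[k] x ∈ rootsOf S' p := mem_rootsOf.2 ⟨(hinv.iterate k x).1 hx, hk⟩
    rw [hr, mem_singleton] at this
    exact mem_desc.2 ⟨k, this⟩

/-! ### Removal of the root of a tree -/

/-- The forest which is obtained from a tree by removing its root `r`. -/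
def detach (r : V) (p : V → V) (v : V) : V := if p v = r then v else p v

/-- The tree on `S` which is obtained from a forest on `S \ {r}` by attaching its roots to `r`. -/
def attach (S : Finset V) (r : V) (p : V → V) (v : V) : V := if v ∈ S ∧ p v = v then r else p v

section Detach

variable {S : Finset V} {r : V} {p : V → V}

omit [Fintype V] in
lemma detach_of_eq {v : V} (h : p v = r) : detach r p v = v := if_pos h

omit [Fintype V] in
lemma detach_of_ne {v : V} (h : p v ≠ r) : detach r p v = p v := if_neg h

omit [Fintype V] in
lemma isForest_detach (h : IsForest S p) (hr : p r = r) : IsForest (S.erase r) (detach r p) := by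
  refine ⟨fun v hv => ?_, fun v hv => ?_, fun v => ?_⟩
  · by_cases hpv : p v = r
    · exact detach_of_eq hpv
    · rw [detach_of_ne hpv]
      refine h.1 v fun hvS => hv (mem_erase.2 ⟨?_, hvS⟩)
      rintro rfl
      exact hpv hr
  · by_cases hpv : p v = r
    · rwa [detach_of_eq hpv]
    · rw [detach_of_ne hpv]
      exact mem_erase.2 ⟨hpv, h.2.1 v (mem_erase.1 hv).2⟩
  · obtain ⟨k, hk⟩ := h.2.2 v
    induction k generalizing v with
    | zero =>
      refine ⟨0, ?_⟩
      by_cases hpv : p v = r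
      · exact detach_of_eq hpv
      · rw [Function.iterate_zero, id, detach_of_ne hpv]
        exact hk
    | succ k ih =>
      by_cases hpv : p v = r
      · exact ⟨0, detach_of_eq hpv⟩
      · obtain ⟨l, hl⟩ := ih (p v) hk
        refine ⟨l + 1, ?_⟩
        rwa [Function.iterate_succ_apply, detach_of_ne hpv]

/-- Only edges into `r` are deleted, and no path that ends at `v ≠ r` runs through the fixed point
`r`. -/
lemma desc_detach (hr : p r = r) {v : V} (hv : v ≠ r) : desc (detach r p) v = desc p v := by
  symm
  refine desc_eq_of_agree (fun c hc hcv => detach_of_ne fun hpc => hv ?_) fun c hc hcv => ?_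
  · have := map_mem_desc hc hcv
    rw [hpc] at this
    exact (eq_of_mem_desc_of_fixed this hr).symm
  · by_cases hpc : p c = r
    · exact absurd (eq_of_mem_desc_of_fixed hc (detach_of_eq hpc)) hcv
    · exact detach_of_ne hpc

lemma kids_detach {v : V} (hv : v ≠ r) : kids (detach r p) v = kids p v := by
  ext c
  simp only [kids, mem_filter, mem_univ, true_and]
  refine and_congr_right fun hc => ?_
  by_cases hpc : p c = r
  · rw [detach_of_eq hpc, hpc]
    exact iff_of_false hc hv.symm
  · rw [detach_of_ne hpc]

/-- The components left after deleting the root correspond to its children, so the weight of the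
root depends on their number only. -/
lemma rootsOf_detach (h : IsForest S p) (hroot : rootsOf S p = {r}) :
    rootsOf (S.erase r) (detach r p) = kids p r := by
  ext c
  have hr : r ∈ rootsOf S p := by rw [hroot]; exact mem_singleton_self r
  rw [mem_rootsOf] at hr
  simp only [mem_rootsOf, kids, mem_filter, mem_univ, true_and, mem_erase]
  constructor
  · rintro ⟨⟨hcr, hcS⟩, hc⟩
    refine ⟨hcr, ?_⟩
    by_contra hpc
    rw [detach_of_ne hpc] at hc
    have : c ∈ rootsOf S p := mem_rootsOf.2 ⟨hcS, hc⟩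
    rw [hroot, mem_singleton] at this
    exact hcr this
  · rintro ⟨hcr, hpc⟩
    refine ⟨⟨hcr, ?_⟩, detach_of_eq hpc⟩
    rw [h.inv c, hpc]
    exact hr.1

lemma balanced_detach (h : IsForest S p) (hr : p r = r) {v : V} (hv : v ∈ S.erase r) (b : ℕ)
    (m : V → ℕ) :
    Balanced b (detach r p) (restrLoad (S.erase r) m) v ↔ Balanced b p m v := by
  have hsub := (isForest_detach h hr).inv.desc_subset hv
  rw [Balanced, Balanced, sum_congr rfl fun x hx => restrLoad_of_mem (hsub hx),
    desc_detach hr (mem_erase.1 hv).1]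

lemma weight_detach (w a : ℕ → ℚ) (hr : r ∈ S) (m : V → ℕ) :
    weight w a S p m = w #(kids p r) * a (m r)
      * weight w a (S.erase r) (detach r p) (restrLoad (S.erase r) m) := by
  rw [weight, ← mul_prod_erase S _ hr]
  congr 1
  refine prod_congr rfl fun v hv => ?_
  rw [kids_detach (mem_erase.1 hv).1, restrLoad_of_mem hv]

omit [Fintype V] in
lemma attach_of_root {v : V} (hv : v ∈ S) (hp : p v = v) : attach S r p v = r :=
  if_pos ⟨hv, hp⟩

omit [Fintype V] in
lemma attach_of_ne {v : V} (hp : p v ≠ v) : attach S r p v = p v := if_neg fun h => hp h.2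

omit [Fintype V] in
lemma attach_of_notMem {v : V} (hv : v ∉ S) : attach S r p v = p v := if_neg fun h => hv h.1

variable (hr : r ∈ S) (h : IsForest (S.erase r) p)
include hr h

omit [Fintype V] in
lemma attach_root : attach S r p r = r := attach_of_root hr (h.1 r (notMem_erase r S))

omit [Fintype V] in
lemma isForest_attach : IsForest S (attach S r p) := by
  have hoff : ∀ v, v ∉ S → attach S r p v = v := fun v hv => by
    rw [attach_of_notMem hv, h.1 v fun hv' => hv (mem_erase.1 hv').2]
  have base : ∀ v, p v = v → ∃ k : ℕ, attach S r p ((attach S r p)^[k] v)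
      = (attach S r p)^[k] v := fun v hv => by
    by_cases hvS : v ∈ S
    · refine ⟨1, ?_⟩
      rw [Function.iterate_one, attach_of_root hvS hv, attach_root hr h]
    · exact ⟨0, hoff v hvS⟩
  refine ⟨hoff, fun v hv => ?_, fun v => ?_⟩
  · by_cases hpv : p v = v
    · rwa [attach_of_root hv hpv]
    · rw [attach_of_ne hpv]
      by_cases hv' : v ∈ S.erase r
      · exact (mem_erase.1 (h.2.1 v hv')).2
      · exact absurd (h.1 v hv') hpv
  · obtain ⟨k, hk⟩ := h.2.2 v
    induction k generalizing v with
    | zero => exact base v hk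
    | succ k ih =>
      by_cases hpv : p v = v
      · exact base v hpv
      · obtain ⟨l, hl⟩ := ih (p v) hk
        refine ⟨l + 1, ?_⟩
        rwa [Function.iterate_succ_apply, attach_of_ne hpv]

omit [Fintype V] in
lemma rootsOf_attach : rootsOf S (attach S r p) = {r} := by
  ext v
  rw [mem_rootsOf, mem_singleton]
  constructor
  · rintro ⟨hv, hv'⟩
    by_cases hpv : p v = v
    · rw [← hv', attach_of_root hv hpv]
    · rw [attach_of_ne hpv] at hv'
      exact absurd hv' hpv
  · rintro rfl
    exact ⟨hr, attach_root hr h⟩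

omit [Fintype V] hr in
lemma detach_attach : detach r (attach S r p) = p := by
  funext v
  by_cases hpv : p v = v
  · by_cases hv : v ∈ S
    · rw [detach_of_eq (attach_of_root hv hpv), hpv]
    · by_cases hv' : attach S r p v = r
      · rw [detach_of_eq hv', hpv]
      · rw [detach_of_ne hv', attach_of_notMem hv]
  · have hv : v ∈ S.erase r := by
      by_contra hcon
      exact hpv (h.1 v hcon)
    rw [detach_of_ne, attach_of_ne hpv]
    rw [attach_of_ne hpv]
    exact (mem_erase.1 (h.2.1 v hv)).1

end Detach

omit [Fintype V] in
lemma attach_detach {S : Finset V} {r : V} {p : V → V} (h : IsForest S p)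
    (hroot : rootsOf S p = {r}) : attach S r (detach r p) = p := by
  funext v
  by_cases hv : v ∈ S
  · by_cases hpv : p v = r
    · rw [attach_of_root hv (detach_of_eq hpv), hpv]
    · rw [attach_of_ne, detach_of_ne hpv]
      rw [detach_of_ne hpv]
      intro hpv'
      have hvr : v ∈ rootsOf S p := mem_rootsOf.2 ⟨hv, hpv'⟩
      rw [hroot, mem_singleton] at hvr
      exact hpv (hpv'.trans hvr)
  · rw [attach_of_notMem hv]
    by_cases hpv : p v = r
    · rw [detach_of_eq hpv, h.1 v hv]
    · exact detach_of_ne hpv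

end Forest

end TreeParking

namespace TreeParking
open Finset

/-! ### Recursions for weighted sums over forests and trees with loads -/

section Sums

variable {V : Type*} [Fintype V] [DecidableEq V]

open Classical in
/-- The forests on `S` with loads of total size `#S + e`, where the load of each subtree exceeds
its size by at least `b`. -/
noncomputable def forestConf (b : ℕ) (S : Finset V) (e : ℕ) : Finset ((V → V) × (V → ℕ)) :=
  {x ∈ univ ×ˢ piAntidiag S (#S + e) | IsForest S x.1 ∧ ∀ v ∈ S, Balanced b x.1 x.2 v}

open Classical in
/-- The trees on `S` with loads of total size `#S + e`, where the load of each subtree, except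
for the whole tree, exceeds its size by at least `b`. -/
noncomputable def treeConf (b : ℕ) (S : Finset V) (e : ℕ) : Finset ((V → V) × (V → ℕ)) :=
  {x ∈ univ ×ˢ piAntidiag S (#S + e) | IsForest S x.1 ∧ #(rootsOf S x.1) = 1 ∧
    ∀ v ∈ S, x.1 v ≠ v → Balanced b x.1 x.2 v}

/-- The total weight of the forests with `k` components. -/
noncomputable def forestSum (w a : ℕ → ℚ) (b : ℕ) (S : Finset V) (k e : ℕ) : ℚ :=
  ∑ x ∈ forestConf b S e with #(rootsOf S x.1) = k, weight w a S x.1 x.2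

/-- The total weight of the trees. -/
noncomputable def treeSum (w a : ℕ → ℚ) (b : ℕ) (S : Finset V) (e : ℕ) : ℚ :=
  ∑ x ∈ treeConf b S e, weight w a S x.1 x.2

lemma mem_forestConf {b : ℕ} {S : Finset V} {e : ℕ} {x : (V → V) × (V → ℕ)} :
    x ∈ forestConf b S e ↔ (∑ v ∈ S, x.2 v = #S + e ∧ ∀ v, x.2 v ≠ 0 → v ∈ S) ∧
      IsForest S x.1 ∧ ∀ v ∈ S, Balanced b x.1 x.2 v := by
  simp [forestConf]

lemma mem_treeConf {b : ℕ} {S : Finset V} {e : ℕ} {x : (V → V) × (V → ℕ)} :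
    x ∈ treeConf b S e ↔ (∑ v ∈ S, x.2 v = #S + e ∧ ∀ v, x.2 v ≠ 0 → v ∈ S) ∧
      IsForest S x.1 ∧ #(rootsOf S x.1) = 1 ∧ ∀ v ∈ S, x.1 v ≠ v → Balanced b x.1 x.2 v := by
  simp [treeConf]

omit [Fintype V] in
lemma sum_restrLoad (S : Finset V) (m : V → ℕ) : ∑ v ∈ S, restrLoad S m v = ∑ v ∈ S, m v :=
  sum_congr rfl fun _ hv => restrLoad_of_mem hv

omit [Fintype V] in
lemma mem_of_restrLoad_ne_zero {S : Finset V} {m : V → ℕ} {v : V} (h : restrLoad S m v ≠ 0) :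
    v ∈ S := by
  by_contra hcon
  exact h (if_neg hcon)

/-- The loads on a union of two disjoint sets. -/
def glueLoad (S : Finset V) (m₁ m₂ : V → ℕ) (v : V) : ℕ := if v ∈ S then m₁ v else m₂ v

omit [Fintype V] in
lemma restrLoad_glueLoad_left {S : Finset V} {m₁ m₂ : V → ℕ} (h : ∀ v, m₁ v ≠ 0 → v ∈ S) :
    restrLoad S (glueLoad S m₁ m₂) = m₁ := by
  funext v
  by_cases hv : v ∈ S
  · rw [restrLoad_of_mem hv, glueLoad, if_pos hv]
  · rw [restrLoad, if_neg hv]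
    by_contra hcon
    exact hv (h v (Ne.symm hcon))

omit [Fintype V] in
lemma restrLoad_glueLoad_right {S S' : Finset V} {m₁ m₂ : V → ℕ}
    (h : ∀ v, m₂ v ≠ 0 → v ∈ S \ S') :
    restrLoad (S \ S') (glueLoad S' m₁ m₂) = m₂ := by
  funext v
  by_cases hv : v ∈ S \ S'
  · rw [restrLoad_of_mem hv, glueLoad, if_neg (mem_sdiff.1 hv).2]
  · rw [restrLoad, if_neg hv]
    by_contra hcon
    exact hv (h v (Ne.symm hcon))

open Classical in
/-- The weight of the forests for which a fixed set is a component. -/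
lemma sum_forestConf_component (w a : ℕ → ℚ) (b : ℕ) {S S' : Finset V} (hS : S' ⊆ S) (k e : ℕ) :
    ∑ x ∈ forestConf b S e with #(rootsOf S x.1) = k + 1 ∧ Inv x.1 S' ∧ #(rootsOf S' x.1) = 1,
      weight w a S x.1 x.2
    = ∑ ee ∈ antidiagonal e, forestSum w a b S' 1 ee.1 * forestSum w a b (S \ S') k ee.2 := by
  simp only [forestSum, sum_mul_sum, ← sum_product', sum_sigma']
  have hroots : ∀ p : V → V, #(rootsOf S p) = #(rootsOf S' p) + #(rootsOf (S \ S') p) := by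
    intro p
    rw [rootsOf, rootsOf, rootsOf, ← card_union_of_disjoint, ← filter_union,
      union_sdiff_of_subset hS]
    exact disjoint_filter_filter disjoint_sdiff
  have hcard : #(S \ S') + #S' = #S := card_sdiff_add_card_eq_card hS
  have hsum : ∀ m : V → ℕ, ∑ v ∈ S \ S', m v + ∑ v ∈ S', m v = ∑ v ∈ S, m v :=
    fun m => sum_sdiff hS
  -- A configuration is cut into its restrictions to `S'` and `S \ S'`, and the excess is additive.
  -- `hle` and `hle'` below show that both differences are genuine.
  refine sum_bij'
    (fun x _ => ⟨(∑ v ∈ S', x.2 v - #S', ∑ v ∈ S \ S', x.2 v - #(S \ S')),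
      ((restr S' x.1, restrLoad S' x.2), (restr (S \ S') x.1, restrLoad (S \ S') x.2))⟩)
    (fun y _ => (glue S' y.2.1.1 y.2.2.1, glueLoad S' y.2.1.2 y.2.2.2)) ?_ ?_ ?_ ?_ ?_
  · rintro ⟨p, m⟩ hx
    simp only [mem_filter, mem_forestConf] at hx
    obtain ⟨⟨⟨hm, hm0⟩, hp, hb⟩, hk, hinv, hone⟩ := hx
    have hinv' := hp.inv.sdiff hinv
    have hr := hroots p
    have hf := hinv.isForest_restr hp.2.2
    have hf' := hinv'.isForest_restr hp.2.2
    have hb1 : ∀ v ∈ S', Balanced b (restr S' p) (restrLoad S' m) v := fun v hv =>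
      (hinv.balanced_restr hv b m).2 (hb v (hS hv))
    have hb2 : ∀ v ∈ S \ S', Balanced b (restr (S \ S') p) (restrLoad (S \ S') m) v :=
      fun v hv => (hinv'.balanced_restr hv b m).2 (hb v (mem_sdiff.1 hv).1)
    have hle := card_le_sum_of_balanced hf hb1
    have hle' := card_le_sum_of_balanced hf' hb2
    rw [sum_restrLoad] at hle hle'
    have hs := hsum m
    simp only [mem_sigma, HasAntidiagonal.mem_antidiagonal, mem_product, mem_filter,
      mem_forestConf, sum_restrLoad, rootsOf_restr]
    refine ⟨by omega, ⟨⟨⟨by omega, fun v hv => mem_of_restrLoad_ne_zero hv⟩, hf, hb1⟩, hone⟩,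
      ⟨⟨by omega, fun v hv => mem_of_restrLoad_ne_zero hv⟩, hf', hb2⟩, by omega⟩
  · rintro ⟨⟨e₁, e₂⟩, ⟨p₁, m₁⟩, p₂, m₂⟩ hy
    simp only [mem_sigma, HasAntidiagonal.mem_antidiagonal, mem_product, mem_filter,
      mem_forestConf] at hy
    obtain ⟨he, ⟨⟨⟨hm1, hm10⟩, hp1, hb1⟩, hr1⟩, ⟨⟨hm2, hm20⟩, hp2, hb2⟩, hr2⟩ := hy
    have hinv := inv_glue hp1 hp2
    have hfor := isForest_glue hS hp1 hp2
    have hinv' := hfor.inv.sdiff hinv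
    have e1 := restr_glue_left (p₂ := p₂) hp1
    have e2 := restr_glue_right (p₁ := p₁) hp2
    have e3 := restrLoad_glueLoad_left (m₂ := m₂) hm10
    have e4 := restrLoad_glueLoad_right (m₁ := m₁) hm20
    have hr := hroots (glue S' p₁ p₂)
    rw [← rootsOf_restr S', ← rootsOf_restr (S \ S'), e1, e2, hr1, hr2] at hr
    have hs := hsum (glueLoad S' m₁ m₂)
    rw [← sum_restrLoad S', ← sum_restrLoad (S \ S'), e3, e4] at hs
    simp only [mem_filter, mem_forestConf]
    refine ⟨⟨⟨by omega, fun v hv => ?_⟩, hfor, fun v hv => ?_⟩, by omega, hinv, ?_⟩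
    · by_cases hv' : v ∈ S'
      · exact hS hv'
      · rw [glueLoad, if_neg hv'] at hv
        exact (mem_sdiff.1 (hm20 v hv)).1
    · by_cases hv' : v ∈ S'
      · rw [← hinv.balanced_restr hv', e1, e3]
        exact hb1 v hv'
      · have hv'' := mem_sdiff.2 ⟨hv, hv'⟩
        rw [← hinv'.balanced_restr hv'', e2, e4]
        exact hb2 v hv''
    · rw [← rootsOf_restr, e1, hr1]
  · rintro ⟨p, m⟩ hx
    simp only [mem_filter, mem_forestConf] at hx
    obtain ⟨⟨⟨hm, hm0⟩, hp, hb⟩, hk, hinv, hone⟩ := hx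
    refine Prod.ext ?_ ?_
    · funext v
      by_cases hv : v ∈ S'
      · simp only [glue_of_mem hv, restr_of_mem hv]
      · simp only [glue_of_notMem hv]
        by_cases hvS : v ∈ S \ S'
        · rw [restr_of_mem hvS]
        · rw [restr_of_notMem hvS, hp.1 v fun h => hvS (mem_sdiff.2 ⟨h, hv⟩)]
    · funext v
      simp only [glueLoad]
      split_ifs with hv
      · exact restrLoad_of_mem hv
      · by_cases hvS : v ∈ S \ S'
        · exact restrLoad_of_mem hvS
        · rw [restrLoad, if_neg hvS]
          by_contra hcon
          exact hvS (mem_sdiff.2 ⟨hm0 v (Ne.symm hcon), hv⟩)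
  · rintro ⟨⟨e₁, e₂⟩, ⟨p₁, m₁⟩, p₂, m₂⟩ hy
    simp only [mem_sigma, HasAntidiagonal.mem_antidiagonal, mem_product, mem_filter,
      mem_forestConf] at hy
    obtain ⟨he, ⟨⟨⟨hm1, hm10⟩, hp1, hb1⟩, hr1⟩, ⟨⟨hm2, hm20⟩, hp2, hb2⟩, hr2⟩ := hy
    have e1 := restr_glue_left (p₂ := p₂) hp1
    have e2 := restr_glue_right (p₁ := p₁) hp2
    have e3 := restrLoad_glueLoad_left (m₂ := m₂) hm10
    have e4 := restrLoad_glueLoad_right (m₁ := m₁) hm20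
    have hs1 : ∑ v ∈ S', glueLoad S' m₁ m₂ v - #S' = e₁ := by
      rw [← sum_restrLoad, e3]; omega
    have hs2 : ∑ v ∈ S \ S', glueLoad S' m₁ m₂ v - #(S \ S') = e₂ := by
      rw [← sum_restrLoad, e4]; omega
    simp only [e1, e2, e3, e4, hs1, hs2]
  · rintro ⟨p, m⟩ hx
    simp only [mem_filter, mem_forestConf] at hx
    obtain ⟨⟨⟨hm, hm0⟩, hp, hb⟩, hk, hinv, hone⟩ := hx
    have hinv' := hp.inv.sdiff hinv
    simp only [hinv.weight_restr, hinv'.weight_restr]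
    rw [weight, weight, weight, mul_comm, prod_sdiff hS]

/-- Splitting off a component of a forest. -/
lemma forestSum_succ (w a : ℕ → ℚ) (b : ℕ) (S : Finset V) (k e : ℕ) :
    (k + 1 : ℚ) * forestSum w a b S (k + 1) e
      = ∑ S' ∈ S.powerset, ∑ ee ∈ antidiagonal e,
        forestSum w a b S' 1 ee.1 * forestSum w a b (S \ S') k ee.2 := by
  classical
  -- Double counting of pairs of a forest and one of its components: each forest with `k + 1`
  -- components occurs `k + 1` times.
  rw [← sum_congr rfl fun S' hS' =>
    sum_forestConf_component w a b (mem_powerset.1 hS') k e]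
  simp only [sum_filter]
  rw [sum_comm, forestSum, mul_sum, sum_filter]
  refine sum_congr rfl fun x hx => ?_
  split_ifs with hk
  · have h := card_components (mem_forestConf.1 hx).2.1
    simp only [hk, true_and]
    rw [← sum_filter, sum_const, h, hk, nsmul_eq_mul]
    push_cast
    ring
  · simp [hk]

/-- Removing the root of a tree. -/
lemma treeSum_eq (w a : ℕ → ℚ) (b : ℕ) (S : Finset V) (e : ℕ) :
    treeSum w a b S e = ∑ r ∈ S, ∑ je ∈ antidiagonal (e + 1), a je.1 *
      ∑ x ∈ forestConf b (S.erase r) je.2, w #(rootsOf (S.erase r) x.1) *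
        weight w a (S.erase r) x.1 x.2 := by
  classical
  -- A tree has exactly one fixed point in `S`, so it is counted once when `r` runs over `S`.
  have h1 : treeSum w a b S e
      = ∑ r ∈ S, ∑ x ∈ treeConf b S e with x.1 r = r, weight w a S x.1 x.2 := by
    simp only [sum_filter]
    rw [sum_comm, treeSum]
    refine sum_congr rfl fun x hx => ?_
    rw [← sum_filter, sum_const]
    have : #{r ∈ S | x.1 r = r} = 1 := (mem_treeConf.1 hx).2.2.1
    rw [this, one_smul]
  rw [h1]
  refine sum_congr rfl fun r hr => ?_
  simp only [mul_sum, sum_sigma']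
  have hcard : #(S.erase r) + 1 = #S := card_erase_add_one hr
  have hsum : ∀ m : V → ℕ, m r + ∑ v ∈ S.erase r, m v = ∑ v ∈ S, m v :=
    fun m => add_sum_erase S m hr
  have hroot : ∀ p : V → V, #(rootsOf S p) = 1 → p r = r → rootsOf S p = {r} := by
    intro p hone hpr
    obtain ⟨r', hr'⟩ := card_eq_one.1 hone
    have : r ∈ rootsOf S p := mem_rootsOf.2 ⟨hr, hpr⟩
    rw [hr', mem_singleton] at this
    rw [hr', this]
  have hbal : ∀ (p : V → V) (m : V → ℕ), IsForest S p → p r = r → rootsOf S p = {r} →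
      ((∀ v ∈ S, p v ≠ v → Balanced b p m v) ↔
        ∀ v ∈ S.erase r, Balanced b (detach r p) (restrLoad (S.erase r) m) v) := by
    intro p m hp hpr hpS
    constructor
    · intro hb v hv
      rw [balanced_detach hp hpr hv]
      refine hb v (mem_erase.1 hv).2 fun hpv => ?_
      have : v ∈ rootsOf S p := mem_rootsOf.2 ⟨(mem_erase.1 hv).2, hpv⟩
      rw [hpS, mem_singleton] at this
      exact (mem_erase.1 hv).1 this
    · intro hb v hv hpv
      have hv' : v ∈ S.erase r := mem_erase.2 ⟨fun h => hpv (by rw [h, hpr]), hv⟩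
      exact (balanced_detach hp hpr hv' b m).1 (hb v hv')
  -- The root has load `j` but counts as one node, so the excess `e'` of the remaining forest
  -- satisfies `j + e' = e + 1`.
  refine sum_bij'
    (fun x _ => ⟨(x.2 r, e + 1 - x.2 r), (detach r x.1, restrLoad (S.erase r) x.2)⟩)
    (fun y _ => (attach S r y.2.1, Function.update y.2.2 r y.1.1)) ?_ ?_ ?_ ?_ ?_
  · rintro ⟨p, m⟩ hx
    simp only [mem_filter, mem_treeConf] at hx
    obtain ⟨⟨⟨hm, hm0⟩, hp, hone, hb⟩, hpr⟩ := hx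
    have hf := isForest_detach hp hpr
    have hb' := (hbal p m hp hpr (hroot p hone hpr)).1 hb
    have hle := card_le_sum_of_balanced hf hb'
    rw [sum_restrLoad] at hle
    have hs := hsum m
    simp only [mem_sigma, HasAntidiagonal.mem_antidiagonal, mem_forestConf, sum_restrLoad]
    exact ⟨by omega, ⟨by omega, fun v hv => mem_of_restrLoad_ne_zero hv⟩, hf, hb'⟩
  · rintro ⟨⟨j, e'⟩, p, m⟩ hy
    simp only [mem_sigma, HasAntidiagonal.mem_antidiagonal, mem_forestConf] at hy
    obtain ⟨he, ⟨hm, hm0⟩, hp, hb⟩ := hy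
    have hres : restrLoad (S.erase r) (Function.update m r j) = m := by
      funext v
      by_cases hv : v ∈ S.erase r
      · rw [restrLoad_of_mem hv, Function.update_of_ne (mem_erase.1 hv).1]
      · rw [restrLoad, if_neg hv]
        by_contra hcon
        exact hv (hm0 v (Ne.symm hcon))
    have hs := hsum (Function.update m r j)
    rw [← sum_restrLoad (S.erase r), hres, Function.update_self] at hs
    simp only [mem_filter, mem_treeConf]
    have hroot' := rootsOf_attach hr hp
    have hfor := isForest_attach hr hp
    refine ⟨⟨⟨by omega, fun v hv => ?_⟩, hfor, by rw [hroot', card_singleton], ?_⟩,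
      attach_root hr hp⟩
    · by_cases hvr : v = r
      · rwa [hvr]
      · rw [Function.update_of_ne hvr] at hv
        exact (mem_erase.1 (hm0 v hv)).2
    · rw [hbal _ _ hfor (attach_root hr hp) hroot', detach_attach hp, hres]
      exact hb
  · rintro ⟨p, m⟩ hx
    simp only [mem_filter, mem_treeConf] at hx
    obtain ⟨⟨⟨hm, hm0⟩, hp, hone, hb⟩, hpr⟩ := hx
    refine Prod.ext (attach_detach hp (hroot p hone hpr)) ?_
    funext v
    by_cases hvr : v = r
    · rw [hvr]; exact Function.update_self _ _ _
    · simp only [Function.update_of_ne hvr]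
      by_cases hv : v ∈ S.erase r
      · exact restrLoad_of_mem hv
      · rw [restrLoad, if_neg hv]
        by_contra hcon
        exact hv (mem_erase.2 ⟨hvr, hm0 v (Ne.symm hcon)⟩)
  · rintro ⟨⟨j, e'⟩, p, m⟩ hy
    simp only [mem_sigma, HasAntidiagonal.mem_antidiagonal, mem_forestConf] at hy
    obtain ⟨he, ⟨hm, hm0⟩, hp, hb⟩ := hy
    have hres : restrLoad (S.erase r) (Function.update m r j) = m := by
      funext v
      by_cases hv : v ∈ S.erase r
      · rw [restrLoad_of_mem hv, Function.update_of_ne (mem_erase.1 hv).1]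
      · rw [restrLoad, if_neg hv]
        by_contra hcon
        exact hv (hm0 v (Ne.symm hcon))
    have he' : e + 1 - j = e' := by omega
    simp only [Function.update_self, detach_attach hp, hres, he']
  · rintro ⟨p, m⟩ hx
    simp only [mem_filter, mem_treeConf] at hx
    obtain ⟨⟨⟨hm, hm0⟩, hp, hone, hb⟩, hpr⟩ := hx
    simp only
    rw [weight_detach w a hr, rootsOf_detach hp (hroot p hone hpr)]
    ring

lemma sum_forestConf_eq (w a : ℕ → ℚ) (b : ℕ) (S : Finset V) (e : ℕ) {N : ℕ} (hN : #S ≤ N) :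
    ∑ x ∈ forestConf b S e, w #(rootsOf S x.1) * weight w a S x.1 x.2
      = ∑ k ∈ range (N + 1), w k * forestSum w a b S k e := by
  have hmaps : ∀ x ∈ forestConf b S e, #(rootsOf S x.1) ∈ range (N + 1) := fun x _ =>
    mem_range.2 (Nat.lt_succ_of_le ((card_filter_le _ _).trans hN))
  rw [← sum_fiberwise_of_maps_to hmaps]
  refine sum_congr rfl fun k _ => ?_
  rw [forestSum, mul_sum]
  refine sum_congr rfl fun x hx => ?_
  rw [(mem_filter.1 hx).2]

/-- Every nonempty forest has a root. On the empty set the only configuration is the identity with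
load zero, because values outside `S` are fixed by convention. -/
lemma forestSum_zero (w a : ℕ → ℚ) (b : ℕ) (S : Finset V) (e : ℕ) :
    forestSum w a b S 0 e = if S = ∅ ∧ e = 0 then 1 else 0 := by
  split_ifs with h
  · obtain ⟨rfl, rfl⟩ := h
    have : ∀ x : (V → V) × (V → ℕ), x ∈ forestConf b ∅ 0 ∧ #(rootsOf ∅ x.1) = 0 ↔
        x = (id, 0) := by
      rintro ⟨p, m⟩
      simp only [mem_forestConf, rootsOf, filter_empty, card_empty, sum_empty, notMem_empty,
        Prod.mk.injEq, IsForest]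
      constructor
      · rintro ⟨⟨⟨-, hm⟩, ⟨hp, -⟩, -⟩, -⟩
        refine ⟨funext fun v => hp v not_false, funext fun v => ?_⟩
        by_contra hcon
        exact hm v hcon
      · rintro ⟨rfl, rfl⟩
        simp
    rw [forestSum, show {x ∈ forestConf b (∅ : Finset V) 0 | #(rootsOf (∅ : Finset V) x.1) = 0}
      = ({(id, 0)} : Finset ((V → V) × (V → ℕ))) by ext x; simp [← this], sum_singleton]
    simp [weight]
  · refine sum_eq_zero fun x hx => absurd ?_ h
    obtain ⟨hx, h0⟩ := mem_filter.1 hx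
    obtain ⟨⟨hm, -⟩, hp, -⟩ := mem_forestConf.1 hx
    rw [card_eq_zero] at h0
    have hS := biUnion_desc_rootsOf hp
    rw [h0, biUnion_empty] at hS
    subst hS
    simp at hm
    exact ⟨rfl, by omega⟩

/-- The forests with one component are the trees with sufficient load. -/
lemma forestSum_one (w a : ℕ → ℚ) (b : ℕ) (S : Finset V) (e : ℕ) :
    forestSum w a b S 1 e = if b ≤ e then treeSum w a b S e else 0 := by
  have key : ∀ x : (V → V) × (V → ℕ), x ∈ forestConf b S e ∧ #(rootsOf S x.1) = 1 ↔
      b ≤ e ∧ x ∈ treeConf b S e := by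
    rintro ⟨p, m⟩
    simp only [mem_forestConf, mem_treeConf]
    have hroot : IsForest S p → #(rootsOf S p) = 1 → ∑ v ∈ S, m v = #S + e →
        ∃ r ∈ S, (∀ v ∈ S, p v = v → v = r) ∧ (Balanced b p m r ↔ b ≤ e) ∧ p r = r := by
      intro hp hone hm
      obtain ⟨r, hr⟩ := card_eq_one.1 hone
      have hr' : r ∈ rootsOf S p := by rw [hr]; exact mem_singleton_self r
      have hd := biUnion_desc_rootsOf hp
      rw [hr, singleton_biUnion] at hd
      refine ⟨r, (mem_rootsOf.1 hr').1, fun v hv hpv => ?_, ?_, (mem_rootsOf.1 hr').2⟩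
      · have : v ∈ rootsOf S p := mem_rootsOf.2 ⟨hv, hpv⟩
        rwa [hr, mem_singleton] at this
      · rw [Balanced, hd, hm]
        omega
    constructor
    · rintro ⟨⟨⟨hm, hm0⟩, hp, hb⟩, hone⟩
      obtain ⟨r, hrS, -, hbr, -⟩ := hroot hp hone hm
      exact ⟨hbr.1 (hb r hrS), ⟨hm, hm0⟩, hp, hone, fun v hv _ => hb v hv⟩
    · rintro ⟨hbe, ⟨hm, hm0⟩, hp, hone, hb⟩
      obtain ⟨r, hrS, huniq, hbr, -⟩ := hroot hp hone hm
      refine ⟨⟨⟨hm, hm0⟩, hp, fun v hv => ?_⟩, hone⟩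
      by_cases hpv : p v = v
      · rw [huniq v hv hpv]
        exact hbr.2 hbe
      · exact hb v hv hpv
  split_ifs with hbe
  · rw [forestSum, treeSum]
    refine sum_congr ?_ fun _ _ => rfl
    ext x
    rw [mem_filter, key]
    simp [hbe]
  · rw [forestSum]
    refine sum_eq_zero fun x hx => absurd ?_ hbe
    exact ((key x).1 (mem_filter.1 hx)).1

end Sums

end TreeParking

namespace TreeParking
open PowerSeries Finset

/-! ### From the recursions to functional equations with a catalytic variable -/

section Counting

/-- The part of a power series of order at least `b`. -/
noncomputable def highPart (b : ℕ) (f : ℚ⟦X⟧) : ℚ⟦X⟧ :=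
  mk fun e => if b ≤ e then coeff e f else 0

/-- The coefficientwise part of order at least `b` in the inner variable. -/
noncomputable def innerHighPart (b : ℕ) (F : ℚ⟦X⟧⟦X⟧) : ℚ⟦X⟧⟦X⟧ :=
  mk fun n => highPart b (coeff n F)

lemma highPart_zero (b : ℕ) : highPart b 0 = 0 := by
  ext e; simp [highPart]

lemma constantCoeff_innerHighPart {b : ℕ} {F : ℚ⟦X⟧⟦X⟧} (h : constantCoeff F = 0) :
    constantCoeff (innerHighPart b F) = 0 := by
  rw [← coeff_zero_eq_constantCoeff_apply] at h ⊢
  rw [innerHighPart, coeff_mk, h, highPart_zero]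

/-- The functional equation of the trees with loads has a solution. -/
lemma exists_tree_series (A φ : ℚ⟦X⟧) (b : ℕ) :
    ∃ F : ℚ⟦X⟧⟦X⟧, constantCoeff F = 0 ∧ ∀ n e, coeff e (coeff (n + 1) F)
      = coeff (e + 1) (A * coeff n (φ.subst (innerHighPart b F))) := by
  -- `N` removes the constant coefficient, so that the substitution into `φ` is always defined; it
  -- does nothing at the fixed point.
  let N : ℚ⟦X⟧⟦X⟧ → ℚ⟦X⟧⟦X⟧ := fun F => F - C (constantCoeff F)
  let Ψ : ℚ⟦X⟧⟦X⟧ → ℚ⟦X⟧⟦X⟧ := fun F => X * mk fun n => mk fun e =>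
    coeff (e + 1) (A * coeff n (φ.subst (innerHighPart b (N F))))
  have hN : ∀ F, constantCoeff (N F) = 0 := fun F => by simp [N]
  have hΨ : Contracting Ψ := by
    intro n F F' h
    have h1 : X ^ n ∣ N F - N F' := by
      rcases n with _ | n
      · simp
      · have : constantCoeff F = constantCoeff F' := by
          simpa [sub_eq_zero] using X_pow_dvd_iff.1 h 0 n.succ_pos
        simpa [N, this] using h
    have h2 : X ^ n ∣ innerHighPart b (N F) - innerHighPart b (N F') := by
      rw [X_pow_dvd_iff] at h1 ⊢
      intro m hm
      have := h1 m hm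
      rw [map_sub, sub_eq_zero] at this ⊢
      simp only [innerHighPart, coeff_mk, this]
    have h3 := X_pow_dvd_subst_sub_subst φ (constantCoeff_innerHighPart (hN F))
      (constantCoeff_innerHighPart (hN F')) h2
    simp only [Ψ]
    rw [← mul_sub, pow_succ']
    refine mul_dvd_mul_left _ ?_
    rw [X_pow_dvd_iff] at h3 ⊢
    intro m hm
    have := h3 m hm
    rw [map_sub, sub_eq_zero] at this ⊢
    simp only [coeff_mk, this]
  obtain ⟨F, hF⟩ := hΨ.exists_fixed
  have hF0 : constantCoeff F = 0 := by rw [hF]; simp [Ψ]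
  refine ⟨F, hF0, fun n e => ?_⟩
  conv_lhs => rw [hF]
  simp only [Ψ, N, hF0, map_zero, sub_zero, coeff_succ_X_mul, coeff_mk]

variable {V : Type*} [Fintype V] [DecidableEq V] {w a : ℕ → ℚ} {b : ℕ} {F : ℚ⟦X⟧⟦X⟧}

/-- The forests are enumerated by powers of the generating function of trees. -/
lemma forestSum_eq_of_treeSum_eq {N : ℕ}
    (h : ∀ S : Finset V, #S ≤ N → ∀ e,
      treeSum w a b S e = (#S).factorial * coeff e (coeff #S F)) (k : ℕ) :
    ∀ S : Finset V, #S ≤ N → ∀ e, forestSum w a b S k e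
      = (#S).factorial / k.factorial * coeff e (coeff #S (innerHighPart b F ^ k)) := by
  induction k with
  | zero =>
    intro S _ e
    rw [forestSum_zero, pow_zero, coeff_one]
    by_cases hS : S = ∅
    · subst hS
      simp [coeff_one]
    · simp [hS]
  | succ k ih =>
    intro S hS e
    have hk : (k + 1 : ℚ) ≠ 0 := by positivity
    have hkf : (k.factorial : ℚ) ≠ 0 := by exact_mod_cast k.factorial_ne_zero
    apply mul_left_cancel₀ hk
    rw [forestSum_succ]
    have h1 : ∀ S' ∈ S.powerset, ∑ ee ∈ antidiagonal e,
        forestSum w a b S' 1 ee.1 * forestSum w a b (S \ S') k ee.2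
        = (#S').factorial * (#S - #S').factorial / k.factorial
          * coeff e (coeff #S' (innerHighPart b F) * coeff (#S - #S') (innerHighPart b F ^ k)) := by
      intro S' hS'
      have hsub := mem_powerset.1 hS'
      have hc := card_le_card hsub
      rw [coeff_mul, mul_sum]
      refine sum_congr rfl fun ee _ => ?_
      rw [ih _ ((card_le_card sdiff_subset).trans hS), card_sdiff_of_subset hsub, forestSum_one]
      simp only [innerHighPart, highPart, coeff_mk]
      split_ifs with hb
      · rw [h S' (hc.trans hS)]
        ring
      · ring
    -- The summand depends only on the size of `S'`; the binomial coefficient counting such sets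
    -- merges the two factorials into that of `#S`.
    rw [sum_congr rfl h1, sum_powerset_apply_card (fun m => ((m.factorial : ℚ) *
        (#S - m).factorial / k.factorial
          * coeff e (coeff m (innerHighPart b F) * coeff (#S - m) (innerHighPart b F ^ k)))),
      pow_succ', coeff_mul, map_sum, Nat.sum_antidiagonal_eq_sum_range_succ_mk, mul_sum, mul_sum]
    refine sum_congr rfl fun m hm => ?_
    have hm' : m ≤ #S := Nat.le_of_lt_succ (mem_range.1 hm)
    have hch : ((#S).choose m : ℚ) * (m.factorial * (#S - m).factorial) = (#S).factorial := by
      rw [← mul_assoc]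
      exact_mod_cast Nat.choose_mul_factorial_mul_factorial hm'
    rw [nsmul_eq_mul, ← hch, Nat.factorial_succ]
    push_cast
    field_simp

/-- The trees are enumerated by the solution of the functional equation. -/
lemma treeSum_eq_factorial_mul_coeff {A φ : ℚ⟦X⟧} (hw : ∀ k, w k = k.factorial * coeff k φ)
    (ha : ∀ j, a j = coeff j A) (hF : constantCoeff F = 0)
    (hrec : ∀ n e, coeff e (coeff (n + 1) F)
      = coeff (e + 1) (A * coeff n (φ.subst (innerHighPart b F)))) (S : Finset V) (e : ℕ) :
    treeSum w a b S e = (#S).factorial * coeff e (coeff #S F) := by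
  -- Induction on a bound for the size, because the components after removal of the root are trees
  -- of various smaller sizes.
  suffices ∀ N, ∀ S : Finset V, #S ≤ N → ∀ e,
      treeSum w a b S e = (#S).factorial * coeff e (coeff #S F) from this _ S le_rfl e
  have hempty : ∀ e, treeSum w a b (∅ : Finset V) e
      = (#(∅ : Finset V)).factorial * coeff e (coeff #(∅ : Finset V) F) := by
    intro e
    rw [treeSum_eq, sum_empty, card_empty, coeff_zero_eq_constantCoeff_apply, hF]
    simp
  intro N
  induction N with
  | zero =>
    intro S hS e
    rw [card_eq_zero.1 (Nat.le_zero.1 hS)]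
    exact hempty e
  | succ N ih =>
    intro S hS e
    rcases S.eq_empty_or_nonempty with rfl | hne
    · exact hempty e
    obtain ⟨n, hn⟩ : ∃ n, #S = n + 1 := ⟨#S - 1, by have := hne.card_pos; omega⟩
    have hforest := fun k => forestSum_eq_of_treeSum_eq ih k
    have hK := constantCoeff_innerHighPart (b := b) hF
    rw [treeSum_eq, hn, hrec, coeff_mul]
    have h1 : ∀ r ∈ S, ∑ je ∈ antidiagonal (e + 1), a je.1 *
        ∑ x ∈ forestConf b (S.erase r) je.2, w #(rootsOf (S.erase r) x.1) *
          weight w a (S.erase r) x.1 x.2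
        = n.factorial * ∑ je ∈ antidiagonal (e + 1),
          coeff je.1 A * coeff je.2 (coeff n (φ.subst (innerHighPart b F))) := by
      intro r hr
      have hcard : #(S.erase r) = n := by rw [card_erase_of_mem hr, hn]; rfl
      rw [mul_sum]
      refine sum_congr rfl fun je _ => ?_
      rw [sum_forestConf_eq w a b _ _ hcard.le, coeff_subst_eq_sum φ hK le_rfl, ha, map_sum,
        mul_sum, mul_sum, mul_sum]
      refine sum_congr rfl fun k _ => ?_
      have hkf : (k.factorial : ℚ) ≠ 0 := by exact_mod_cast k.factorial_ne_zero
      rw [hforest k _ (by omega), hcard, hw]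
      simp only [coeff_smul, smul_eq_mul]
      field_simp
    -- Each of the `n + 1` choices of the root contributes the same amount, which turns `n!` into
    -- `(n + 1)!`.
    rw [sum_congr rfl h1, sum_const, hn, nsmul_eq_mul, Nat.factorial_succ]
    push_cast
    ring

omit [Fintype V] [DecidableEq V] in
-- Setting `u = 0` is a ring homomorphism; this evaluates the boundary terms of the functional
-- equations.
lemma map_constantCoeff_subst (φ : ℚ⟦X⟧) {K : ℚ⟦X⟧⟦X⟧} (hK : constantCoeff K = 0) :
    map constantCoeff (φ.subst K) = φ.subst (map constantCoeff K) := by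
  ext n
  have hK' : constantCoeff (map constantCoeff K) = 0 := by
    rw [← coeff_zero_eq_constantCoeff_apply] at hK ⊢
    simp [hK]
  rw [coeff_map, coeff_subst_eq_sum φ hK le_rfl, coeff_subst_eq_sum φ hK' le_rfl, map_sum]
  refine sum_congr rfl fun k _ => ?_
  rw [← map_pow, coeff_map]
  simp

/-- For `b = 0` no excess is discarded, so `K = F`, and `F(z,0) = g`. Coefficient extraction leaves
out only the boundary term `A(0) φ(F(z,0)) = φ(g)`. -/
lemma catalytic_of_treeSum {A φ g : ℚ⟦X⟧} (hA : constantCoeff A = 1)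
    (hw : ∀ k, w k = k.factorial * coeff k φ)
    (hg0 : constantCoeff g = 0)
    (hg : ∀ n, n ≠ 0 → (n.factorial : ℚ) * coeff n g
      = treeSum w (fun j => coeff j A) 0 (univ : Finset (Fin n)) 0) : Catalytic A φ g := by
  obtain ⟨F, hF0, hrec⟩ := exists_tree_series A φ 0
  have hK : innerHighPart 0 F = F := by
    ext n e; simp [innerHighPart, highPart]
  have hgF : map constantCoeff F = g := by
    ext n
    rcases eq_or_ne n 0 with rfl | hn
    · rw [coeff_map, coeff_zero_eq_constantCoeff_apply, hF0]
      simp [hg0]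
    · have hnf : (n.factorial : ℚ) ≠ 0 := by exact_mod_cast n.factorial_ne_zero
      apply mul_left_cancel₀ hnf
      rw [hg n hn, treeSum_eq_factorial_mul_coeff hw (fun _ => rfl) hF0 hrec]
      simp
  rw [hK] at hrec
  refine ⟨hg0, F, hF0, ?_⟩
  ext n e
  rcases n with _ | n
  · simp [hF0]
  rw [coeff_C_mul, coeff_succ_X_mul, map_sub, coeff_C_mul, coeff_map, ← hgF,
    ← map_constantCoeff_subst φ hF0, coeff_map]
  rcases e with _ | e
  · simp [hA]
  · rw [coeff_succ_X_mul, hrec, map_sub, coeff_C]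
    simp

/-- For `b = 1` exactly the trees of excess zero are discarded, so `K = F - g` vanishes at `u = 0`,
and the boundary term is `A(0) φ(0) = 1`. -/
lemma primeCatalytic_of_treeSum {A φ g : ℚ⟦X⟧} (hA : constantCoeff A = 1)
    (hφ : constantCoeff φ = 1) (hw : ∀ k, w k = k.factorial * coeff k φ)
    (hg0 : constantCoeff g = 0)
    (hg : ∀ n, n ≠ 0 → (n.factorial : ℚ) * coeff n g
      = treeSum w (fun j => coeff j A) 1 (univ : Finset (Fin n)) 0) : PrimeCatalytic A φ g := by
  obtain ⟨F, hF0, hrec⟩ := exists_tree_series A φ 1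
  have hgF : ∀ n, constantCoeff (coeff n F) = coeff n g := by
    intro n
    rcases eq_or_ne n 0 with rfl | hn
    · rw [coeff_zero_eq_constantCoeff_apply, hF0]
      simp [hg0]
    · have hnf : (n.factorial : ℚ) ≠ 0 := by exact_mod_cast n.factorial_ne_zero
      apply mul_left_cancel₀ hnf
      rw [hg n hn, treeSum_eq_factorial_mul_coeff hw (fun _ => rfl) hF0 hrec]
      simp
  have hK : innerHighPart 1 F + map C g = F := by
    ext n e
    simp only [innerHighPart, highPart, map_add, coeff_mk, coeff_map, coeff_C]
    rcases e with _ | e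
    · simp [← hgF]
    · simp
  have hK0 := constantCoeff_innerHighPart (b := 1) hF0
  have hK1 : map constantCoeff (innerHighPart 1 F) = 0 := by
    ext n
    rw [coeff_map, innerHighPart, coeff_mk, ← coeff_zero_eq_constantCoeff_apply, highPart]
    simp
  have hconst : ∀ n, constantCoeff (coeff n (φ.subst (innerHighPart 1 F)))
      = coeff n (1 : ℚ⟦X⟧) := by
    intro n
    rw [← coeff_map, map_constantCoeff_subst φ hK0, hK1]
    rw [coeff_subst_eq_sum φ (by simp) le_rfl, sum_range_succ']
    simp [hφ]
  refine ⟨_, hK0, ?_⟩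
  rw [hK]
  ext n e
  rcases n with _ | n
  · simp [hF0]
  rw [coeff_C_mul, coeff_succ_X_mul, map_sub, coeff_C_mul]
  rcases e with _ | e
  · simp only [coeff_zero_eq_constantCoeff_apply, map_sub, map_mul, hA, hconst]
    simp only [coeff_one]
    split_ifs <;> simp
  · rw [coeff_succ_X_mul, hrec, map_sub, coeff_one]
    split_ifs <;> simp [coeff_one]

end Counting
end TreeParking

namespace TreeParking
open Finset

/-! ### Preference sequences with prescribed loads -/

section Fibers

variable {ι V : Type*} [Fintype ι] [Fintype V] [DecidableEq V]

/-- The sizes of the fibers of a function. -/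
def fiberCard (s : ι → V) (v : V) : ℕ := #{i | s i = v}

omit [Fintype V] in
lemma sum_fiberCard (s : ι → V) (D : Finset V) :
    ∑ v ∈ D, fiberCard s v = #{i | s i ∈ D} := by
  have h := card_eq_sum_card_fiberwise (s := ({i | s i ∈ D} : Finset ι)) (f := s) (t := D)
    (fun i hi => by simpa using hi)
  rw [h]
  refine sum_congr rfl fun v hv => ?_
  rw [fiberCard, filter_filter]
  congr 1
  ext i
  simp only [mem_filter, mem_univ, true_and]
  constructor
  · rintro rfl; exact ⟨hv, rfl⟩
  · exact fun h => h.2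

lemma fiberCard_mem_piAntidiag (s : ι → V) :
    fiberCard s ∈ piAntidiag univ (Fintype.card ι) := by
  rw [mem_piAntidiag]
  refine ⟨?_, fun _ _ => mem_univ _⟩
  change ∑ v, fiberCard s v = _
  rw [sum_fiberCard]
  simp

/-- The number of functions with given sizes of the fibers. -/
lemma card_fiberCard_eq [DecidableEq ι] {m : V → ℕ}
    (hm : m ∈ piAntidiag univ (Fintype.card ι)) :
    #{s : ι → V | fiberCard s = m} = Nat.multinomial univ m := by
  -- The power of the sum of variables `X v` is expanded by the multinomial theorem and as a sum
  -- over functions; the coefficients of the monomial with exponents `m` are compared.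
  have h := sum_pow_eq_sum_piAntidiag (univ : Finset V) (fun v => (MvPolynomial.X v : MvPolynomial V ℕ))
    (Fintype.card ι)
  have h1 : (∑ v, (MvPolynomial.X v : MvPolynomial V ℕ)) ^ Fintype.card ι
      = ∑ s : ι → V, ∏ v, (MvPolynomial.X v) ^ fiberCard s v := by
    rw [← card_univ, ← prod_const, prod_univ_sum, Fintype.piFinset_univ]
    refine sum_congr rfl fun s _ => ?_
    rw [prod_comp (fun v => (MvPolynomial.X v : MvPolynomial V ℕ)) s]
    refine prod_subset (subset_univ _) fun v _ hv => ?_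
    have : #{i | s i = v} = 0 := by
      rw [card_eq_zero, filter_eq_empty_iff]
      rintro i - rfl
      exact hv (mem_image_of_mem s (mem_univ i))
    simp [this]
  have hX : ∀ m' : V → ℕ, ∏ v, (MvPolynomial.X v : MvPolynomial V ℕ) ^ m' v
      = MvPolynomial.monomial (Finsupp.equivFunOnFinite.symm m') 1 := by
    intro m'
    rw [MvPolynomial.monomial_eq, MvPolynomial.C_1, one_mul, Finsupp.prod_fintype _ _ (by simp)]
    rfl
  have h2 := congrArg (MvPolynomial.coeff (Finsupp.equivFunOnFinite.symm m)) (h1.symm.trans h)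
  simp only [hX, MvPolynomial.coeff_sum, MvPolynomial.coeff_monomial, EmbeddingLike.apply_eq_iff_eq,
    ← map_natCast (MvPolynomial.C (σ := V) (R := ℕ)), MvPolynomial.coeff_C_mul] at h2
  rw [card_filter, h2, sum_eq_single m]
  · simp
  · intro m' _ hne
    simp [hne]
  · exact fun h => absurd hm h

open Classical in
lemma card_fiberCard_pred [DecidableEq ι] (R : (V → ℕ) → Prop) :
    Nat.card {s : ι → V // R (fiberCard s)}
      = ∑ m ∈ piAntidiag univ (Fintype.card ι) with R m, Nat.multinomial univ m := by
  rw [Nat.card_eq_fintype_card, Fintype.card_subtype,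
    card_eq_sum_card_fiberwise (f := fiberCard)
      (t := {m ∈ piAntidiag univ (Fintype.card ι) | R m})]
  · refine sum_congr rfl fun m hm => ?_
    rw [← card_fiberCard_eq (mem_filter.1 hm).1, filter_filter]
    congr 1
    ext s
    simp only [mem_filter, mem_univ, true_and, and_iff_right_iff_imp]
    rintro rfl
    exact (mem_filter.1 hm).2
  · intro s hs
    exact mem_filter.2 ⟨fiberCard_mem_piAntidiag s, (mem_filter.1 hs).2⟩

omit [Fintype V] in
lemma fiberCard_comp_perm (s : ι → V) (σ : Equiv.Perm ι) : fiberCard (s ∘ σ) = fiberCard s := by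
  funext v
  refine card_bij (fun i _ => σ i) ?_ ?_ ?_
  · intro i hi; simpa using hi
  · intro i _ j _ h; exact σ.injective h
  · intro j hj
    exact ⟨σ.symm j, by simpa using hj, by simp⟩

lemma eq_of_monotone_of_fiberCard_eq {n : ℕ} {V : Type*} [Fintype V] [LinearOrder V]
    {s t : Fin n → V} (hs : Monotone s) (ht : Monotone t) (h : fiberCard s = fiberCard t) :
    s = t := by
  have hperm : (List.ofFn s).Perm (List.ofFn t) := by
    rw [← Multiset.coe_eq_coe, ← Fin.univ_val_map, ← Fin.univ_val_map]
    ext v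
    rw [Multiset.count_map, Multiset.count_map]
    have := congrFun h v
    simpa only [fiberCard, card_def, filter_val, eq_comm] using this
  exact List.ofFn_injective
    (hperm.eq_of_sortedLE hs.sortedLE_ofFn ht.sortedLE_ofFn)

open Classical in
-- Sorting any sequence with load `m` gives a monotone one, and a monotone sequence is determined by
-- its load.
lemma card_monotone_fiberCard_pred {n : ℕ} {V : Type*} [Fintype V] [LinearOrder V]
    (R : (V → ℕ) → Prop) :
    Nat.card {s : Fin n → V // R (fiberCard s) ∧ Monotone s}
      = #{m ∈ piAntidiag (univ : Finset V) n | R m} := by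
  rw [Nat.card_eq_fintype_card, Fintype.card_subtype]
  refine card_bij (fun s _ => fiberCard s) ?_ ?_ ?_
  · intro s hs
    have := fiberCard_mem_piAntidiag s
    rw [Fintype.card_fin] at this
    exact mem_filter.2 ⟨this, (mem_filter.1 hs).2.1⟩
  · intro s hs t ht h
    exact eq_of_monotone_of_fiberCard_eq (mem_filter.1 hs).2.2 (mem_filter.1 ht).2.2 h
  · intro m hm
    obtain ⟨hm, hR⟩ := mem_filter.1 hm
    have hcard := card_fiberCard_eq (ι := Fin n) (m := m) (by rwa [Fintype.card_fin])
    have hpos := Nat.multinomial_pos (univ : Finset V) m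
    rw [← hcard, card_pos] at hpos
    obtain ⟨s, hs⟩ := hpos
    have hs' : fiberCard s = m := (mem_filter.1 hs).2
    have hsort : fiberCard (s ∘ Tuple.sort s) = m := by rw [fiberCard_comp_perm, hs']
    refine ⟨s ∘ Tuple.sort s, mem_filter.2 ⟨mem_univ _, ?_, Tuple.monotone_sort s⟩, hsort⟩
    rw [hsort]
    exact hR

end Fibers

/-! ### Arrangements of children -/

section Arrangements

/-- The number of arrangements of `k` children. -/
def numArr : TreeFamily → ℕ → ℕ
  | .ordered, k => k.factorial
  | .unordered, _ => 1
  | .dary d, k => d.descFactorial k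
  | .dbundled d, k => k.factorial * d.multichoose k

lemma card_piAntidiag_univ (d k : ℕ) : #(piAntidiag (univ : Finset (Fin d)) k) = d.multichoose k := by
  rw [← map_sym_eq_piAntidiag, card_map, sym_univ, card_univ, Sym.card_sym_eq_multichoose,
    Fintype.card_fin]

instance (F : TreeFamily) (C : Type) [Finite C] : Finite (F.Arrangement C) := by
  cases F <;> unfold TreeFamily.Arrangement <;> infer_instance

lemma card_arrangement (F : TreeFamily) (C : Type) [Finite C] :
    Nat.card (F.Arrangement C) = numArr F (Nat.card C) := by
  classical
  have := Fintype.ofFinite C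
  have hequiv : ∀ D : Type, [Finite D] →
      Nat.card (Fin (Nat.card D) ≃ D) = (Nat.card D).factorial := by
    intro D _
    have := Fintype.ofFinite D
    rw [Nat.card_eq_fintype_card, Fintype.card_equiv (Finite.equivFin D).symm]
    simp
  cases F with
  | ordered => exact hequiv C
  | unordered =>
    change Nat.card Unit = 1
    simp
  | dary d =>
    change Nat.card (C ↪ Fin d) = d.descFactorial (Nat.card C)
    rw [Nat.card_eq_fintype_card, Fintype.card_embedding_eq, Fintype.card_fin,
      Nat.card_eq_fintype_card]
  | dbundled d =>
    change Nat.card (Σ b : C → Fin d,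
      ∀ j : Fin d, Fin (Nat.card {c : C // b c = j}) ≃ {c : C // b c = j})
      = (Nat.card C).factorial * d.multichoose (Nat.card C)
    rw [Nat.card_sigma]
    have h1 : ∀ b : C → Fin d, Nat.card (∀ j : Fin d,
        Fin (Nat.card {c : C // b c = j}) ≃ {c : C // b c = j})
        = ∏ j, (fiberCard b j).factorial := by
      intro b
      rw [Nat.card_pi]
      refine prod_congr rfl fun j _ => ?_
      rw [hequiv, Nat.card_eq_fintype_card, Fintype.card_subtype, fiberCard]
    -- For fixed bundle sizes `m`, the multinomial number of assignments times the orders within the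
    -- bundles is `(Nat.card C)!`, whatever `m` is. It remains to count the vectors `m`.
    rw [sum_congr rfl fun b _ => h1 b, ← card_piAntidiag_univ, Nat.card_eq_fintype_card,
      ← sum_fiberwise_of_maps_to (fun b _ => fiberCard_mem_piAntidiag b), mul_comm,
      ← smul_eq_mul, ← sum_const]
    refine sum_congr rfl fun m hm => ?_
    have h2 : ∀ b ∈ ({b | fiberCard b = m} : Finset (C → Fin d)),
        ∏ j, (fiberCard b j).factorial = ∏ j, (m j).factorial := by
      intro b hb
      rw [(mem_filter.1 hb).2]
    rw [sum_congr rfl h2, sum_const, card_fiberCard_eq hm, smul_eq_mul, mul_comm,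
      Nat.multinomial_spec, (mem_piAntidiag.1 hm).1]

open PowerSeries in
/-- The exponential generating function of the numbers of arrangements. -/
noncomputable def degreeSeries : TreeFamily → ℚ⟦X⟧
  | .ordered => powSeries (-1) 1
  | .unordered => exp ℚ
  | .dary d => powSeries 1 d
  | .dbundled d => powSeries (-1) d

/-- The parameter of the family is positive. -/
def TreeFamily.Valid : TreeFamily → Prop
  | ordered => True
  | unordered => True
  | dary d => 1 ≤ d
  | dbundled d => 1 ≤ d

open PowerSeries in
lemma coeff_powSeries_one (d k : ℕ) : coeff k (powSeries 1 d) = d.choose k := by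
  rw [powSeries, map_one, one_mul, one_mul, fpow, add_sub_cancel_left, X_subst,
    binomialSeries_coeff, Ring.choose_natCast]
  simp

open PowerSeries in
lemma coeff_powSeries_neg_one {d : ℕ} (hd : 1 ≤ d) (k : ℕ) :
    coeff k (powSeries (-1) d) = d.multichoose k := by
  have h1 : powSeries (-1) d = ((1 - X) ^ d)⁻¹ := by
    rw [powSeries, map_neg, map_one, neg_one_mul, neg_one_mul, ← sub_eq_add_neg,
      fpow_neg (by simp), fpow_natCast (by simp)]
  have h2 : ((1 - X : ℚ⟦X⟧) ^ d)⁻¹ = (invOneSubPow ℚ d).val := by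
    rw [PowerSeries.inv_eq_iff_mul_eq_one (by simp), ← invOneSubPow_inv_eq_one_sub_pow]
    exact (invOneSubPow ℚ d).val_inv
  rw [h1, h2, invOneSubPow_val_eq_mk_sub_one_add_choose_of_pos ℚ d hd, coeff_mk,
    Nat.multichoose_eq, Nat.choose_symm_of_eq_add (show d - 1 + k = (d - 1) + k from rfl),
    show d + k - 1 = d - 1 + k by omega]

open PowerSeries in
lemma numArr_eq {F : TreeFamily} (hF : F.Valid) (k : ℕ) :
    (numArr F k : ℚ) = k.factorial * coeff k (degreeSeries F) := by
  cases F with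
  | ordered => simp [numArr, degreeSeries, coeff_powSeries_neg_one]
  | unordered =>
    have : (k.factorial : ℚ) ≠ 0 := by exact_mod_cast k.factorial_ne_zero
    simp [numArr, degreeSeries, coeff_exp, this]
  | dary d =>
    simp only [numArr, degreeSeries, coeff_powSeries_one, Nat.descFactorial_eq_factorial_mul_choose]
    push_cast; ring
  | dbundled d =>
    simp only [numArr, degreeSeries, coeff_powSeries_neg_one hF]
    push_cast; ring

open PowerSeries in
lemma constantCoeff_degreeSeries (F : TreeFamily) : constantCoeff (degreeSeries F) = 1 := by
  cases F <;> simp [degreeSeries, powSeries, constantCoeff_fpow]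

end Arrangements

/-! ### Counting labelled trees with preferences -/

section Labelled

variable {F : TreeFamily} {n : ℕ}

lemma RootedTree.ext_parent {T T' : RootedTree n} (h : T.parent = T'.parent) : T = T' := by
  have hr : T.root = T'.root := by
    obtain ⟨k, hk⟩ := T'.reaches_root T.root
    rw [← h, T.iterate_parent_root] at hk
    exact hk
  cases T; cases T'
  simp only at h hr
  subst h hr
  rfl

instance : Finite (RootedTree n) :=
  Finite.of_injective RootedTree.parent fun _ _ => RootedTree.ext_parent

noncomputable instance : Fintype (RootedTree n) := Fintype.ofFinite _

/-- Parking does not see the arrangement of the children, so the arrangements contribute an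
independent factor at each node. -/
lemma card_labelledTree_pred (Q : RootedTree n → (Fin n → Fin n) → Prop) :
    Nat.card {p : LabelledTree F n × (Fin n → Fin n) // Q p.1.toRootedTree p.2}
      = ∑ T : RootedTree n, (∏ v, numArr F (Nat.card (T.Child v))) * Nat.card {s // Q T s} := by
  let e : {p : LabelledTree F n × (Fin n → Fin n) // Q p.1.toRootedTree p.2}
      ≃ Σ T : RootedTree n, (∀ v, F.Arrangement (T.Child v)) × {s // Q T s} :=
    { toFun := fun p => ⟨p.1.1.toRootedTree, p.1.1.arr, ⟨p.1.2, p.2⟩⟩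
      invFun := fun x => ⟨(⟨x.1, x.2.1⟩, x.2.2.1), x.2.2.2⟩
      left_inv := fun _ => rfl
      right_inv := fun _ => rfl }
  rw [Nat.card_congr e, Nat.card_sigma]
  refine sum_congr rfl fun T _ => ?_
  rw [Nat.card_prod, Nat.card_pi]
  congr 1
  exact prod_congr rfl fun v _ => card_arrangement _ _

lemma RootedTree.parent_eq_self_iff (T : RootedTree n) (v : Fin n) :
    T.parent v = v ↔ v = T.root := by
  constructor
  · intro h
    exact T.eq_root_of_iterate_eq one_pos h
  · rintro rfl
    exact T.parent_root

lemma RootedTree.isForest (T : RootedTree n) : IsForest univ T.parent := by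
  refine ⟨fun v hv => absurd (mem_univ v) hv, fun v _ => mem_univ _, fun v => ?_⟩
  obtain ⟨k, hk⟩ := T.reaches_root v
  exact ⟨k, by rw [hk, T.parent_root]⟩

lemma RootedTree.rootsOf_parent (T : RootedTree n) : rootsOf univ T.parent = {T.root} := by
  ext v
  simp [mem_rootsOf, T.parent_eq_self_iff]

/-- Given that the parent of `c` is `v`, being different from the root and being different from `v`
are the same, as the root is the only fixed point. -/
lemma RootedTree.card_child (T : RootedTree n) (v : Fin n) :
    Nat.card (T.Child v) = #(kids T.parent v) := by
  rw [Nat.card_eq_fintype_card, Fintype.card_subtype, kids]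
  congr 1
  ext c
  simp only [mem_filter, mem_univ, true_and]
  refine and_congr_left fun hc => not_congr ?_
  constructor
  · rintro rfl
    rw [← hc, T.parent_root]
  · rintro rfl
    exact (T.parent_eq_self_iff c).1 hc

/-- The number of drivers who start in a subtree exceeds its size by at least `b`, for all
subtrees except for the whole tree. -/
def RootedTree.Loaded (b : ℕ) (T : RootedTree n) (m : Fin n → ℕ) : Prop :=
  ∀ v, T.parent v ≠ v → Balanced b T.parent m v

lemma RootedTree.allPark_iff_loaded (T : RootedTree n) (s : Fin n → Fin n) :
    T.AllPark s ↔ T.Loaded 0 (fiberCard s) := by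
  classical
  rw [T.allPark_iff]
  constructor
  · intro h v _
    rw [Balanced, add_zero, sum_fiberCard]
    convert h v
  · intro h v
    by_cases hv : T.parent v = v
    -- At the root the condition is automatic: there are `n` drivers and `n` nodes.
    · rw [(T.parent_eq_self_iff v).1 hv, T.desc_root]
      simp
    · have := h v hv
      rw [Balanced, add_zero, sum_fiberCard] at this
      convert this

lemma RootedTree.allEdgesUsed_iff_loaded (T : RootedTree n) (s : Fin n → Fin n) :
    (T.AllPark s ∧ T.AllEdgesUsed s) ↔ T.Loaded 1 (fiberCard s) := by
  classical
  have h1 : T.Loaded 1 (fiberCard s) ↔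
      ∀ v, v ≠ T.root → #(desc T.parent v) < #{i | s i ∈ desc T.parent v} := by
    refine forall_congr' fun v => ?_
    rw [Ne, T.parent_eq_self_iff, Balanced, sum_fiberCard, Nat.succ_le_iff]
  constructor
  · rintro ⟨h, h'⟩
    rw [h1]
    rw [T.allEdgesUsed_iff s h] at h'
    convert h'
  · intro h
    have hp : T.AllPark s := by
      rw [T.allPark_iff_loaded]
      intro v hv
      exact (Nat.le_succ _).trans (h v hv)
    refine ⟨hp, ?_⟩
    rw [T.allEdgesUsed_iff s hp]
    convert h1.1 h

open Classical in
/-- The sum over the trees on `Fin n` as a sum over rooted trees. -/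
lemma treeSum_univ_eq (w a : ℕ → ℚ) (b : ℕ) :
    treeSum w a b (univ : Finset (Fin n)) 0
      = ∑ T : RootedTree n, (∏ v, w (Nat.card (T.Child v))) *
        ∑ m ∈ piAntidiag (univ : Finset (Fin n)) n with T.Loaded b m, ∏ v, a (m v) := by
  simp only [mul_sum, sum_sigma']
  rw [treeSum]
  symm
  refine sum_bij (fun x _ => (x.1.parent, x.2)) ?_ ?_ ?_ ?_
  · rintro ⟨T, m⟩ hx
    simp only [mem_sigma, mem_univ, true_and, mem_filter, mem_piAntidiag] at hx
    rw [mem_treeConf]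
    refine ⟨⟨?_, fun v _ => mem_univ v⟩, T.isForest, ?_, fun v _ hv => hx.2 v hv⟩
    · rw [card_univ, Fintype.card_fin]
      exact hx.1.1
    · simp [T.rootsOf_parent]
  · rintro ⟨T, m⟩ _ ⟨T', m'⟩ _ h
    simp only [Prod.mk.injEq] at h
    obtain rfl := RootedTree.ext_parent h.1
    obtain rfl := h.2
    rfl
  · rintro ⟨p, m⟩ hx
    rw [mem_treeConf] at hx
    obtain ⟨⟨hm, -⟩, hp, hone, hb⟩ := hx
    obtain ⟨r, hr⟩ := card_eq_one.1 hone
    have hr' : r ∈ rootsOf univ p := by rw [hr]; exact mem_singleton_self r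
    let T : RootedTree n :=
      { root := r
        parent := p
        parent_root := (mem_rootsOf.1 hr').2
        reaches_root := fun v => by
          obtain ⟨k, hk⟩ := hp.2.2 v
          have : p^[k] v ∈ rootsOf univ p := mem_rootsOf.2 ⟨mem_univ _, hk⟩
          rw [hr, mem_singleton] at this
          exact ⟨k, this⟩ }
    refine ⟨⟨T, m⟩, ?_, rfl⟩
    simp only [mem_sigma, mem_univ, true_and, mem_filter, mem_piAntidiag]
    rw [card_univ, Fintype.card_fin] at hm
    exact ⟨⟨hm, fun _ _ => trivial⟩, fun v hv => hb v (mem_univ v) hv⟩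
  · rintro ⟨T, m⟩ _
    simp only [weight, prod_mul_distrib, T.card_child]

lemma multinomial_cast {m : Fin n → ℕ} (hm : m ∈ piAntidiag univ n) :
    (Nat.multinomial univ m : ℚ) = n.factorial * ∏ v, (1 / (m v).factorial : ℚ) := by
  have h := Nat.multinomial_spec univ m
  rw [(mem_piAntidiag.1 hm).1] at h
  have h0 : (∏ v, ((m v).factorial : ℚ)) ≠ 0 :=
    prod_ne_zero_iff.2 fun v _ => by exact_mod_cast (m v).factorial_ne_zero
  have h' : (∏ v, ((m v).factorial : ℚ)) * Nat.multinomial univ m = n.factorial := by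
    exact_mod_cast h
  simp only [one_div, prod_inv_distrib]
  rw [← h']
  field_simp

/-- A load arises from `n! / ∏ (m v)!` sequences. The denominators give the weights `1 / j!`, and
the extra `n!` is why the generating function is doubly exponential. -/
lemma card_loaded_eq (b : ℕ) {Q : RootedTree n → (Fin n → Fin n) → Prop}
    (hQ : ∀ T s, Q T s ↔ T.Loaded b (fiberCard s)) :
    (Nat.card {p : LabelledTree F n × (Fin n → Fin n) // Q p.1.toRootedTree p.2} : ℚ)
      = n.factorial * treeSum (fun k => numArr F k) (fun j => 1 / j.factorial) b
        (univ : Finset (Fin n)) 0 := by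
  classical
  rw [card_labelledTree_pred, treeSum_univ_eq, mul_sum]
  push_cast
  refine sum_congr rfl fun T _ => ?_
  rw [mul_left_comm]
  congr 1
  simp only [hQ]
  rw [card_fiberCard_pred, Fintype.card_fin, mul_sum]
  push_cast
  exact sum_congr rfl fun m hm => multinomial_cast (mem_filter.1 hm).1

/-- Each load comes from exactly one monotone sequence, hence all load weights are `1`. -/
lemma card_loaded_monotone_eq (b : ℕ) {Q : RootedTree n → (Fin n → Fin n) → Prop}
    (hQ : ∀ T s, Q T s ↔ T.Loaded b (fiberCard s)) :
    (Nat.card {p : LabelledTree F n × (Fin n → Fin n) //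
        Q p.1.toRootedTree p.2 ∧ Monotone p.2} : ℚ)
      = treeSum (fun k => numArr F k) (fun _ => 1) b (univ : Finset (Fin n)) 0 := by
  classical
  rw [card_labelledTree_pred (fun T s => Q T s ∧ Monotone s), treeSum_univ_eq]
  push_cast
  refine sum_congr rfl fun T _ => ?_
  congr 1
  simp only [hQ]
  rw [card_monotone_fiberCard_pred]
  simp

end Labelled

/-! ### The functional equations for the generating functions -/

section FunctionalEquations

open PowerSeries

variable {F : TreeFamily}

lemma coeff_exp_eq : (fun j => coeff j (exp ℚ)) = fun j : ℕ => (1 / j.factorial : ℚ) := by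
  funext j; simp [coeff_exp]

lemma coeff_geom_eq : (fun j => coeff j ((1 - X : ℚ⟦X⟧)⁻¹)) = fun _ : ℕ => (1 : ℚ) := by
  have : (1 - X : ℚ⟦X⟧)⁻¹ = PowerSeries.mk 1 := by
    rw [PowerSeries.inv_eq_iff_mul_eq_one (by simp)]
    exact mk_one_mul_one_sub_eq_one ℚ
  funext j
  simp [this]

lemma constantCoeff_doubleExpGF (a : ℕ → ℕ) : constantCoeff (doubleExpGF a) = 0 := by
  rw [← coeff_zero_eq_constantCoeff_apply]; simp [doubleExpGF]

lemma constantCoeff_expGF (a : ℕ → ℕ) : constantCoeff (expGF a) = 0 := by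
  rw [← coeff_zero_eq_constantCoeff_apply]; simp [expGF]

lemma factorial_mul_coeff_doubleExpGF {a : ℕ → ℕ} {c : ℚ} {n : ℕ} (hn : n ≠ 0)
    (h : (a n : ℚ) = n.factorial * c) : (n.factorial : ℚ) * coeff n (doubleExpGF a) = c := by
  have hnf : (n.factorial : ℚ) ≠ 0 := by exact_mod_cast n.factorial_ne_zero
  rw [doubleExpGF, coeff_mk, if_neg hn, h]
  field_simp

lemma factorial_mul_coeff_expGF {a : ℕ → ℕ} {n : ℕ} (hn : n ≠ 0) :
    (n.factorial : ℚ) * coeff n (expGF a) = a n := by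
  have hnf : (n.factorial : ℚ) ≠ 0 := by exact_mod_cast n.factorial_ne_zero
  rw [expGF, coeff_mk, if_neg hn]
  field_simp

lemma catalytic_G (hF : F.Valid) : Catalytic (exp ℚ) (degreeSeries F) (G F) := by
  refine catalytic_of_treeSum (by simp) (numArr_eq hF) (constantCoeff_doubleExpGF _)
    fun n hn => factorial_mul_coeff_doubleExpGF hn ?_
  rw [coeff_exp_eq]
  exact card_loaded_eq 0 fun T s => T.allPark_iff_loaded s

lemma primeCatalytic_P (hF : F.Valid) : PrimeCatalytic (exp ℚ) (degreeSeries F) (P F) := by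
  refine primeCatalytic_of_treeSum (by simp) (constantCoeff_degreeSeries F) (numArr_eq hF)
    (constantCoeff_doubleExpGF _) fun n hn => factorial_mul_coeff_doubleExpGF hn ?_
  rw [coeff_exp_eq]
  exact card_loaded_eq 1 fun T s => T.allEdgesUsed_iff_loaded s

lemma catalytic_Gt (hF : F.Valid) : Catalytic ((1 - X)⁻¹) (degreeSeries F) (Gt F) := by
  refine catalytic_of_treeSum (by simp) (numArr_eq hF) (constantCoeff_expGF _) fun n hn => ?_
  rw [coeff_geom_eq, Gt, factorial_mul_coeff_expGF hn]
  exact card_loaded_monotone_eq 0 fun T s => T.allPark_iff_loaded s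

lemma primeCatalytic_Pt (hF : F.Valid) : PrimeCatalytic ((1 - X)⁻¹) (degreeSeries F) (Pt F) := by
  refine primeCatalytic_of_treeSum (by simp) (constantCoeff_degreeSeries F) (numArr_eq hF)
    (constantCoeff_expGF _) fun n hn => ?_
  rw [coeff_geom_eq, Pt, factorial_mul_coeff_expGF hn]
  exact card_loaded_monotone_eq 1 fun T s => T.allEdgesUsed_iff_loaded s

end FunctionalEquations

end TreeParking

theorem theorem1 :
    -- tree parking functions
    ImplicitForm (G .ordered) (1 - ((1 - q) * (1 + q) * fexp q)⁻¹) ((1 + q) ^ 2 * fexp q) ∧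
    ImplicitForm (G .unordered) (2 * q + fln (1 - q)) (fexp (2 * q)) ∧
    (∀ d : ℕ, 1 ≤ d → ImplicitForm (G (.dary d))
      (fpow (1 - d * q) (1 / d) * fexp q * (1 - q)⁻¹ - 1)
      (fexp (d * q) * ((1 - q) ^ (d - 1))⁻¹)) ∧
    (∀ d : ℕ, 1 ≤ d → ImplicitForm (G (.dbundled d))
      (1 - (fpow (1 - d * q) (1 / d) * (1 + q) * fexp q)⁻¹)
      ((1 + q) ^ (d + 1) * fexp (d * q))) ∧
    -- prime tree parking functions
    ImplicitForm (P .ordered) ((1 + q) * (1 - q) * fexp q - 1) ((1 - q) ^ 2 * fexp q)⁻¹ ∧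
    ImplicitForm (P .unordered) (2 * q + fln (1 - q)) (1 - q)⁻¹ ∧
    (∀ d : ℕ, 1 ≤ d → ImplicitForm (P (.dary d))
      (1 - (1 - q) * (fpow (1 - d * q) (1 / d) * fexp q)⁻¹)
      (fexp q * (fpow (1 - d * q) ((d - 1) / d))⁻¹)) ∧
    (∀ d : ℕ, 1 ≤ d → ImplicitForm (P (.dbundled d))
      (fpow (1 - d * q) (1 / d) * (1 + q) * fexp q - 1)
      (fpow (1 - d * q) ((d + 1) / d) * fexp q)⁻¹) ∧
    -- tree parking distributions
    ImplicitForm (Gt .ordered) (1 - ((1 + q) ^ 2 * (1 - q))⁻¹) ((1 + q) ^ 4) ∧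
    ImplicitForm (Gt .unordered) (q + fln (1 + q) + fln (1 - q)) ((1 + q) ^ 2 * fexp q) ∧
    (∀ d : ℕ, 1 ≤ d → ImplicitForm (Gt (.dary d))
      (fpow (1 - q ^ 2) (1 / d) * (1 - (1 / d : ℚ) • q)⁻¹ - 1)
      (d * (1 + q) ^ 2 * ((1 - (1 / d : ℚ) • q) ^ (d - 1))⁻¹)) ∧
    (∀ d : ℕ, 1 ≤ d → ImplicitForm (Gt (.dbundled d))
      (1 - ((1 + (1 / d : ℚ) • q) * fpow (1 - q ^ 2) (1 / d))⁻¹)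
      (d * (1 + q) ^ 2 * (1 + (1 / d : ℚ) • q) ^ (d + 1))) ∧
    -- prime tree parking distributions
    ImplicitForm (Pt .ordered) ((1 + q) ^ 2 * (1 - q) - 1) ((1 - q) ^ 2)⁻¹ ∧
    ImplicitForm (Pt .unordered) (q + fln (1 + q) + fln (1 - q)) ((1 + q) * (1 - q)⁻¹) ∧
    (∀ d : ℕ, 1 ≤ d → ImplicitForm (Pt (.dary d))
      (1 - (1 - (1 / d : ℚ) • q) * (fpow (1 - q ^ 2) (1 / d))⁻¹)
      (d * fpow (1 + q) ((d + 1) / d) * (fpow (1 - q) ((d - 1) / d))⁻¹)) ∧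
    (∀ d : ℕ, 1 ≤ d → ImplicitForm (Pt (.dbundled d))
      ((1 + (1 / d : ℚ) • q) * fpow (1 - q ^ 2) (1 / d) - 1)
      (d * fpow (1 + q) ((d - 1) / d) * (fpow (1 - q) ((d + 1) / d))⁻¹)) :=
  ⟨implicit_ordered_exp (catalytic_G (F := .ordered) trivial),
    implicit_unordered_exp (catalytic_G (F := .unordered) trivial),
    fun d hd => implicit_dary_exp (by omega) (catalytic_G (F := .dary d) hd),
    fun d hd => implicit_dbundled_exp (by omega) (catalytic_G (F := .dbundled d) hd),
    implicit_ordered_exp_prime (primeCatalytic_P (F := .ordered) trivial),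
    implicit_unordered_exp_prime (primeCatalytic_P (F := .unordered) trivial),
    fun d hd => implicit_dary_exp_prime (by omega) (primeCatalytic_P (F := .dary d) hd),
    fun d hd => implicit_dbundled_exp_prime (by omega) (primeCatalytic_P (F := .dbundled d) hd),
    implicit_ordered_geom (catalytic_Gt (F := .ordered) trivial),
    implicit_unordered_geom (catalytic_Gt (F := .unordered) trivial),
    fun d hd => implicit_dary_geom (by omega) (catalytic_Gt (F := .dary d) hd),
    fun d hd => implicit_dbundled_geom (by omega) (catalytic_Gt (F := .dbundled d) hd),
    implicit_ordered_geom_prime (primeCatalytic_Pt (F := .ordered) trivial),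
    implicit_unordered_geom_prime (primeCatalytic_Pt (F := .unordered) trivial),
    fun d hd => implicit_dary_geom_prime (by omega) (primeCatalytic_Pt (F := .dary d) hd),
    fun d hd => implicit_dbundled_geom_prime (by omega) (primeCatalytic_Pt (F := .dbundled d) hd)⟩
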